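/- All graphs are finite and simple. For a set $F$ of edges, $d_F(v)$ is the number of edges of $F$ incident to $v$; $F$ is \emph{Eulerian} if $d_F(v)$ is even for every vertex $v$. For a graph $H$, a set $X$ of vertices and positive integers $r,q$, an \emph{$(X,r,q)$-factor} of $H$ is a set $F\subseteq E(H)$ with $d_F(v)=(r/q)\,d_H(v)$ for every $v\in X$. If $q-\ell$ is a positive even number and $\ell\ge 1$, an \emph{$(X,\ell,q)$-fractional factorization} of $H$ is a partition $\{M_1,\dots,M_\ell,F_1,\dots,F_{(q-\ell)/2}\}$ of $E(H)$ in which every $M_i$ is an $(X,1,q)$-factor of $H$ and every $F_j$ is an Eulerian $(X,2,q)$-factor of $H$. Let $G=(A_1,A_2;E)$ be a bipartite graph. An \emph{$(\ell,q)$-bifactorization} of $G$ is a pair $\mathbb F=(\mathcal F_1,\mathcal F_2)$ of families of subsets of $E$ such that, with $E_i=\bigcup_{F\in\mathcal F_i}F$ and $G_i=G[E_i]$, the sets $E_1,E_2$ are disjoint with $E_1\cup E_2=E$, and $\mathcal F_i$ is an $(A_i,\ell,q)$-fractional factorization of $G_i$ for $i=1,2$. Let $p=1$ if $\ell$ is odd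 and $p=2$ if $\ell$ is even; $\mathbb F$ is \emph{strong} if $d_{E_i}(v)\ge (q/p)\big((q/p)+p\big)$ for every $v\in A_i$, $i=1,2$. A \emph{$t$-path tracking decomposition} of $G$ is a set $\mathcal B$ of pairwise edge-disjoint vertex sequences $x_0x_1\cdots x_t$ of paths of length $t$ in $G$ that together cover all edges of $G$. For a vertex $v$, $\mathcal B(v)$ is the number of members of $\mathcal B$ in which $v$ has odd degree plus twice the number of members with $x_0=x_t=v$ (so $\mathcal B(v)$ counts the ends of members of $\mathcal B$ at $v$). \textbf{Theorem.} Let $k$ be a positive integer, and let $G=(A_1,A_2;E)$ be a bipartite graph with a strong $\big(2,2(2k+2)\big)$-bifactorization $\mathbb F=(\mathcal F_1,\mathcal F_2)$, where $M_i,N_i$ denote the two $\big(A_i,1,2(2k+2)\big)$-factors of the family $\mathcal F_i$. Then $G$ admits a $(2k+2)$-path tracking decomposition $\mathcal B$ that is $\mathbb F$-balanced, that is, \[ \mathcal B(v)=\frac{d_{G_1}(v)}{2k+2}+d_{M_2}(v)+d_{N_2}(v)\ \text{ for every } v\in A_1,\qquad \mathcal B(v)=\frac{d_{G_2}(v)}{2k+2}+d_{M_1}(v)+d_{N_1}(v)\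 \text{ for every } v\in A_2 . \] -/

import Mathlib

open Finset

/-- `d_F(v)`: the number of edges of the edge set `F` that are incident to `v`. -/
def edgeDeg {V : Type*} [DecidableEq V] (F : Finset (Sym2 V)) (v : V) : ℕ :=
  #{e ∈ F | v ∈ e}

/-- `F` is an `(X, r, k)`-factor of the graph with edge set `E`:
`F ⊆ E` and `d_F(v) = (r / k) d_E(v)` for every `v ∈ X`. -/
def IsFactor {V : Type*} [DecidableEq V] (X : Set V) (r k : ℕ) (E F : Finset (Sym2 V)) : Prop :=
  F ⊆ E ∧ ∀ v ∈ X, (edgeDeg F v : ℚ) = (r : ℚ) / (k : ℚ) * (edgeDeg E v : ℚ)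

/-- `F` is Eulerian: every vertex is incident to an even number of edges of `F`. -/
def IsEulerianEdgeSet {V : Type*} [DecidableEq V] (F : Finset (Sym2 V)) : Prop :=
  ∀ v : V, Even (edgeDeg F v)

/-- A family `{M_1, …, M_ℓ, F_1, …, F_{(k-ℓ)/2}}` of edge sets (only the data). -/
structure FactorFamily (V : Type*) (ℓ k : ℕ) where
  M : Fin ℓ → Finset (Sym2 V)
  F : Fin ((k - ℓ) / 2) → Finset (Sym2 V)

/-- All the members of the family, indexed by a sum type. -/
def FactorFamily.part {V : Type*} {ℓ k : ℕ} (𝓕 : FactorFamily V ℓ k) :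
    Fin ℓ ⊕ Fin ((k - ℓ) / 2) → Finset (Sym2 V) :=
  Sum.elim 𝓕.M 𝓕.F

/-- The union of all the members of the family. -/
def FactorFamily.edges {V : Type*} [DecidableEq V] {ℓ k : ℕ} (𝓕 : FactorFamily V ℓ k) :
    Finset (Sym2 V) :=
  univ.biUnion 𝓕.part

/-- The family `𝓕` is an `(X, ℓ, k)`-fractional factorization of the graph with edge set `E`. -/
structure IsFractionalFactorization {V : Type*} [DecidableEq V] {ℓ k : ℕ}
    (X : Set V) (E : Finset (Sym2 V)) (𝓕 : FactorFamily V ℓ k) : Prop where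
  pos : 0 < ℓ
  lt : ℓ < k
  even : Even (k - ℓ)
  disjoint : ∀ a b, a ≠ b → Disjoint (𝓕.part a) (𝓕.part b)
  union : 𝓕.edges = E
  factor_M : ∀ i, IsFactor X 1 k E (𝓕.M i)
  factor_F : ∀ j, IsFactor X 2 k E (𝓕.F j)
  eulerian_F : ∀ j, IsEulerianEdgeSet (𝓕.F j)

/-- `(𝓕₁, 𝓕₂)` is an `(ℓ, k)`-bifactorization of the bipartite graph `G = (A₁, A₂; E)`. Here
`𝓕ᵢ.edges` is the edge set of the graph `Gᵢ` induced by the union of the members of `𝓕ᵢ`. -/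
structure IsBifactorization {V : Type*} [DecidableEq V] {ℓ k : ℕ} (G : SimpleGraph V)
    (A₁ A₂ : Set V) (𝓕₁ 𝓕₂ : FactorFamily V ℓ k) : Prop where
  disjoint : Disjoint 𝓕₁.edges 𝓕₂.edges
  union : (𝓕₁.edges : Set (Sym2 V)) ∪ (𝓕₂.edges : Set (Sym2 V)) = G.edgeSet
  factorization₁ : IsFractionalFactorization A₁ 𝓕₁.edges 𝓕₁
  factorization₂ : IsFractionalFactorization A₂ 𝓕₂.edges 𝓕₂

/-- The bound `(k/p) ((k/p) + p)`, where `p = 1` if `ℓ` is odd and `p = 2` if `ℓ` is even. -/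
def strongBound (ℓ k : ℕ) : ℚ :=
  let p : ℚ := if Odd ℓ then 1 else 2
  ((k : ℚ) / p) * ((k : ℚ) / p + p)

/-- `(𝓕₁, 𝓕₂)` is a strong `(ℓ, k)`-bifactorization of `G = (A₁, A₂; E)`. -/
structure IsStrongBifactorization {V : Type*} [DecidableEq V] {ℓ k : ℕ} (G : SimpleGraph V)
    (A₁ A₂ : Set V) (𝓕₁ 𝓕₂ : FactorFamily V ℓ k) : Prop
    extends IsBifactorization G A₁ A₂ 𝓕₁ 𝓕₂ where
  strong₁ : ∀ v ∈ A₁, strongBound ℓ k ≤ (edgeDeg 𝓕₁.edges v : ℚ)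
  strong₂ : ∀ v ∈ A₂, strongBound ℓ k ≤ (edgeDeg 𝓕₂.edges v : ℚ)

/-- A tracking `x_0 x_1 ⋯ x_ℓ` in `G`: the sequence of vertices of a trail (a walk without
repeated edges), with its two end-vertices `x_0 = start` and `x_ℓ = finish`. -/
structure Tracking {V : Type*} (G : SimpleGraph V) where
  start : V
  finish : V
  walk : G.Walk start finish
  isTrail : walk.IsTrail

/-- The edge set `E(B)` of a tracking. -/
def Tracking.edgeFinset {V : Type*} [DecidableEq V] {G : SimpleGraph V} (B : Tracking G) :
    Finset (Sym2 V) :=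
  B.walk.edges.toFinset

/-- `𝓑` is an `ℓ`-path tracking decomposition of `G`: its members are trackings of paths of
length `ℓ`, distinct members are edge-disjoint, and together they cover all edges of `G`. -/
structure IsPathTrackingDecomposition {V : Type*} [DecidableEq V] {G : SimpleGraph V}
    (ℓ : ℕ) (𝓑 : Finset (Tracking G)) : Prop where
  isPath : ∀ B ∈ 𝓑, B.walk.IsPath
  length : ∀ B ∈ 𝓑, B.walk.length = ℓ
  disjoint : ∀ B ∈ 𝓑, ∀ B' ∈ 𝓑, B ≠ B' → Disjoint B.edgeFinset B'.edgeFinset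
  union : ∀ e : Sym2 V, e ∈ G.edgeSet ↔ ∃ B ∈ 𝓑, e ∈ B.edgeFinset

/-- `𝓑(v) = 𝓑_odd(v) + 2 𝓑_even(v)`: here `𝓑_odd(v)` is the number of members of `𝓑` in which `v`
has odd degree, and `𝓑_even(v)` the number of members with both end-vertices equal to `v`. -/
def endCount {V : Type*} [DecidableEq V] {G : SimpleGraph V}
    (𝓑 : Finset (Tracking G)) (v : V) : ℕ :=
  #{B ∈ 𝓑 | Odd (edgeDeg B.edgeFinset v)} + 2 * #{B ∈ 𝓑 | B.start = v ∧ B.finish = v}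

/-- `𝓑` is `𝔽`-balanced for the `(2, 2(2k+2))`-bifactorization `𝔽 = (𝓕₁, 𝓕₂)`. The two
`(Aᵢ, 1, 2(2k+2))`-factors of `𝓕ᵢ` are `𝓕ᵢ.M 0` and `𝓕ᵢ.M 1`. -/
def IsBalanced {V : Type*} [DecidableEq V] {G : SimpleGraph V} {k : ℕ} (A₁ A₂ : Set V)
    (𝓕₁ 𝓕₂ : FactorFamily V 2 (2 * (2 * k + 2))) (𝓑 : Finset (Tracking G)) : Prop :=
  (∀ v ∈ A₁, (endCount 𝓑 v : ℚ) = (edgeDeg 𝓕₁.edges v : ℚ) / (2 * (k : ℚ) + 2)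
    + (edgeDeg (𝓕₂.M 0) v : ℚ) + (edgeDeg (𝓕₂.M 1) v : ℚ)) ∧
  (∀ v ∈ A₂, (endCount 𝓑 v : ℚ) = (edgeDeg 𝓕₂.edges v : ℚ) / (2 * (k : ℚ) + 2)
    + (edgeDeg (𝓕₁.M 0) v : ℚ) + (edgeDeg (𝓕₁.M 1) v : ℚ))

/-!
The edges are distributed over two classes, one for the paths with both ends in `A₂` and one for the
paths with both ends in `A₁`. The first class consists of the two `(A₁, 1, 2(2k+2))`-factors of
`𝓕₁`, of `k` Eulerian members of `𝓕₁` and of `k + 1` Eulerian members of `𝓕₂`; the second class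
arises by exchanging `1` and `2` and taking the complementary Eulerian members.

Consider the first class. Every Eulerian edge set of a bipartite graph splits into two sets with
equal degrees (`exists_split`). Recombining the halves (`exists_ladder`) arranges the edges of the
class in levels `U 0, …, U k` (`exists_levels`). The edges of `U t` are meant to be the edges at
distance `t` from the ends of the paths, on both sides, so that a path visits each level twice and
has `2k + 2` edges. The vertex of such an edge nearer to the centre lies alternately in `A₁` and
`A₂`, and the levels are such that at these vertices the degrees of `U t` and `U (t + 1)` agree and
are at least `2k + 4`, by strongness, while the degrees of `U k` at the centres are even. So the
edges of `U k` can be paired at the centres (`exists_pairing`), and `U (k - 1), …, U 0` are used to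
prolong the paths at both ends (`exists_path_system`). The number of path ends at `y ∈ A₂` is then
the degree of `y` in `U 0`, which is the required one.

The point is that prolonging at random creates closed walks, because the new end may already lie on
the path. `IsHanging.exists_extension` shows that this can be avoided. Given paths with ends in `X`
and as many *hanging* edges `xy` at every `x ∈ X` as there are path ends at `x`, the vertices
`y ∈ Y` are processed one at a time, and the path ends are *labelled* by the vertices to which they
will be prolonged. A path through `y` with end `x` and entering `y` from `x'` on that side can be
rerouted: if `xy` is hanging, it may use `xy` instead of `x'y`, which moves its end to `x'` and
makes `x'y` hanging (`IsAltPath.exists_entry`). Thus each vertex `x` whose edge `xy` is hanging, or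
which is the vertex before `y` on such a path, is a *client*. It is offered two ends, one of which
it must use up: an end whose path avoids `y` is labelled by `y`, whereas an end whose path contains
`y` is rerouted, or stays as it is if the client is the vertex from which `y` is entered. Every end,
and every path avoiding `y`, is an option of at most two clients, so Hall's theorem gives a
consistent choice (`exists_injective_choice_of_two_options`, `exists_service`), and the result is
again a labelling (`IsService.labelling`).

For two offers to exist until the end, an invariant is needed (`Budget`): a vertex `x` may lose an
end and a hanging edge `xy` by rerouting, but then `x` records `y` as *lost*, and all but few of its
unlabelled ends belong to paths through all the lost vertices. As a path contains at most `k`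
vertices of `Y`, the number of ends at `x` cannot drop too far.
-/

set_option linter.unusedSectionVars false

/-! ### Choices from two options and greedy list colouring -/

/-- Every client `x ∈ s` has two distinct options `f x` and `g x`, and no option is shared by more
than two clients; then the clients can choose pairwise distinct options. Among the choices, one with
the most `f`s leaves no option `f x` unused, because otherwise `x` could switch to it. -/
theorem exists_injective_choice_of_two_options {α β γ : Type*} [DecidableEq α] [DecidableEq γ]
    (s : Finset α) (f g : α → β) (srv : β → γ)
    (hne : ∀ x ∈ s, srv (f x) ≠ srv (g x))
    (htwo : ∀ c, #{x ∈ s | srv (f x) = c ∨ srv (g x) = c} ≤ 2) :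
    ∃ h : α → β, (∀ x ∈ s, h x = f x ∨ h x = g x) ∧
      (∀ x ∈ s, ∀ x' ∈ s, srv (h x) = srv (h x') → x = x') ∧
      ∀ x ∈ s, ∃ w ∈ s, srv (h w) = srv (f x) := by
  classical
  have hall : ∃ t : s → γ, Function.Injective t ∧
      ∀ x, t x ∈ (fun x : s => ({srv (f x), srv (g x)} : Finset γ)) x := by
    rw [← Finset.all_card_le_biUnion_card_iff_exists_injective]
    intro u
    -- Double counting of the pairs consisting of a client of `u` and one of its options.
    have h1 : ∑ x ∈ u, #{c ∈ u.biUnion (fun x : s => ({srv (f x), srv (g x)} : Finset γ)) |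
        srv (f x) = c ∨ srv (g x) = c} = ∑ x ∈ u, 2 := by
      refine Finset.sum_congr rfl fun x hx => ?_
      rw [← Finset.card_pair (hne x x.2)]
      congr 1
      ext c
      simp only [mem_filter, mem_biUnion, mem_insert, mem_singleton]
      constructor
      · rintro ⟨-, h | h⟩ <;> simp [h]
      · intro h
        exact ⟨⟨x, hx, h⟩, by rcases h with h | h <;> simp [h]⟩
    have h2 := Finset.sum_card_bipartiteAbove_eq_sum_card_bipartiteBelow (s := u)
      (t := u.biUnion (fun x : s => ({srv (f x), srv (g x)} : Finset γ)))
      (fun (x : s) c => srv (f x) = c ∨ srv (g x) = c)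
    simp only [Finset.bipartiteAbove, Finset.bipartiteBelow] at h2
    rw [h1] at h2
    have h3 : ∑ c ∈ u.biUnion (fun x : s => ({srv (f x), srv (g x)} : Finset γ)),
        #{x : s | x ∈ u ∧ (srv (f x) = c ∨ srv (g x) = c)} ≤
        ∑ c ∈ u.biUnion (fun x : s => ({srv (f x), srv (g x)} : Finset γ)), 2 := by
      refine Finset.sum_le_sum fun c _ => le_trans ?_ (htwo c)
      refine Finset.card_le_card_of_injOn (fun x : s => (x : α)) ?_ Subtype.val_injective.injOn
      intro x hx
      simp only [coe_filter, Set.mem_ofPred_eq, mem_univ, true_and] at hx ⊢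
      exact ⟨x.2, hx.2⟩
    have h4 : ∀ c, #(u.filter fun x : s => srv (f x) = c ∨ srv (g x) = c) =
        #{x : s | x ∈ u ∧ (srv (f x) = c ∨ srv (g x) = c)} := fun c =>
      congrArg card (by ext x; simp)
    simp only [h4] at h2
    rw [← h2] at h3
    simp only [Finset.sum_const, smul_eq_mul] at h3
    omega
  obtain ⟨t, tinj, ht⟩ := hall
  let good (h : α → Bool) : Prop := ∀ x ∈ s, ∀ x' ∈ s,
    srv (if h x then f x else g x) = srv (if h x' then f x' else g x') → x = x'
  have hgood : ∃ h, good h := by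
    have key : ∀ x (hx : x ∈ s), srv (if srv (f x) = (if hx : x ∈ s then t ⟨x, hx⟩ else srv (f x))
        then f x else g x) = t ⟨x, hx⟩ := by
      intro x hx
      have := ht ⟨x, hx⟩
      simp only [mem_insert, mem_singleton] at this
      simp only [hx, dif_pos]
      split_ifs with h
      · exact h
      · rcases this with h' | h'
        · exact absurd h'.symm h
        · exact h'.symm
    refine ⟨fun x => decide (srv (f x) = (if hx : x ∈ s then t ⟨x, hx⟩ else srv (f x))), ?_⟩
    intro x hx x' hx' h
    simp only [decide_eq_true_eq] at h
    rw [key x hx, key x' hx'] at h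
    exact congrArg Subtype.val (tinj h)
  have hmax : ∃ h, good h ∧ ∀ h', good h' → #{x ∈ s | h' x = true} ≤ #{x ∈ s | h x = true} := by
    by_contra hcon
    push Not at hcon
    have : ∀ n, ∃ h, good h ∧ n ≤ #{x ∈ s | h x = true} := by
      intro n
      induction n with
      | zero => obtain ⟨h, hh⟩ := hgood; exact ⟨h, hh, Nat.zero_le _⟩
      | succ n ih =>
        obtain ⟨h, hh, hn⟩ := ih
        obtain ⟨h', hh', hlt⟩ := hcon h hh
        exact ⟨h', hh', by omega⟩
    obtain ⟨h, -, hn⟩ := this (#s + 1)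
    have := card_filter_le s (fun x => h x = true)
    omega
  obtain ⟨h, hh, hm⟩ := hmax
  refine ⟨fun x => if h x then f x else g x, ?_, hh, ?_⟩
  · intro x _
    by_cases hx : h x <;> simp [hx]
  · intro x hx
    by_contra hcon
    push Not at hcon
    have hx0 : h x = false := by
      by_contra hx1
      have hx1 : h x = true := by simpa using hx1
      exact hcon x hx (by simp [hx1])
    have hg' : good (Function.update h x true) := by
      intro u hu u' hu' e
      by_cases h1 : u = x <;> by_cases h2 : u' = x
      · rw [h1, h2]
      · subst h1
        simp only [Function.update_self, Function.update_of_ne h2, if_true] at e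
        exact absurd e.symm (hcon u' hu')
      · subst h2
        simp only [Function.update_self, Function.update_of_ne h1, if_true] at e
        exact absurd e (hcon u hu)
      · simp only [Function.update_of_ne h1, Function.update_of_ne h2] at e
        exact hh u hu u' hu' e
    have := hm _ hg'
    have hlt : #{u ∈ s | h u = true} < #{u ∈ s | Function.update h x true u = true} := by
      apply Finset.card_lt_card
      rw [Finset.ssubset_iff_of_subset]
      · exact ⟨x, by simp [hx], by simp [hx0]⟩
      · intro u hu
        simp only [mem_filter] at hu ⊢
        refine ⟨hu.1, ?_⟩
        by_cases hux : u = x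
        · simp [hux]
        · simpa [Function.update_of_ne hux] using hu.2
    omega

/-- Greedy list colouring: if every vertex has more colours in its list than neighbours in `s`,
then the vertices of `s` can be coloured properly from their lists. -/
theorem exists_list_coloring {α β : Type*} [DecidableEq α] [DecidableEq β] [Nonempty β]
    (s : Finset α) (adj : α → α → Prop) [DecidableRel adj] (symm : ∀ x y, adj x y → adj y x)
    (irrefl : ∀ x, ¬ adj x x)
    (L : α → Finset β) (hL : ∀ x ∈ s, #{y ∈ s | adj x y} < #(L x)) :
    ∃ c : α → β, (∀ x ∈ s, c x ∈ L x) ∧ ∀ x ∈ s, ∀ y ∈ s, adj x y → c x ≠ c y := by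
  suffices H : ∀ t ⊆ s, ∃ c : α → β, (∀ x ∈ t, c x ∈ L x) ∧
      ∀ x ∈ t, ∀ y ∈ t, adj x y → c x ≠ c y from H s subset_rfl
  intro t
  induction t using Finset.induction_on with
  | empty => intro _; exact ⟨fun _ => Classical.arbitrary β, by simp, by simp⟩
  | insert a t ha ih =>
    intro hts
    obtain ⟨c, hc1, hc2⟩ := ih ((subset_insert a t).trans hts)
    have has : a ∈ s := hts (mem_insert_self a t)
    have : ({y ∈ s | adj a y}.image c).card < #(L a) := lt_of_le_of_lt card_image_le (hL a has)
    obtain ⟨b, hb, hb'⟩ := exists_mem_notMem_of_card_lt_card this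
    simp only [mem_image, mem_filter, not_exists, not_and, and_imp] at hb'
    have key : ∀ x ∈ t, Function.update c a b x = c x := fun x hx =>
      Function.update_of_ne (fun h : x = a => ha (h ▸ hx)) _ _
    refine ⟨Function.update c a b, ?_, ?_⟩
    · intro x hx
      rcases mem_insert.1 hx with rfl | hx
      · simpa using hb
      · rw [key x hx]; exact hc1 x hx
    · intro x hx y hy hxy
      rcases mem_insert.1 hx with rfl | hx'
      · rcases mem_insert.1 hy with rfl | hy'
        · exact absurd hxy (irrefl _)
        · rw [key y hy', Function.update_self]
          exact fun h => hb' y (hts hy) hxy h.symm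
      · rcases mem_insert.1 hy with rfl | hy'
        · rw [key x hx', Function.update_self]
          exact hb' x (hts hx) (symm _ _ hxy)
        · rw [key x hx', key y hy']
          exact hc2 x hx' y hy' hxy

/-! ### The budget of a vertex -/

/-- The budget of a vertex `x` during the labelling process. Here `arms` is the set of path ends
currently at `x`, `op` the set of those that carry no label yet, and `lost` the set of the vertices
whose hanging edge at `x` was absorbed by a path; `S α` is the vertex set of the path of the end
`α`. An end is *unclean* if its path misses a lost vertex. The field `size` says that every end that
`x` has lost is accounted for by a lost vertex. If more than `k` vertices were lost, no path could
contain them all; the field `reserve` is what remains available in that case. -/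
structure Budget {V β : Type*} [DecidableEq V] (k : ℕ) (S : β → Finset V)
    (arms op : Finset β) (lost : Finset V) : Prop where
  size : 2 * k + 4 ≤ #arms + #lost
  unclean : #{α ∈ op | ¬ lost ⊆ S α} + 2 * k + 4 ≤ 1 + #arms + #lost
  reserve : #lost ≤ k ∨ #op + k + 2 ≤ #arms

section Budget

variable {V β : Type*} [DecidableEq V] [DecidableEq β] {k : ℕ} {S : β → Finset V}
  {arms op : Finset β} {lost : Finset V}

/-- When few ends are unlabelled, many are labelled. -/
theorem Budget.le_card_arms (h : Budget k S arms op lost) (hop : #op ≤ 2) :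
    #op + k + 2 ≤ #arms := by
  have := h.size
  rcases h.reserve with h | h <;> omega

theorem Budget.erase_open {C : β} (h : Budget k S arms op lost) :
    Budget k S arms (op.erase C) lost where
  size := h.size
  unclean := by
    have : #{α ∈ op.erase C | ¬ lost ⊆ S α} ≤ #{α ∈ op | ¬ lost ⊆ S α} :=
      card_le_card (filter_subset_filter _ (erase_subset _ _))
    have := h.unclean
    omega
  reserve := by
    have := card_le_card (erase_subset C op)
    rcases h.reserve with h | h
    · exact Or.inl h
    · right; omega

/-- If `x` has at least two open ends, then two of them can be offered such that the budget survives
the loss of either. If at most one open end avoids `y`, then this one is offered together with an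
end through `y` that is unclean if possible: then `x` loses an unclean end, and the only end that
becomes unclean is the one avoiding `y`. -/
theorem Budget.exists_pair {Y : Finset V} {y : V} (h : Budget k S arms op lost) (hop : op ⊆ arms)
    (h2 : 2 ≤ #op) (hy : y ∉ lost) (hY : insert y lost ⊆ Y) (hS : ∀ α, #(S α ∩ Y) ≤ k) :
    ∃ A ∈ op, ∃ B ∈ op, A ≠ B ∧ ∀ C, C = A ∨ C = B → y ∈ S C →
      Budget k S (arms.erase C) (op.erase C) (insert y lost) := by
  by_cases hfree : 2 ≤ #{α ∈ op | y ∉ S α}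
  · obtain ⟨A, hA, B, hB, hAB⟩ := one_lt_card.1 (show 1 < #{α ∈ op | y ∉ S α} by omega)
    simp only [mem_filter] at hA hB
    refine ⟨A, hA.1, B, hB.1, hAB, ?_⟩
    rintro C (rfl | rfl) hC
    · exact absurd hC hA.2
    · exact absurd hC hB.2
  push Not at hfree
  -- It suffices to control the number of unclean ends after the step.
  suffices H : ∃ A ∈ op, ∃ B ∈ op, A ≠ B ∧ ∀ C, C = A ∨ C = B → y ∈ S C →
      #{α ∈ op.erase C | ¬ insert y lost ⊆ S α} + 2 * k + 4 ≤ 1 + #arms + #lost by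
    obtain ⟨A, hA, B, hB, hAB, H⟩ := H
    refine ⟨A, hA, B, hB, hAB, fun C hC hyC => ?_⟩
    have hCop : C ∈ op := by rcases hC with rfl | rfl <;> assumption
    have e1 := card_erase_of_mem (hop hCop)
    have e2 := card_erase_of_mem hCop
    have e3 := card_insert_of_notMem hy
    have p1 : 0 < #op := card_pos.2 ⟨C, hCop⟩
    have p2 : 0 < #arms := card_pos.2 ⟨C, hop hCop⟩
    refine ⟨by have := h.size; omega, by have := H C hC hyC; omega, ?_⟩
    rcases h.reserve with hr | hr
    · by_cases hc : ∃ α ∈ op, lost ⊆ S α ∧ y ∈ S α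
      · obtain ⟨α, -, hα, hyα⟩ := hc
        left
        refine (card_le_card ?_).trans (hS α)
        exact subset_inter (insert_subset hyα hα) hY
      · push Not at hc
        have hle : #op ≤ #{α ∈ op | ¬ lost ⊆ S α} + #{α ∈ op | y ∉ S α} := by
          refine (card_le_card ?_).trans (card_union_le _ _)
          intro α hα
          by_cases hl : lost ⊆ S α
          · exact mem_union_right _ (mem_filter.2 ⟨hα, hc α hα hl⟩)
          · exact mem_union_left _ (mem_filter.2 ⟨hα, hl⟩)
        have := h.unclean
        right; omega
    · right; omega
  have hsize := h.size
  have hun := h.unclean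
  have hsub : {α ∈ op | ¬ insert y lost ⊆ S α} ⊆
      {α ∈ op | ¬ lost ⊆ S α} ∪ {α ∈ op | y ∉ S α} := by
    intro α
    simp only [mem_filter, mem_union, insert_subset_iff]
    tauto
  by_cases hu : ∃ u ∈ op, y ∉ S u
  · obtain ⟨u, hu, hyu⟩ := hu
    have honly : ∀ α ∈ op, y ∉ S α → α = u := fun α hα hyα =>
      card_le_one.1 (by omega : #{α ∈ op | y ∉ S α} ≤ 1) α (by simp [hα, hyα]) u (by simp [hu, hyu])
    by_cases hn : ∃ α ∈ op, y ∈ S α ∧ ¬ lost ⊆ S α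
    · obtain ⟨A, hA, hyA, hlA⟩ := hn
      refine ⟨A, hA, u, hu, fun e => hyu (e ▸ hyA), ?_⟩
      rintro C (rfl | rfl) hC
      · have : #{α ∈ op.erase C | ¬ insert y lost ⊆ S α} ≤ #{α ∈ op | ¬ lost ⊆ S α} := by
          have hm : C ∈ {α ∈ op | ¬ lost ⊆ S α} := by simp [hA, hlA]
          have h1 : {α ∈ op.erase C | ¬ insert y lost ⊆ S α} ⊆
              insert u ({α ∈ op | ¬ lost ⊆ S α}.erase C) := by
            intro α hα
            simp only [mem_filter, mem_erase, mem_insert, insert_subset_iff] at hα ⊢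
            by_cases hyα : y ∈ S α
            · right; exact ⟨hα.1.1, hα.1.2, fun h' => hα.2 ⟨hyα, h'⟩⟩
            · left; exact honly α hα.1.2 hyα
          have h2 := card_le_card h1
          have h3 := card_insert_le u ({α ∈ op | ¬ lost ⊆ S α}.erase C)
          have h4 := card_erase_add_one hm
          omega
        omega
      · exact absurd hC hyu
    · push Not at hn
      obtain ⟨A, hA, hAu⟩ : ∃ A ∈ op, A ≠ u := exists_mem_ne (by omega) u
      refine ⟨A, hA, u, hu, hAu, ?_⟩
      rintro C (rfl | rfl) hC
      · have : {α ∈ op.erase C | ¬ insert y lost ⊆ S α} ⊆ {u} := by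
          intro α hα
          simp only [mem_filter, mem_erase, mem_singleton, insert_subset_iff] at hα ⊢
          by_contra hαu
          have hyα : y ∈ S α := by
            by_contra hyα; exact hαu (honly α hα.1.2 hyα)
          exact hα.2 ⟨hyα, hn α hα.1.2 hyα⟩
        have := card_le_card this
        simp only [card_singleton] at this
        omega
      · exact absurd hC hyu
  · push Not at hu
    obtain ⟨A, hA, B, hB, hAB⟩ := one_lt_card.1 (show 1 < #op by omega)
    refine ⟨A, hA, B, hB, hAB, fun C _ _ => ?_⟩
    have : #{α ∈ op.erase C | ¬ insert y lost ⊆ S α} ≤ #{α ∈ op | ¬ lost ⊆ S α} := by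
      refine card_le_card fun α hα => ?_
      simp only [mem_filter, mem_erase, insert_subset_iff] at hα ⊢
      exact ⟨hα.1.2, fun h' => hα.2 ⟨hu α hα.1.2, h'⟩⟩
    omega

/-- If `x` receives the end `A`, then it can dispose of one of its open ends, unclean if possible,
whether this one leaves `x` or becomes labelled at `x`. -/
theorem Budget.exists_swap {A : β} (h : Budget k S arms op lost) (hop : op ⊆ arms)
    (hne : op.Nonempty) (hA : A ∉ arms) :
    ∃ B ∈ op, Budget k S ((insert A arms).erase B) ((insert A op).erase B) lost ∧
      Budget k S (insert A arms) ((insert A op).erase B) lost := by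
  have hAop : A ∉ op := fun h' => hA (hop h')
  have hsize := h.size
  have hun := h.unclean
  suffices H : ∃ B ∈ op, #{α ∈ (insert A op).erase B | ¬ lost ⊆ S α} + 2 * k + 4 ≤
      1 + #arms + #lost by
    obtain ⟨B, hB, H⟩ := H
    have e1 : #((insert A arms).erase B) = #arms := by
      rw [card_erase_of_mem (mem_insert_of_mem (hop hB)), card_insert_of_notMem hA]; rfl
    have e2 : #((insert A op).erase B) = #op := by
      rw [card_erase_of_mem (mem_insert_of_mem hB), card_insert_of_notMem hAop]; rfl
    have e3 : #(insert A arms) = #arms + 1 := card_insert_of_notMem hA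
    refine ⟨B, hB, ⟨by omega, by omega, ?_⟩, ⟨by omega, by omega, ?_⟩⟩
    · rw [e1, e2]; exact h.reserve
    · rw [e2, e3]
      rcases h.reserve with h | h
      · exact Or.inl h
      · right; omega
  by_cases hn : ∃ B ∈ op, ¬ lost ⊆ S B
  · obtain ⟨B, hB, hlB⟩ := hn
    refine ⟨B, hB, ?_⟩
    have hm : B ∈ {α ∈ op | ¬ lost ⊆ S α} := by simp [hB, hlB]
    have h1 : {α ∈ (insert A op).erase B | ¬ lost ⊆ S α} ⊆
        insert A ({α ∈ op | ¬ lost ⊆ S α}.erase B) := by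
      intro α
      simp only [mem_filter, mem_erase, mem_insert]
      tauto
    have h2 := card_le_card h1
    have h3 := card_insert_le A ({α ∈ op | ¬ lost ⊆ S α}.erase B)
    have h4 := card_erase_add_one hm
    omega
  · push Not at hn
    obtain ⟨B, hB⟩ := hne
    refine ⟨B, hB, ?_⟩
    have h1 : {α ∈ (insert A op).erase B | ¬ lost ⊆ S α} ⊆ {A} := by
      intro α
      simp only [mem_filter, mem_erase, mem_insert, mem_singleton]
      rintro ⟨⟨-, h | h⟩, h'⟩
      · exact h
      · exact absurd (hn α h) h'
    have := card_le_card h1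
    simp only [card_singleton] at this
    omega

/-- The budget after a step in which all the ends at `x` have become labelled. -/
theorem Budget.of_op_empty (h1 : 2 * k + 4 ≤ #arms + #lost) (h2 : #lost ≤ k ∨ k + 2 ≤ #arms) :
    Budget k S arms ∅ lost where
  size := h1
  unclean := by simp; omega
  reserve := by simpa using h2

end Budget

/-! ### Labellings of path ends -/

/-- The other end of the path to which an end belongs. -/
def partner {ι : Type*} (α : ι × Bool) : ι × Bool := (α.1, !α.2)

@[simp] theorem partner_partner {ι : Type*} (α : ι × Bool) : partner (partner α) = α := by
  simp [partner]

@[simp] theorem partner_fst {ι : Type*} (α : ι × Bool) : (partner α).1 = α.1 := rfl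

theorem partner_ne {ι : Type*} (α : ι × Bool) : partner α ≠ α := by
  intro h
  have := congrArg Prod.snd h
  simp [partner] at this

theorem eq_or_eq_partner {ι : Type*} {α β : ι × Bool} (h : α.1 = β.1) : α = β ∨ α = partner β := by
  obtain ⟨i, a⟩ := α
  obtain ⟨j, b⟩ := β
  obtain rfl : i = j := h
  cases a <;> cases b <;> simp [partner]

/-- The path ends located at `x`. -/
def endsAt {V ι : Type*} [DecidableEq V] [Fintype ι] (loc : ι × Bool → V) (x : V) :
    Finset (ι × Bool) :=
  {α | loc α = x}

/-- The path ends located at `x` that carry no label. -/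
def openEnds {V ι : Type*} [DecidableEq V] [Fintype ι] (loc : ι × Bool → V)
    (lab : ι × Bool → Option V) (x : V) : Finset (ι × Bool) :=
  {α | loc α = x ∧ lab α = none}

@[simp] theorem mem_endsAt {V ι : Type*} [DecidableEq V] [Fintype ι] {loc : ι × Bool → V} {x : V}
    {α : ι × Bool} : α ∈ endsAt loc x ↔ loc α = x := by
  simp [endsAt]

@[simp] theorem mem_openEnds {V ι : Type*} [DecidableEq V] [Fintype ι] {loc : ι × Bool → V}
    {lab : ι × Bool → Option V} {x : V} {α : ι × Bool} :
    α ∈ openEnds loc lab x ↔ loc α = x ∧ lab α = none := by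
  simp [openEnds]

/-- The combinatorial shadow of a system of paths between the sides `X` and `Y` together with sets
of hanging edges: the path `i` has vertex set `S i` and the ends `(i, false)` and `(i, true)`,
located at `loc (i, false)` and `loc (i, true)` in `X`, and `E x ⊆ Y` is the set of the neighbours
of `x` along hanging edges. -/
structure EndSystem {V ι : Type*} [DecidableEq V] (k : ℕ) (X Y : Finset V) (S : ι → Finset V)
    (loc : ι × Bool → V) (E : V → Finset V) : Prop where
  card_le : ∀ i, #(S i ∩ Y) ≤ k
  hang_subset : ∀ x, E x ⊆ Y
  mem_of_hang : ∀ x y, y ∈ E x → x ∈ X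
  loc_mem : ∀ α, loc α ∈ X
  exists_notMem : ∀ α, ∃ w ∈ S α.1 ∩ Y, w ∉ E (loc α)
  loc_ne : ∀ α, loc (partner α) ≠ loc α

/-- A partial assignment `lab` of the hanging edges to the path ends: the end `α` is to be prolonged
by the edge from `loc α` to `lab α`. The hanging edges that lead to the set `D` have already been
assigned, and each end of a path is prolonged to a vertex off the path that differs from the
prolongation of the other end. The edges from `x` to the vertices of `lost x` were hanging until
they were absorbed into a path. -/
structure Labelling {V ι : Type*} [DecidableEq V] [Fintype ι] [DecidableEq ι] (k : ℕ)
    (X D : Finset V) (S : ι → Finset V) (loc : ι × Bool → V) (E : V → Finset V)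
    (lab : ι × Bool → Option V) (lost : V → Finset V) : Prop where
  mem_hang : ∀ α z, lab α = some z → z ∈ E (loc α)
  mem_done : ∀ α z, lab α = some z → z ∈ D
  inj : ∀ α β z, loc α = loc β → lab α = some z → lab β = some z → α = β
  surj : ∀ x z, z ∈ E x → z ∈ D → ∃ α, loc α = x ∧ lab α = some z
  notMem : ∀ α z, lab α = some z → z ∉ S α.1
  ne_partner : ∀ α z, lab α = some z → lab (partner α) ≠ some z
  card_eq : ∀ x ∈ X, #(endsAt loc x) = #(E x)
  lost_subset : ∀ x, lost x ⊆ D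
  budget : ∀ x ∈ X, Budget k (fun α : ι × Bool => S α.1) (endsAt loc x)
    (openEnds loc lab x) (lost x)

section Session

variable {V ι : Type*} [DecidableEq V] [Fintype ι] [DecidableEq ι] {k : ℕ}
  {X Y D : Finset V} {S : ι → Finset V} {loc : ι × Bool → V} {E : V → Finset V}
  {lab : ι × Bool → Option V} {lost : V → Finset V}

/-- The open ends at `x` are as many as the hanging edges at `x` that are yet to be assigned. -/
theorem Labelling.card_open (h : Labelling k X D S loc E lab lost) {x : V} (hx : x ∈ X) :
    #(openEnds loc lab x) = #(E x \ D) := by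
  have h1 : #{α ∈ endsAt loc x | lab α ≠ none} = #(E x ∩ D) := by
    have e : {α ∈ endsAt loc x | lab α ≠ none}.image lab =
        (E x ∩ D).image some := by
      ext o
      simp only [mem_image, mem_filter, mem_endsAt, mem_inter]
      constructor
      · rintro ⟨α, ⟨rfl, hα⟩, rfl⟩
        obtain ⟨z, hz⟩ := Option.ne_none_iff_exists'.1 hα
        exact ⟨z, ⟨h.mem_hang _ _ hz, h.mem_done _ _ hz⟩, hz.symm⟩
      · rintro ⟨z, ⟨hz, hzD⟩, rfl⟩
        obtain ⟨α, hα, hl⟩ := h.surj x z hz hzD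
        exact ⟨α, ⟨hα, by simp [hl]⟩, hl⟩
    rw [← card_image_of_injective (E x ∩ D) (Option.some_injective V), ← e, card_image_of_injOn]
    intro α hα β hβ hαβ
    simp only [coe_filter, mem_endsAt, Set.mem_ofPred_eq] at hα hβ
    obtain ⟨z, hz⟩ := Option.ne_none_iff_exists'.1 hα.2
    exact h.inj α β z (hα.1.trans hβ.1.symm) hz (hαβ ▸ hz)
  have h2 : #(endsAt loc x) = #(openEnds loc lab x) + #{α ∈ endsAt loc x | lab α ≠ none} := by
    rw [openEnds, ← filter_filter]
    exact (card_filter_add_card_filter_not _).symm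
  have h3 := card_inter_add_card_sdiff (E x) D
  have := h.card_eq x hx
  omega

/-- The budget of a client `x` that is offered the ends `A` and `B` and uses up the end `C`. -/
def BudgetAfter (k : ℕ) (S : ι → Finset V) (loc : ι × Bool → V) (E : V → Finset V)
    (lab : ι × Bool → Option V) (lost : V → Finset V) (y x : V) (A B C : ι × Bool) : Prop :=
  Budget k (fun α : ι × Bool => S α.1)
    (if y ∈ S C.1 then (insert A (endsAt loc x)).erase C
      else insert A (endsAt loc x))
    (if lab B = none then (insert A (openEnds loc lab x)).erase C
      else ∅)
    (if y ∈ E x ∧ y ∈ S C.1 then insert y (lost x) else lost x)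

/-- The offers to a single client `x`. If possible, the second end `B` has no label. Otherwise
`B` may be any of the labelled ends at `x`, and because `x` has many ends, at least three
of their labels are not on the path of `A`, to which the label of `B` may have to be moved. -/
theorem exists_options_of_client {near : ι × Bool → V} {y : V}
    (hE : EndSystem k X Y S loc E) (h : Labelling k X D S loc E lab lost)
    (hy : y ∉ D) (hDY : insert y D ⊆ Y) {x : V} (hx : x ∈ X)
    (hcl : y ∈ E x ∨ y ∉ E x ∧ ∃ α : ι × Bool, y ∈ S α.1 ∧ near α = x ∧ loc α ≠ x) :
    ∃ A : ι × Bool, (y ∈ E x ∧ loc A = x ∧ lab A = none ∨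
        y ∉ E x ∧ y ∈ S A.1 ∧ near A = x ∧ loc A ≠ x) ∧
      ((∃ B, loc B = x ∧ A ≠ B ∧ lab B = none ∧
          ∀ C, C = A ∨ C = B → BudgetAfter k S loc E lab lost y x A B C) ∨
        ((∀ α, loc α = x → lab α = none → α = A) ∧ 3 ≤ #{z ∈ E x ∩ D | z ∉ S A.1} ∧
          ∀ B C, loc B = x → lab B ≠ none → C = A ∨ C = B →
            BudgetAfter k S loc E lab lost y x A B C)) := by
  have hb := h.budget x hx
  have hlost : y ∉ lost x := fun h' => hy (h.lost_subset x h')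
  have hop : openEnds loc lab x ⊆ (endsAt loc x) := by
    intro α; simp only [mem_endsAt, mem_openEnds]; tauto
  have hcard := h.card_open hx
  have hcardE := h.card_eq x hx
  have hsplit := card_inter_add_card_sdiff (E x) D
  rcases hcl with hyE | ⟨hyE, A, hyA, hnA, hlA⟩
  · have hpos : 1 ≤ #(openEnds loc lab x) := by
      rw [hcard]; exact card_pos.2 ⟨y, mem_sdiff.2 ⟨hyE, hy⟩⟩
    by_cases h2 : 2 ≤ #(openEnds loc lab x)
    · obtain ⟨A, hA, B, hB, hAB, hC⟩ := hb.exists_pair hop h2 hlost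
        ((insert_subset_insert y (h.lost_subset x)).trans hDY) (fun α => hE.card_le α.1)
      have hA' := hA
      have hB' := hB
      simp only [mem_openEnds] at hA' hB'
      refine ⟨A, Or.inl ⟨hyE, hA'⟩, Or.inl ⟨B, hB'.1, hAB, hB'.2, fun C hC' => ?_⟩⟩
      unfold BudgetAfter
      rw [insert_eq_of_mem hA, insert_eq_of_mem (hop hA), if_pos hB'.2]
      by_cases hyC : y ∈ S C.1
      · simpa [hyC, hyE] using hC C hC' hyC
      · simpa [hyC] using hb.erase_open
    · obtain ⟨A, hA⟩ := card_eq_one.1 (by omega : #(openEnds loc lab x) = 1)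
      have hA' : A ∈ openEnds loc lab x := by simp [hA]
      have hA2 := hA'
      simp only [mem_openEnds] at hA2
      have hn := hb.le_card_arms (by omega)
      refine ⟨A, Or.inl ⟨hyE, hA2⟩, Or.inr ⟨?_, ?_, ?_⟩⟩
      · intro α h1 h2
        have : α ∈ openEnds loc lab x := by simp [h1, h2]
        simpa [hA] using this
      · -- The path of `A` contains a neighbour of `x`, which is not a hanging neighbour of `x`.
        obtain ⟨w, hw, hwE⟩ := hE.exists_notMem A
        rw [hA2.1] at hwE
        have h1 : (E x ∩ D) \ {z ∈ E x ∩ D | z ∉ S A.1} ⊆ (S A.1 ∩ Y).erase w := by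
          intro z
          simp only [mem_sdiff, mem_inter, mem_filter, mem_erase, not_and, not_not, and_imp]
          intro hz hzD hzS
          exact ⟨fun e => hwE (e ▸ hz), hzS hz hzD, hE.hang_subset x hz⟩
        have h2 := card_le_card h1
        rw [card_erase_of_mem hw] at h2
        have h3 := hE.card_le A.1
        have h4 := card_pos.2 ⟨w, hw⟩
        have h5 := le_card_sdiff {z ∈ E x ∩ D | z ∉ S A.1} (E x ∩ D)
        omega
      · intro B C hB hlB hC
        unfold BudgetAfter
        rw [if_neg hlB, insert_eq_of_mem (hop hA')]
        have hsz := hb.size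
        have hCx : loc C = x := by rcases hC with rfl | rfl; exacts [hA2.1, hB]
        by_cases hyC : y ∈ S C.1
        · simp only [hyC, hyE, and_self, if_true]
          have e1 := card_erase_of_mem (by simp [hCx] : C ∈ endsAt loc x)
          have e2 := card_insert_of_notMem hlost
          exact Budget.of_op_empty (by omega) (by omega)
        · simp only [hyC, and_false, if_false]
          exact Budget.of_op_empty hsz (by omega)
  · have hAarms : A ∉ endsAt loc x := by simp [hlA]
    refine ⟨A, Or.inr ⟨hyE, hyA, hnA, hlA⟩, ?_⟩
    by_cases h2 : 1 ≤ #(openEnds loc lab x)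
    · left
      obtain ⟨B, hB, hB1, hB2⟩ := hb.exists_swap hop (card_pos.1 h2) hAarms
      have hB' := hB
      simp only [mem_openEnds] at hB'
      have hAB : A ≠ B := fun e => hlA (e ▸ hB'.1)
      refine ⟨B, hB'.1, hAB, hB'.2, ?_⟩
      rintro C (rfl | rfl)
      · unfold BudgetAfter
        rw [if_pos hyA, if_pos hB'.2, if_neg (fun h' : y ∈ E x ∧ y ∈ S C.1 => hyE h'.1),
          erase_insert hAarms, erase_insert]
        · exact hb
        · exact fun h' => hAarms (hop h')
      · unfold BudgetAfter
        rw [if_pos hB'.2]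
        by_cases hyC : y ∈ S C.1
        · simpa [hyC, hyE] using hB1
        · simpa [hyC] using hB2
    · right
      have hemp : openEnds loc lab x = ∅ :=
        card_eq_zero.1 (by omega)
      have hn := hb.le_card_arms (by omega)
      refine ⟨?_, ?_, ?_⟩
      · intro α h1 h2
        have : α ∈ openEnds loc lab x := by simp [h1, h2]
        simp [hemp] at this
      · have hw : y ∈ S A.1 ∩ Y := mem_inter.2 ⟨hyA, hDY (mem_insert_self y D)⟩
        have h1 : (E x ∩ D) \ {z ∈ E x ∩ D | z ∉ S A.1} ⊆ (S A.1 ∩ Y).erase y := by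
          intro z
          simp only [mem_sdiff, mem_inter, mem_filter, mem_erase, not_and, not_not, and_imp]
          intro hz hzD hzS
          exact ⟨fun e => hyE (e ▸ hz), hzS hz hzD, hE.hang_subset x hz⟩
        have h2 := card_le_card h1
        rw [card_erase_of_mem hw] at h2
        have h3 := hE.card_le A.1
        have h4 := card_pos.2 ⟨y, hw⟩
        have h5 := le_card_sdiff {z ∈ E x ∩ D | z ∉ S A.1} (E x ∩ D)
        omega
      · intro B C hB hlB hC
        unfold BudgetAfter
        rw [if_neg hlB, if_neg (fun h' : y ∈ E x ∧ y ∈ S C.1 => hyE h'.1)]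
        have hsz := hb.size
        have e1 := card_insert_of_notMem hAarms
        refine Budget.of_op_empty ?_ (Or.inr ?_)
        · by_cases hyC : y ∈ S C.1
          · rw [if_pos hyC, card_erase_of_mem
              (by rcases hC with rfl | rfl <;> simp [hB])]
            omega
          · rw [if_neg hyC]; omega
        · by_cases hyC : y ∈ S C.1
          · rw [if_pos hyC, card_erase_of_mem
              (by rcases hC with rfl | rfl <;> simp [hB])]
            omega
          · rw [if_neg hyC]; omega

end Session

/-! ### The offers made to clients -/

section Options

variable {V ι : Type*} [DecidableEq V] [Fintype ι] [DecidableEq ι] {k : ℕ}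
  {X Y D : Finset V} {S : ι → Finset V} {loc : ι × Bool → V} {E : V → Finset V}
  {lab : ι × Bool → Option V} {lost : V → Finset V}

/-- The vertices `x` that want to be served when the vertex `y` is processed: either the edge `xy`
is hanging, or it is the edge by which a path with an end elsewhere passes from `x` to `y`. -/
def IsClient (X : Finset V) (S : ι → Finset V) (loc near : ι × Bool → V) (E : V → Finset V)
    (y x : V) : Prop :=
  x ∈ X ∧ (y ∈ E x ∨ y ∉ E x ∧ ∃ α : ι × Bool, y ∈ S α.1 ∧ near α = x ∧ loc α ≠ x)

/-- The two ends `A x` and `B x` offered to each client `x` when `y` is processed. If `xy` is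
hanging, then both ends are located at `x`; otherwise `A x` is the end that reaches `y` through `x`.
The client uses one of them for the edge `xy`, and the label of `B x` moves to the other one. -/
structure IsOffer (k : ℕ) (X : Finset V) (S : ι → Finset V) (loc near : ι × Bool → V)
    (E : V → Finset V) (lab : ι × Bool → Option V) (lost : V → Finset V) (y : V)
    (A B : V → ι × Bool) (x : V) : Prop where
  fst : y ∈ E x ∧ loc (A x) = x ∧ lab (A x) = none ∨
    y ∉ E x ∧ y ∈ S (A x).1 ∧ near (A x) = x ∧ loc (A x) ≠ x
  snd : loc (B x) = x
  ne : A x ≠ B x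
  budget : ∀ C, C = A x ∨ C = B x → BudgetAfter k S loc E lab lost y x (A x) (B x) C
  late : lab (B x) ≠ none → ∀ α, loc α = x → lab α = none → α = A x
  notMem : ∀ z, lab (B x) = some z → z ∉ S (A x).1
  ne_partner : ∀ z, lab (B x) = some z → lab (partner (A x)) ≠ some z
  ne_of_partner : ∀ x', IsClient X S loc near E y x' → A x' = partner (A x) →
    ∀ z, lab (B x) = some z → lab (B x') ≠ some z

/-- Offers can be made simultaneously to all clients. Two labelled second ends must not have the
same label if the corresponding first ends belong to the same path; as three labels are available to
each client and at most two are forbidden, they can be chosen greedily. -/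
theorem exists_offer [Nonempty ι] {near : ι × Bool → V} {y : V}
    (hE : EndSystem k X Y S loc E) (h : Labelling k X D S loc E lab lost)
    (hy : y ∉ D) (hDY : insert y D ⊆ Y) :
    ∃ A B : V → ι × Bool, ∀ x, IsClient X S loc near E y x →
      IsOffer k X S loc near E lab lost y A B x := by
  classical
  have hex := fun x (hx : IsClient X S loc near E y x) =>
    exists_options_of_client hE h hy hDY hx.1 hx.2
  choose! A hA1 hA2 using hex
  let early (x : V) : Prop := ∃ B, loc B = x ∧ A x ≠ B ∧ lab B = none ∧
          ∀ C, C = A x ∨ C = B → BudgetAfter k S loc E lab lost y x (A x) B C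
  let late : Finset V := {x ∈ X | IsClient X S loc near E y x ∧ ¬ early x}
  obtain ⟨c, hc1, hc2⟩ : ∃ c : V → V, (∀ x ∈ late, c x ∈
      (({z ∈ E x ∩ D | z ∉ S (A x).1} : Finset V) \ (lab (partner (A x))).toFinset)) ∧
      ∀ x ∈ late, ∀ x' ∈ late, A x' = partner (A x) → c x ≠ c x' := by
    rcases isEmpty_or_nonempty V with hV | hV
    · exact ⟨id, fun x => isEmptyElim x, fun x => isEmptyElim x⟩
    refine exists_list_coloring late (fun x x' => A x' = partner (A x)) ?_ ?_ _ ?_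
    · intro x x' e; rw [e, partner_partner]
    · intro x e; exact partner_ne _ e.symm
    intro x hx
    simp only [late, mem_filter] at hx
    have h3 := ((hA2 x hx.2.1).resolve_left hx.2.2).2.1
    -- A neighbour of `x` is located where the partner of `A x` ends, which is then unlabelled, or
    -- where it leaves `y`.
    have hsub : {x' ∈ late | A x' = partner (A x)} ⊆
        insert (near (partner (A x)))
          (if lab (partner (A x)) = none then {loc (partner (A x))} else ∅) := by
      intro x' hx'
      simp only [late, mem_filter] at hx'
      rcases hA1 x' hx'.1.2.1 with ⟨-, h1, h2⟩ | ⟨-, -, h1, -⟩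
      · rw [hx'.2] at h1 h2
        simp [h1, h2]
      · rw [hx'.2] at h1
        simp [h1]
    have h4 := (card_le_card hsub).trans (card_insert_le _ _)
    have h5 := le_card_sdiff (lab (partner (A x))).toFinset {z ∈ E x ∩ D | z ∉ S (A x).1}
    rcases ho : lab (partner (A x)) with _ | z
    · rw [ho] at h4 h5
      simp only [if_true, card_singleton, Option.toFinset_none, card_empty] at h4 h5 ⊢
      omega
    · rw [ho] at h4 h5
      simp only [reduceCtorEq, if_false, card_empty, Option.toFinset_some, card_singleton] at h4 h5 ⊢
      omega
  have hB : ∀ x, ∃ B, IsClient X S loc near E y x → loc B = x ∧ A x ≠ B ∧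
      (∀ C, C = A x ∨ C = B → BudgetAfter k S loc E lab lost y x (A x) B C) ∧
      (lab B ≠ none → ∀ α, loc α = x → lab α = none → α = A x) ∧
      ∀ z, lab B = some z → x ∈ late ∧ z = c x := by
    intro x
    by_cases hx : IsClient X S loc near E y x
    · by_cases he : early x
      · obtain ⟨B, h1, h2, h3, h4⟩ := he
        exact ⟨B, fun _ => ⟨h1, h2, h4, fun h' => absurd h3 h', fun z hz => by simp [h3] at hz⟩⟩
      · have hl : x ∈ late := by simp only [late, mem_filter]; exact ⟨hx.1, hx, he⟩
        have hcx := hc1 x hl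
        simp only [mem_sdiff, mem_filter, mem_inter] at hcx
        obtain ⟨B, hB1, hB2⟩ := h.surj x (c x) hcx.1.1.1 hcx.1.1.2
        obtain ⟨h1, -, h3⟩ := (hA2 x hx).resolve_left he
        refine ⟨B, fun _ => ⟨hB1, ?_, fun C => h3 B C hB1 (by simp [hB2]), fun _ => h1, ?_⟩⟩
        · rintro rfl
          rcases hA1 x hx with ⟨-, -, h2⟩ | ⟨-, -, -, h2⟩
          · simp [hB2] at h2
          · exact h2 hB1
        · intro z hz
          rw [hB2] at hz
          exact ⟨hl, (Option.some_injective _ hz).symm⟩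
    · exact ⟨A x, fun h' => absurd h' hx⟩
  choose B hB using hB
  refine ⟨A, B, fun x hx => ?_⟩
  obtain ⟨h1, h2, h3, h4, h5⟩ := hB x hx
  refine ⟨hA1 x hx, h1, h2, h3, h4, ?_, ?_, ?_⟩
  · intro z hz
    obtain ⟨hl, rfl⟩ := h5 z hz
    have hcx := hc1 x hl
    simp only [mem_sdiff, mem_filter] at hcx
    exact hcx.1.2
  · intro z hz
    obtain ⟨hl, rfl⟩ := h5 z hz
    have hcx := hc1 x hl
    simp only [mem_sdiff, Option.mem_toFinset, Option.mem_def] at hcx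
    exact hcx.2
  · intro x' hx' e z hz hz'
    obtain ⟨hl, rfl⟩ := h5 z hz
    obtain ⟨hl', e'⟩ := (hB x' hx').2.2.2.2 _ hz'
    exact hc2 x hl x' hl' e e'

end Options

/-! ### Processing one vertex -/

section Step

variable {V ι : Type*} [DecidableEq V] [Fintype ι] [DecidableEq ι] {k : ℕ}
  {X Y D : Finset V} {S : ι → Finset V} {loc near : ι × Bool → V} {E : V → Finset V}
  {lab : ι × Bool → Option V} {lost : V → Finset V} {y : V} {A B C : V → ι × Bool}

/-- When the vertex `y` is processed, the path through `y` of the end `α` is entered from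
`near α` on the side of `α`; these vertices are in `X`, and the corresponding edges are distinct and
not hanging. -/
structure IsEntry {V ι : Type*} (X : Finset V) (S : ι → Finset V) (E : V → Finset V) (y : V)
    (near : ι × Bool → V) : Prop where
  mem : ∀ α, y ∈ S α.1 → near α ∈ X
  notMem : ∀ α, y ∈ S α.1 → y ∉ E (near α)
  inj : ∀ α β, y ∈ S α.1 → y ∈ S β.1 → near α = near β → α = β

/-- An assignment of ends to the clients of `y`: the client `x` uses up the end `C x`, one of the
two ends `A x` and `B x` it is offered. No end of a path through `y` is used twice, of the two ends
of a path avoiding `y` at most one is used, and an end of a path through `y` which is the first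
offer to some client is used. -/
structure IsService (k : ℕ) (X : Finset V) (S : ι → Finset V) (loc near : ι × Bool → V)
    (E : V → Finset V) (lab : ι × Bool → Option V) (lost : V → Finset V) (y : V)
    (A B C : V → ι × Bool) : Prop where
  offer : ∀ x, IsClient X S loc near E y x → IsOffer k X S loc near E lab lost y A B x
  mem : ∀ x, IsClient X S loc near E y x → C x = A x ∨ C x = B x
  inj : ∀ x x', IsClient X S loc near E y x → IsClient X S loc near E y x' → C x = C x' → x = x'
  inj_fst : ∀ x x', IsClient X S loc near E y x → IsClient X S loc near E y x' →
    y ∉ S (C x).1 → (C x).1 = (C x').1 → x = x'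
  used : ∀ x, IsClient X S loc near E y x → y ∈ S (A x).1 →
    ∃ w, IsClient X S loc near E y w ∧ C w = A x

/-- Ends of paths through `y` and paths avoiding `y` are servers. A server of the first kind is an
option only of the client at its location and of the client from which `y` is entered, one of the
second kind only of the clients at the two ends of the path, so that Hall's theorem applies. -/
theorem exists_service [Nonempty ι] (hE : EndSystem k X Y S loc E)
    (h : Labelling k X D S loc E lab lost) (hy : y ∉ D) (hDY : insert y D ⊆ Y) :
    ∃ A B C, IsService k X S loc near E lab lost y A B C := by
  classical
  obtain ⟨A, B, hAB⟩ := exists_offer (near := near) hE h hy hDY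
  let srv (α : ι × Bool) : (ι × Bool) ⊕ ι := if y ∈ S α.1 then Sum.inl α else Sum.inr α.1
  have hsrv : ∀ α β, srv α = srv β → α = β ∨ α.1 = β.1 ∧ y ∉ S α.1 := by
    intro α β e
    by_cases h1 : y ∈ S α.1 <;> by_cases h2 : y ∈ S β.1 <;> simp [srv, h1, h2] at e
    · exact Or.inl e
    · exact Or.inr ⟨e, h1⟩
  have hfree : ∀ x, IsClient X S loc near E y x → y ∉ S (A x).1 → loc (A x) = x := by
    intro x hx hxy
    rcases (hAB x hx).fst with h' | h'
    · exact h'.2.1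
    · exact absurd h'.2.1 hxy
  have hne : ∀ x ∈ ({x ∈ X | IsClient X S loc near E y x} : Finset V), srv (A x) ≠ srv (B x) := by
    intro x hx e
    have hx := (mem_filter.1 hx).2
    rcases hsrv _ _ e with h' | h'
    · exact (hAB x hx).ne h'
    · rcases eq_or_eq_partner h'.1 with e' | e'
      · exact (hAB x hx).ne e'
      · have h1 := hfree x hx h'.2
        rw [e'] at h1
        exact hE.loc_ne (B x) (h1.trans (hAB x hx).snd.symm)
  have htwo : ∀ c, #{x ∈ ({x ∈ X | IsClient X S loc near E y x} : Finset V) |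
      srv (A x) = c ∨ srv (B x) = c} ≤ 2 := by
    intro c
    obtain ⟨u, v, huv⟩ : ∃ u v, ∀ x, IsClient X S loc near E y x →
        (srv (A x) = c ∨ srv (B x) = c) → x = u ∨ x = v := by
      rcases c with α | i
      · refine ⟨loc α, near α, fun x hx h' => ?_⟩
        have hα : ∀ β, srv β = Sum.inl α → β = α := by
          intro β e
          by_cases h1 : y ∈ S β.1 <;> simp [srv, h1] at e
          exact e
        rcases h' with h' | h'
        · rcases (hAB x hx).fst with h1 | h1
          · left; rw [← hα _ h', h1.2.1]
          · right; rw [← hα _ h', h1.2.2.1]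
        · left; rw [← hα _ h', (hAB x hx).snd]
      · refine ⟨loc (i, false), loc (i, true), fun x hx h' => ?_⟩
        have hi : ∀ β, srv β = Sum.inr i → y ∉ S β.1 ∧ β.1 = i := by
          intro β e
          by_cases h1 : y ∈ S β.1 <;> simp [srv, h1] at e
          exact ⟨h1, e⟩
        have hloc : ∀ β, β.1 = i → loc β = x → x = loc (i, false) ∨ x = loc (i, true) := by
          rintro ⟨j, b⟩ rfl rfl
          cases b <;> simp
        rcases h' with h' | h'
        · exact hloc _ (hi _ h').2 (hfree x hx (hi _ h').1)
        · exact hloc _ (hi _ h').2 (hAB x hx).snd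
    refine (card_le_card (t := {u, v}) fun x hx => ?_).trans card_le_two
    obtain ⟨hx, h'⟩ := mem_filter.1 hx
    simpa using huv x (mem_filter.1 hx).2 h'
  obtain ⟨C, hC1, hC2, hC3⟩ := exists_injective_choice_of_two_options _ A B srv hne htwo
  refine ⟨A, B, C, hAB, ?_, ?_, ?_, ?_⟩
  · exact fun x hx => hC1 x (mem_filter.2 ⟨hx.1, hx⟩)
  · exact fun x x' hx hx' e =>
      hC2 x (mem_filter.2 ⟨hx.1, hx⟩) x' (mem_filter.2 ⟨hx'.1, hx'⟩) (by rw [e])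
  · intro x x' hx hx' hxy e
    refine hC2 x (mem_filter.2 ⟨hx.1, hx⟩) x' (mem_filter.2 ⟨hx'.1, hx'⟩) ?_
    simp only [srv, if_neg hxy, if_neg (e ▸ hxy), e]
  · intro x hx hxy
    obtain ⟨w, hw, e⟩ := hC3 x (mem_filter.2 ⟨hx.1, hx⟩)
    refine ⟨w, (mem_filter.1 hw).2, ?_⟩
    rcases hsrv _ _ e with h' | h'
    · exact h'
    · exact absurd (h'.1 ▸ hxy) h'.2

/-- The end offered to the client `x` which it does not use up. -/
def keptEnd (A B C : V → ι × Bool) (x : V) : ι × Bool := if C x = A x then B x else A x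

open Classical in
/-- The end `α` is reversed when `y` is processed: it is used up by the client at which it is
located, and its path passes through `y`. -/
noncomputable def isFlipped (X : Finset V) (S : ι → Finset V) (loc near : ι × Bool → V)
    (E : V → Finset V) (y : V) (C : V → ι × Bool) (α : ι × Bool) : Bool :=
  decide (y ∈ S α.1 ∧ IsClient X S loc near E y (loc α) ∧ C (loc α) = α)

/-- The locations of the path ends after reversing the flipped ones. -/
noncomputable def newLoc (X : Finset V) (S : ι → Finset V) (loc near : ι × Bool → V)
    (E : V → Finset V) (y : V) (C : V → ι × Bool) (α : ι × Bool) : V :=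
  if isFlipped X S loc near E y C α then near α else loc α

open Classical in
/-- The labels after `y` has been processed: a kept end takes over the label of the second offer to
the client keeping it, which is unique by `IsService.keptEnd_inj`, and a used up end whose path
avoids `y` is labelled by `y`. -/
noncomputable def newLab (X : Finset V) (S : ι → Finset V) (loc near : ι × Bool → V)
    (E : V → Finset V) (lab : ι × Bool → Option V) (y : V) (A B C : V → ι × Bool)
    (α : ι × Bool) : Option V :=
  if h : ∃ x, IsClient X S loc near E y x ∧ keptEnd A B C x = α then lab (B h.choose)
  else if y ∉ S α.1 ∧ IsClient X S loc near E y (loc α) ∧ C (loc α) = α then some y else lab α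

open Classical in
/-- The hanging edges after `y` has been processed: the edge `xy` is hanging exactly if `x` is a
client whose used up end belongs to a path avoiding `y`. -/
noncomputable def newHang (X : Finset V) (S : ι → Finset V) (loc near : ι × Bool → V)
    (E : V → Finset V) (y : V) (C : V → ι × Bool) (x : V) : Finset V :=
  if IsClient X S loc near E y x then
    (if y ∈ S (C x).1 then (E x).erase y else insert y (E x)) else E x

open Classical in
/-- The lost vertices after `y` has been processed. -/
noncomputable def newLost (X : Finset V) (S : ι → Finset V) (loc near : ι × Bool → V)
    (E : V → Finset V) (lost : V → Finset V) (y : V) (C : V → ι × Bool) (x : V) : Finset V :=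
  if IsClient X S loc near E y x ∧ y ∈ E x ∧ y ∈ S (C x).1 then insert y (lost x) else lost x

local notation "cl" => IsClient X S loc near E y
local notation "locN" => newLoc X S loc near E y C
local notation "labN" => newLab X S loc near E lab y A B C
local notation "hangN" => newHang X S loc near E y C

theorem IsService.keptEnd_ne (h : IsService k X S loc near E lab lost y A B C) {x : V} (hx : cl x) :
    keptEnd A B C x ≠ C x := by
  unfold keptEnd
  split_ifs with hC
  · rw [hC]; exact (h.offer x hx).ne.symm
  · exact fun e => hC e.symm

theorem IsService.fst_eq (h : IsService k X S loc near E lab lost y A B C)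
    (hn : IsEntry X S E y near) {α : ι × Bool} (hα : y ∈ S α.1) (hx : cl (near α)) :
    y ∉ E (near α) ∧ A (near α) = α ∧ loc α ≠ near α := by
  have hy := hn.notMem α hα
  rcases (h.offer _ hx).fst with h' | h'
  · exact absurd h'.1 hy
  · have : A (near α) = α := hn.inj _ _ h'.2.1 hα h'.2.2.1
    exact ⟨hy, this, by simpa only [this] using h'.2.2.2⟩

theorem IsService.loc_eq (h : IsService k X S loc near E lab lost y A B C) {x : V} (hx : cl x) :
    loc (C x) = x ∨ C x = A x ∧ near (C x) = x ∧ y ∈ S (C x).1 := by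
  rcases h.mem x hx with e | e
  · rcases (h.offer x hx).fst with h' | h'
    · left; rw [e]; exact h'.2.1
    · right; rw [e]; exact ⟨rfl, h'.2.2.1, h'.2.1⟩
  · left; rw [e]; exact (h.offer x hx).snd

theorem IsService.eq_loc_of_used (h : IsService k X S loc near E lab lost y A B C)
    (hn : IsEntry X S E y near) {α : ι × Bool} (hα : y ∈ S α.1) (hx : cl (near α)) :
    C (near α) = α ∨ cl (loc α) ∧ C (loc α) = α := by
  obtain ⟨-, hA, -⟩ := h.fst_eq hn hα hx
  obtain ⟨w, hw, e⟩ := h.used _ hx (by rwa [hA])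
  rw [hA] at e
  rcases h.loc_eq hw with h' | h'
  · rw [e] at h'; right; rw [h']; exact ⟨hw, e⟩
  · have := h'.2.1
    rw [e] at this; left; rw [this]; exact e

theorem isFlipped_iff {α : ι × Bool} : isFlipped X S loc near E y C α = true ↔
    y ∈ S α.1 ∧ cl (loc α) ∧ C (loc α) = α := by
  simp [isFlipped]

theorem IsService.newLoc_iff (h : IsService k X S loc near E lab lost y A B C)
    (hn : IsEntry X S E y near) {x : V} (hx : cl x) {α : ι × Bool} :
    locN α = x ↔ (α = A x ∨ loc α = x) ∧ ¬ (y ∈ S (C x).1 ∧ α = C x) := by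
  unfold newLoc
  by_cases hf : isFlipped X S loc near E y C α = true
  · rw [if_pos hf]
    rw [isFlipped_iff] at hf
    constructor
    · rintro rfl
      obtain ⟨-, h1, h2⟩ := h.fst_eq hn hf.1 hx
      refine ⟨Or.inl h1.symm, fun h3 => h2 ?_⟩
      exact h.inj _ _ hf.2.1 hx (hf.2.2.trans h3.2)
    · rintro ⟨h1 | rfl, h2⟩
      · rcases (h.offer x hx).fst with h' | h'
        · rw [← h1] at h'
          rw [h'.2.1] at hf
          exact absurd ⟨hf.2.2.symm ▸ hf.1, hf.2.2.symm⟩ h2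
        · rw [h1]; exact h'.2.2.1
      · exact absurd ⟨hf.2.2.symm ▸ hf.1, hf.2.2.symm⟩ h2
  · rw [if_neg hf]
    rw [isFlipped_iff] at hf
    constructor
    · rintro rfl
      refine ⟨Or.inr rfl, fun h' => hf ⟨h'.2.symm ▸ h'.1, hx, h'.2.symm⟩⟩
    · rintro ⟨h1 | h1, h2⟩
      · rcases (h.offer x hx).fst with h' | h'
        · rw [h1]; exact h'.2.1
        · rw [← h1] at h'
          have hx' := hx
          rw [← h'.2.2.1] at hx'
          rcases h.eq_loc_of_used hn h'.2.1 hx' with h3 | h3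
          · rw [h'.2.2.1] at h3
            exact absurd ⟨h3.symm ▸ h'.2.1, h3.symm⟩ h2
          · exact absurd ⟨h'.2.1, h3⟩ hf
      · exact h1

theorem newLoc_iff_of_not (hn : IsEntry X S E y near) {x : V} (hx : ¬ cl x)
    {α : ι × Bool} : locN α = x ↔ loc α = x := by
  unfold newLoc
  by_cases hf : isFlipped X S loc near E y C α = true
  · rw [if_pos hf]
    rw [isFlipped_iff] at hf
    constructor
    · intro e
      by_contra h'
      exact hx ⟨e ▸ hn.mem α hf.1, Or.inr ⟨e ▸ hn.notMem α hf.1, α, hf.1, e, h'⟩⟩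
    · rintro rfl; exact absurd hf.2.1 hx
  · rw [if_neg hf]

theorem IsService.keptEnd_eq (h : IsService k X S loc near E lab lost y A B C) {x : V}
    (hx : cl x) : keptEnd A B C x = A x ∧ C x = B x ∨ keptEnd A B C x = B x ∧ C x = A x := by
  unfold keptEnd
  split_ifs with hC
  · exact Or.inr ⟨rfl, hC⟩
  · exact Or.inl ⟨rfl, (h.mem x hx).resolve_left hC⟩

/-- An end kept by one client is located at it, or else it is used up by the client at its location.
-/
theorem IsService.loc_keptEnd (h : IsService k X S loc near E lab lost y A B C)
    (hn : IsEntry X S E y near) {x : V} (hx : cl x) : loc (keptEnd A B C x) = x ∨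
      cl (loc (keptEnd A B C x)) ∧ C (loc (keptEnd A B C x)) = keptEnd A B C x ∧
        y ∈ S (keptEnd A B C x).1 ∧ keptEnd A B C x = A x := by
  rcases h.keptEnd_eq hx with e | e
  · rcases (h.offer x hx).fst with h' | h'
    · left; rw [e.1]; exact h'.2.1
    · right
      rw [e.1]
      have hx' := hx
      rw [← h'.2.2.1] at hx'
      rcases h.eq_loc_of_used hn h'.2.1 hx' with h3 | h3
      · rw [h'.2.2.1, e.2] at h3
        exact absurd h3.symm (h.offer x hx).ne
      · exact ⟨h3.1, h3.2, h'.2.1, rfl⟩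
  · left; rw [e.1]; exact (h.offer x hx).snd

theorem IsService.keptEnd_inj (h : IsService k X S loc near E lab lost y A B C)
    (hn : IsEntry X S E y near) {x x' : V} (hx : cl x) (hx' : cl x')
    (e : keptEnd A B C x = keptEnd A B C x') : x = x' := by
  have key : ∀ {x x' : V}, cl x → cl x' → keptEnd A B C x = keptEnd A B C x' →
      loc (keptEnd A B C x) = x → x = x' := by
    intro x x' hx hx' e h1
    rcases h.loc_keptEnd hn hx' with h2 | h2
    · rw [e, h2] at h1; exact h1.symm
    · rw [← e, h1] at h2
      exact absurd h2.2.1.symm (h.keptEnd_ne hx)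
  rcases h.loc_keptEnd hn hx with h1 | h1
  · exact key hx hx' e h1
  · rcases h.loc_keptEnd hn hx' with h2 | h2
    · exact (key hx' hx e.symm h2).symm
    · -- Both would be the entry of the same end.
      have hA : A x = A x' := h1.2.2.2.symm.trans (e.trans h2.2.2.2)
      have hnear : ∀ {x}, cl x → y ∈ S (A x).1 → keptEnd A B C x = A x → loc (A x) ≠ x →
          near (A x) = x := by
        intro x hx _ _ hl
        rcases (h.offer x hx).fst with h' | h'
        · exact absurd h'.2.1 hl
        · exact h'.2.2.1
      have g : ∀ {x}, cl x → C (loc (keptEnd A B C x)) = keptEnd A B C x →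
          keptEnd A B C x = A x → loc (A x) ≠ x := by
        intro x hx h3 h4 h5
        rw [h4, h5, ← h4] at h3
        exact h.keptEnd_ne hx h3.symm
      have e1 := hnear hx (h1.2.2.2 ▸ h1.2.2.1) h1.2.2.2 (g hx h1.2.1 h1.2.2.2)
      have e2 := hnear hx' (h2.2.2.2 ▸ h2.2.2.1) h2.2.2.2 (g hx' h2.2.1 h2.2.2.2)
      rw [← e1, ← e2, hA]

theorem IsService.newLab_keptEnd (h : IsService k X S loc near E lab lost y A B C)
    (hn : IsEntry X S E y near) {x : V} (hx : cl x) :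
    labN (keptEnd A B C x) = lab (B x) := by
  unfold newLab
  have hex : ∃ x', cl x' ∧ keptEnd A B C x' = keptEnd A B C x := ⟨x, hx, rfl⟩
  rw [dif_pos hex, h.keptEnd_inj hn hex.choose_spec.1 hx hex.choose_spec.2]

theorem IsService.newLab_used (h : IsService k X S loc near E lab lost y A B C)
    (hn : IsEntry X S E y near) {x : V} (hx : cl x) (hy : y ∉ S (C x).1) :
    loc (C x) = x ∧ labN (C x) = some y := by
  have hl : loc (C x) = x := by
    rcases h.loc_eq hx with h' | h'
    · exact h'
    · exact absurd h'.2.2 hy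
  refine ⟨hl, ?_⟩
  unfold newLab
  rw [dif_neg, if_pos]
  · rw [hl]; exact ⟨hy, hx, rfl⟩
  · rintro ⟨x', hx', e⟩
    rcases h.loc_keptEnd hn hx' with h' | h'
    · rw [e, hl] at h'
      subst h'
      exact h.keptEnd_ne hx e
    · rw [e] at h'; exact hy h'.2.2.1

/-- The three kinds of labels after `y` has been processed. -/
theorem IsService.newLab_cases (h : IsService k X S loc near E lab lost y A B C)
    (hn : IsEntry X S E y near) (α : ι × Bool) :
    (∃ x, cl x ∧ α = keptEnd A B C x ∧ labN α = lab (B x)) ∨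
    (∃ x, cl x ∧ α = C x ∧ y ∉ S α.1 ∧ loc α = x ∧ labN α = some y) ∨
    ((∀ x, cl x → α ≠ keptEnd A B C x) ∧
      ¬ (y ∉ S α.1 ∧ cl (loc α) ∧ C (loc α) = α) ∧ labN α = lab α) := by
  by_cases h1 : ∃ x, cl x ∧ keptEnd A B C x = α
  · obtain ⟨x, hx, rfl⟩ := h1
    exact Or.inl ⟨x, hx, rfl, h.newLab_keptEnd hn hx⟩
  · by_cases h2 : y ∉ S α.1 ∧ cl (loc α) ∧ C (loc α) = α
    · refine Or.inr (Or.inl ⟨loc α, h2.2.1, h2.2.2.symm, h2.1, rfl, ?_⟩)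
      unfold newLab
      rw [dif_neg h1, if_pos h2]
    · refine Or.inr (Or.inr ⟨fun x hx e => h1 ⟨x, hx, e.symm⟩, h2, ?_⟩)
      unfold newLab
      rw [dif_neg h1, if_neg h2]

/-- The labels of the ends that are located at a client after `y` has been processed. -/
theorem IsService.newLab_at_client (h : IsService k X S loc near E lab lost y A B C)
    (hn : IsEntry X S E y near) {x : V} (hx : cl x) {α : ι × Bool} (hα : locN α = x) :
    (α = keptEnd A B C x ∧ labN α = lab (B x)) ∨ (α = C x ∧ y ∉ S (C x).1 ∧ labN α = some y) ∨
      (α ≠ A x ∧ α ≠ B x ∧ loc α = x ∧ labN α = lab α) := by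
  rw [h.newLoc_iff hn hx] at hα
  obtain ⟨h1, h2⟩ := hα
  by_cases hN : α = keptEnd A B C x
  · left; refine ⟨hN, ?_⟩; rw [hN]; exact h.newLab_keptEnd hn hx
  by_cases hC : α = C x
  · have hy : y ∉ S (C x).1 := fun h' => h2 ⟨h', hC⟩
    right; left; refine ⟨hC, hy, ?_⟩; rw [hC]; exact (h.newLab_used hn hx hy).2
  have hAB : α ≠ A x ∧ α ≠ B x := by
    rcases h.keptEnd_eq hx with e | e
    · rw [e.1] at hN; rw [e.2] at hC; exact ⟨hN, hC⟩
    · rw [e.1] at hN; rw [e.2] at hC; exact ⟨hC, hN⟩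
  have hl := h1.resolve_left hAB.1
  right; right
  refine ⟨hAB.1, hAB.2, hl, ?_⟩
  rcases h.newLab_cases hn α with ⟨x', hx', e, -⟩ | ⟨x', -, e, -, e', -⟩ | ⟨-, -, e⟩
  · exfalso
    rcases h.loc_keptEnd hn hx' with h' | h'
    · rw [← e, hl] at h'; subst h'; exact hN e
    · rw [← e, hl] at h'; exact hC h'.2.1.symm
  · rw [hl] at e'; subst e'; exact absurd e hC
  · exact e

theorem IsService.newLab_of_not_client (h : IsService k X S loc near E lab lost y A B C)
    (hn : IsEntry X S E y near) {α : ι × Bool} (hx : ¬ cl (loc α)) : labN α = lab α := by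
  rcases h.newLab_cases hn α with ⟨x', hx', e, -⟩ | ⟨x', hx', e, -, e', -⟩ | ⟨-, -, e⟩
  · exfalso
    rcases h.loc_keptEnd hn hx' with h' | h'
    · rw [← e] at h'; rw [h'] at hx; exact hx hx'
    · rw [← e] at h'; exact hx h'.1
  · rw [e'] at hx; exact absurd hx' hx
  · exact e

theorem IsService.newLoc_keptEnd (h : IsService k X S loc near E lab lost y A B C)
    (hn : IsEntry X S E y near) {x : V} (hx : cl x) : locN (keptEnd A B C x) = x := by
  rw [h.newLoc_iff hn hx]
  refine ⟨?_, fun h' => h.keptEnd_ne hx h'.2⟩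
  rcases h.keptEnd_eq hx with e | e
  · exact Or.inl e.1
  · rw [e.1]; exact Or.inr (h.offer x hx).snd

theorem mem_newHang_of_ne {x z : V} (hz : z ≠ y) : z ∈ hangN x ↔ z ∈ E x := by
  unfold newHang
  split_ifs <;> simp [hz]

theorem mem_newHang_self {x : V} (hx : cl x) : y ∈ hangN x ↔ y ∉ S (C x).1 := by
  unfold newHang
  rw [if_pos hx]
  split_ifs with h <;> simp [h]

theorem newHang_of_not {x : V} (hx : ¬ cl x) : hangN x = E x := by
  unfold newHang
  rw [if_neg hx]

end Step

section StepResult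

variable {V ι : Type*} [DecidableEq V] [Fintype ι] [DecidableEq ι] {k : ℕ}
  {X Y D : Finset V} {S : ι → Finset V} {loc near : ι × Bool → V} {E : V → Finset V}
  {lab : ι × Bool → Option V} {lost : V → Finset V} {y : V} {A B C : V → ι × Bool}

local notation "cl" => IsClient X S loc near E y
local notation "locN" => newLoc X S loc near E y C
local notation "labN" => newLab X S loc near E lab y A B C
local notation "hangN" => newHang X S loc near E y C
local notation "lostN" => newLost X S loc near E lost y C

theorem IsService.endsAt_eq (h : IsService k X S loc near E lab lost y A B C)
    (hn : IsEntry X S E y near) {x : V} (hx : cl x) : endsAt locN x =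
      if y ∈ S (C x).1 then (insert (A x) (endsAt loc x)).erase (C x)
      else insert (A x) (endsAt loc x) := by
  ext α
  rw [mem_endsAt, h.newLoc_iff hn hx]
  split_ifs with hy <;> simp [hy, and_comm]

theorem IsService.openEnds_eq (h : IsService k X S loc near E lab lost y A B C)
    (hn : IsEntry X S E y near) {x : V} (hx : cl x) : openEnds locN labN x =
      if lab (B x) = none then (insert (A x) (openEnds loc lab x)).erase (C x) else ∅ := by
  have ho := h.offer x hx
  ext α
  rw [mem_openEnds]
  split_ifs with hB
  · rw [mem_erase, mem_insert, mem_openEnds]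
    constructor
    · rintro ⟨h1, h2⟩
      have hne := (h.newLoc_iff hn hx).1 h1
      rcases h.newLab_at_client hn hx h1 with h3 | h3 | h3
      · rw [h3.1]
        refine ⟨h.keptEnd_ne hx, ?_⟩
        rcases h.keptEnd_eq hx with e | e
        · exact Or.inl e.1
        · rw [e.1]; exact Or.inr ⟨ho.snd, hB⟩
      · rw [h2] at h3; simp at h3
      · refine ⟨?_, Or.inr ⟨h3.2.2.1, h3.2.2.2.symm.trans h2⟩⟩
        rintro rfl
        rcases h.mem x hx with e | e
        · exact h3.1 e
        · exact h3.2.1 e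
    · rintro ⟨h1, h2⟩
      have h3 : locN α = x := by
        rw [h.newLoc_iff hn hx]
        exact ⟨h2.imp id And.left, fun h' => h1 h'.2⟩
      refine ⟨h3, ?_⟩
      rcases h.newLab_at_client hn hx h3 with h4 | h4 | h4
      · rw [h4.2, hB]
      · exact absurd h4.1 h1
      · rw [h4.2.2.2]
        exact (h2.resolve_left h4.1).2
  · simp only [notMem_empty, iff_false, not_and]
    intro h1 h2
    rcases h.newLab_at_client hn hx h1 with h3 | h3 | h3
    · exact hB (h3.2.symm.trans h2)
    · rw [h2] at h3; simp at h3
    · exact h3.1 (ho.late hB α h3.2.2.1 (h3.2.2.2.symm.trans h2))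

/-- After processing `y`, the labels again form a labelling. -/
theorem IsService.labelling (h : IsService k X S loc near E lab lost y A B C)
    (hn : IsEntry X S E y near) (hE : EndSystem k X Y S loc E)
    (hL : Labelling k X D S loc E lab lost) (hy : y ∉ D) :
    Labelling k X (insert y D) S locN hangN labN lostN := by
  classical
  have hyD : ∀ α, lab α ≠ some y := fun α e => hy (hL.mem_done α y e)
  have hcases : ∀ α z, labN α = some z →
      (∃ x, cl x ∧ α = A x ∧ C x = B x ∧ lab (B x) = some z) ∨
      (∃ x, cl x ∧ α = C x ∧ y ∉ S α.1 ∧ z = y) ∨ lab α = some z := by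
    intro α z hz
    rcases h.newLab_cases hn α with ⟨x, hx, e1, e2⟩ | ⟨x, hx, e1, e2, -, e3⟩ | ⟨-, -, e⟩
    · rcases h.keptEnd_eq hx with e | e
      · exact Or.inl ⟨x, hx, e1.trans e.1, e.2, e2.symm.trans hz⟩
      · right; right; rw [e1, e.1]; exact e2.symm.trans hz
    · exact Or.inr (Or.inl ⟨x, hx, e1, e2, Option.some_injective _ (hz.symm.trans e3)⟩)
    · exact Or.inr (Or.inr (e.symm.trans hz))
  -- An end located at `x` inherits its label from an end that was located at `x` before.
  have hsource : ∀ α z, labN α = some z → z ≠ y → ∃ β, loc β = locN α ∧ lab β = some z ∧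
      ((cl (locN α) ∧ α = keptEnd A B C (locN α) ∧ β = B (locN α)) ∨
        (β = α ∧ (cl (locN α) → α ≠ B (locN α)))) := by
    intro α z hz hzy
    by_cases hx : cl (locN α)
    · rcases h.newLab_at_client hn hx rfl with h3 | h3 | h3
      · exact ⟨B (locN α), (h.offer _ hx).snd, h3.2.symm.trans hz, Or.inl ⟨hx, h3.1, rfl⟩⟩
      · exact absurd (Option.some_injective _ (hz.symm.trans h3.2.2)) hzy
      · exact ⟨α, h3.2.2.1, h3.2.2.2.symm.trans hz, Or.inr ⟨rfl, fun _ => h3.2.1⟩⟩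
    · have hl : loc α = locN α := (newLoc_iff_of_not hn hx).1 rfl
      rw [← hl] at hx
      refine ⟨α, hl, ?_, Or.inr ⟨rfl, fun h' => absurd (hl ▸ h') hx⟩⟩
      rw [← h.newLab_of_not_client hn hx, hz]
  have hcly : ∀ α, labN α = some y → cl (locN α) ∧ α = C (locN α) ∧ y ∉ S (C (locN α)).1 := by
    intro α hz
    by_cases hx : cl (locN α)
    · rcases h.newLab_at_client hn hx rfl with h3 | h3 | h3
      · exact absurd (h3.2.symm.trans hz) (hyD _)
      · exact ⟨hx, h3.1, h3.2.1⟩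
      · exact absurd (h3.2.2.2.symm.trans hz) (hyD _)
    · have hl : loc α = locN α := (newLoc_iff_of_not hn hx).1 rfl
      rw [← hl] at hx
      rw [h.newLab_of_not_client hn hx] at hz
      exact absurd hz (hyD _)
  have hmemN : ∀ α z, labN α = some z → z ∈ insert y D := by
    intro α z hz
    rcases hcases α z hz with ⟨x, -, -, -, e⟩ | ⟨-, -, -, -, rfl⟩ | e
    · exact mem_insert_of_mem (hL.mem_done _ _ e)
    · exact mem_insert_self _ _
    · exact mem_insert_of_mem (hL.mem_done _ _ e)
  refine ⟨?_, hmemN, ?_, ?_, ?_, ?_, ?_, ?_, ?_⟩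
  · intro α z hz
    by_cases hzy : z = y
    · subst hzy
      obtain ⟨h1, -, h3⟩ := hcly α hz
      exact (mem_newHang_self h1).2 h3
    · obtain ⟨β, h1, h2, -⟩ := hsource α z hz hzy
      rw [mem_newHang_of_ne hzy, ← h1]
      exact hL.mem_hang β z h2
  · intro α β z e hα hβ
    by_cases hzy : z = y
    · subst hzy
      rw [(hcly α hα).2.1, (hcly β hβ).2.1, e]
    · obtain ⟨α₁, h1, h2, h3⟩ := hsource α z hα hzy
      obtain ⟨β₁, g1, g2, g3⟩ := hsource β z hβ hzy
      have : α₁ = β₁ := hL.inj _ _ z (h1.trans (e.trans g1.symm)) h2 g2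
      subst this
      rcases h3 with ⟨hx, h3, h4⟩ | ⟨rfl, h4⟩
      · rcases g3 with ⟨-, g3, -⟩ | ⟨rfl, g4⟩
        · rw [h3, g3, e]
        · rw [e] at hx h4
          exact absurd h4 (g4 hx)
      · rcases g3 with ⟨hx, g3, g4⟩ | ⟨rfl, -⟩
        · rw [← e] at hx g4
          exact absurd g4 (h4 hx)
        · rfl
  · intro x z hz hzD
    by_cases hx : cl x
    · by_cases hzy : z = y
      · subst hzy
        have hzS := (mem_newHang_self hx).1 hz
        refine ⟨C x, ?_, (h.newLab_used hn hx hzS).2⟩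
        rw [h.newLoc_iff hn hx]
        exact ⟨Or.inr (h.newLab_used hn hx hzS).1, fun h' => hzS h'.1⟩
      · rw [mem_newHang_of_ne hzy] at hz
        obtain ⟨α, h1, h2⟩ := hL.surj x z hz ((mem_insert.1 hzD).resolve_left hzy)
        by_cases hαB : α = B x
        · subst hαB
          exact ⟨keptEnd A B C x, h.newLoc_keptEnd hn hx, (h.newLab_keptEnd hn hx).trans h2⟩
        · have hαA : α ≠ A x := by
            rintro rfl
            rcases (h.offer x hx).fst with h' | h'
            · rw [h'.2.2] at h2; simp at h2
            · exact h'.2.2.2 h1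
          have hαC : α ≠ C x := by
            rcases h.mem x hx with e | e <;> rw [e] <;> assumption
          have hl : locN α = x := by
            rw [h.newLoc_iff hn hx]; exact ⟨Or.inr h1, fun h' => hαC h'.2⟩
          refine ⟨α, hl, ?_⟩
          rcases h.newLab_at_client hn hx hl with h3 | h3 | h3
          · exfalso
            rcases h.keptEnd_eq hx with e | e
            · exact hαA (h3.1.trans e.1)
            · exact hαB (h3.1.trans e.1)
          · exact absurd h3.1 hαC
          · rw [h3.2.2.2, h2]
    · rw [newHang_of_not hx] at hz
      have hzy : z ≠ y := by
        rintro rfl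
        exact hx ⟨hE.mem_of_hang _ _ hz, Or.inl hz⟩
      obtain ⟨α, h1, h2⟩ := hL.surj x z hz ((mem_insert.1 hzD).resolve_left hzy)
      refine ⟨α, (newLoc_iff_of_not hn hx).2 h1, ?_⟩
      rw [h.newLab_of_not_client hn (h1 ▸ hx), h2]
  · intro α z hz
    rcases hcases α z hz with ⟨x, hx, rfl, -, e⟩ | ⟨x, hx, rfl, e, rfl⟩ | e
    · exact (h.offer x hx).notMem z e
    · exact e
    · exact hL.notMem α z e
  · have key : ∀ α z, (∃ x, cl x ∧ α = A x ∧ C x = B x ∧ lab (B x) = some z) →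
        labN (partner α) = some z → False := by
      rintro α z ⟨x, hx, rfl, -, e⟩ hz
      rcases hcases _ z hz with ⟨x', hx', e1, -, e'⟩ | ⟨x', hx', -, -, rfl⟩ | e'
      · exact (h.offer x hx).ne_of_partner x' hx' e1.symm z e e'
      · exact hyD _ e
      · exact (h.offer x hx).ne_partner z e e'
    intro α z hz hz'
    rcases hcases α z hz with h1 | ⟨x, hx, e1, e2, e3⟩ | h1
    · exact key α z h1 hz'
    · rw [e3] at hz'
      obtain ⟨h1, h2, -⟩ := hcly _ hz'
      have hfst : (C x).1 = (C (locN (partner α))).1 := by rw [← h2, ← e1, partner_fst]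
      have : x = locN (partner α) := h.inj_fst _ _ hx h1 (e1 ▸ e2) hfst
      rw [← this, ← e1] at h2
      exact partner_ne _ h2
    · rcases hcases _ z hz' with h2 | ⟨x, hx, e1, e2, rfl⟩ | h2
      · exact key (partner α) z h2 (by rwa [partner_partner])
      · exact hyD _ h1
      · exact hL.ne_partner α z h1 h2
  · intro x hxX
    have hc := hL.card_eq x hxX
    by_cases hx : cl x
    · rw [h.endsAt_eq hn hx]
      have h1 : #(insert (A x) (endsAt loc x)) = #(insert y (E x)) := by
        rcases (h.offer x hx).fst with h' | h'
        · rw [insert_eq_of_mem h'.1, insert_eq_of_mem (by simp [h'.2.1]), hc]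
        · rw [card_insert_of_notMem h'.1, card_insert_of_notMem (by simp [h'.2.2.2]), hc]
      unfold newHang
      rw [if_pos hx]
      split_ifs with hyS
      · rw [card_erase_of_mem, h1, ← card_erase_of_mem (mem_insert_self y (E x))]
        · congr 1; ext z; simp only [mem_erase, mem_insert]; tauto
        · rcases h.mem x hx with e | e
          · rw [e]; exact mem_insert_self _ _
          · rw [e]; exact mem_insert_of_mem (by simp [(h.offer x hx).snd])
      · exact h1
    · rw [newHang_of_not hx, ← hc]
      congr 1; ext α; rw [mem_endsAt, mem_endsAt, newLoc_iff_of_not hn hx]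
  · intro x
    unfold newLost
    split_ifs
    · exact insert_subset_insert _ (hL.lost_subset x)
    · exact (hL.lost_subset x).trans (subset_insert _ _)
  · intro x hxX
    by_cases hx : cl x
    · have hb := (h.offer x hx).budget (C x) (h.mem x hx)
      unfold BudgetAfter at hb
      rw [h.endsAt_eq hn hx, h.openEnds_eq hn hx]
      unfold newLost
      simpa only [hx, true_and] using hb
    · have e1 : endsAt locN x = endsAt loc x := by
        ext α; rw [mem_endsAt, mem_endsAt, newLoc_iff_of_not hn hx]
      have e2 : openEnds locN labN x = openEnds loc lab x := by
        ext α
        rw [mem_openEnds, mem_openEnds, newLoc_iff_of_not hn hx]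
        refine and_congr_right fun h' => ?_
        rw [h.newLab_of_not_client hn (h' ▸ hx)]
      rw [e1, e2]
      unfold newLost
      simpa only [hx, false_and, if_false] using hL.budget x hxX

/-- Reversing the flipped ends exchanges the edges from their old locations to `y` for the edges
from their new locations to `y`; together with the hanging edges nothing is lost or doubled. -/
theorem IsService.card_flipped (h : IsService k X S loc near E lab lost y A B C)
    (hn : IsEntry X S E y near) (x : V) :
    (if y ∈ hangN x then 1 else 0) +
        #{α | isFlipped X S loc near E y C α = true ∧ loc α = x} =
      (if y ∈ E x then 1 else 0) + #{α | isFlipped X S loc near E y C α = true ∧ near α = x} := by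
  classical
  have hclient : ∀ α, isFlipped X S loc near E y C α = true → near α = x → cl x := by
    intro α hf e
    rw [isFlipped_iff] at hf
    by_contra hx
    have := (newLoc_iff_of_not (C := C) hn hx (α := α)).1
      (by unfold newLoc; rwa [if_pos (isFlipped_iff.2 hf)])
    exact hx (this ▸ hf.2.1)
  by_cases hx : cl x
  · rw [if_congr (mem_newHang_self hx) rfl rfl]
    have e1 : ({α | isFlipped X S loc near E y C α = true ∧ loc α = x} : Finset (ι × Bool)) =
        if y ∈ S (C x).1 ∧ loc (C x) = x then {C x} else ∅ := by
      ext α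
      simp only [mem_filter, mem_univ, true_and, isFlipped_iff]
      split_ifs with h'
      · rw [mem_singleton]
        constructor
        · rintro ⟨⟨-, -, e⟩, rfl⟩; exact e.symm
        · rintro rfl; rw [h'.2]; exact ⟨⟨h'.1, hx, rfl⟩, rfl⟩
      · simp only [notMem_empty, iff_false]
        rintro ⟨⟨e1, -, e⟩, rfl⟩
        rw [e] at h'
        exact h' ⟨e1, rfl⟩
    have e2 : ({α | isFlipped X S loc near E y C α = true ∧ near α = x} : Finset (ι × Bool)) =
        if y ∉ E x ∧ C x ≠ A x then {A x} else ∅ := by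
      ext α
      simp only [mem_filter, mem_univ, true_and, isFlipped_iff]
      split_ifs with h'
      · rw [mem_singleton]
        constructor
        · rintro ⟨⟨g1, -, -⟩, rfl⟩; exact (h.fst_eq hn g1 hx).2.1.symm
        · rintro rfl
          obtain ⟨-, h2, h3, -⟩ := (h.offer x hx).fst.resolve_left fun h'' => h'.1 h''.1
          have hx' := hx
          rw [← h3] at hx'
          rcases h.eq_loc_of_used hn h2 hx' with h4 | h4
          · rw [h3] at h4; exact absurd h4 h'.2
          · exact ⟨⟨h2, h4⟩, h3⟩
      · simp only [notMem_empty, iff_false]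
        rintro ⟨⟨g1, g2, g3⟩, rfl⟩
        obtain ⟨h1, h2, h3⟩ := h.fst_eq hn g1 hx
        refine h' ⟨h1, fun e => h3 ?_⟩
        exact h.inj _ _ g2 hx (g3.trans (h2.symm.trans e.symm))
    rw [e1, e2]
    rcases (h.offer x hx).fst with ⟨h1, h2, -⟩ | ⟨h1, h2, -, h3⟩
    · have hl : loc (C x) = x := by
        rcases h.mem x hx with e | e
        · rw [e, h2]
        · rw [e, (h.offer x hx).snd]
      by_cases hS : y ∈ S (C x).1 <;> simp [hl, hS, h1]
    · by_cases hC : C x = A x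
      · simp [h1, hC, h2, h3]
      · have hB := (h.mem x hx).resolve_left hC
        by_cases hS : y ∈ S (B x).1 <;>
          simp [h1, hB, hS, (h.offer x hx).snd, (h.offer x hx).ne.symm]
  · have e1 : ({α | isFlipped X S loc near E y C α = true ∧ loc α = x} : Finset (ι × Bool)) = ∅ := by
      rw [filter_eq_empty_iff]
      rintro α - ⟨hf, rfl⟩
      exact hx (isFlipped_iff.1 hf).2.1
    have e2 : ({α | isFlipped X S loc near E y C α = true ∧ near α = x} : Finset (ι × Bool)) = ∅ := by
      rw [filter_eq_empty_iff]
      rintro α - ⟨hf, e⟩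
      exact hx (hclient α hf e)
    rw [e1, e2, newHang_of_not hx]

end StepResult

/-! ### Alternating paths as lists -/

section Lists

variable {V : Type*}

/-- The list of the edges joining consecutive vertices of a list. -/
def pathEdges : List V → List (Sym2 V)
  | [] => []
  | [_] => []
  | a :: b :: l => s(a, b) :: pathEdges (b :: l)

@[simp] theorem pathEdges_nil : pathEdges ([] : List V) = [] := rfl

@[simp] theorem pathEdges_singleton (a : V) : pathEdges [a] = [] := rfl

@[simp] theorem pathEdges_cons_cons (a b : V) (l : List V) :
    pathEdges (a :: b :: l) = s(a, b) :: pathEdges (b :: l) := rfl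

theorem pathEdges_append_cons (l r : List V) (a : V) :
    pathEdges (l ++ a :: r) = pathEdges (l ++ [a]) ++ pathEdges (a :: r) := by
  induction l with
  | nil => simp
  | cons b l ih =>
    cases l with
    | nil => simp
    | cons c l => simpa using ih

theorem pathEdges_append_pair (l : List V) (a b : V) :
    pathEdges (l ++ [a, b]) = pathEdges (l ++ [a]) ++ [s(a, b)] := by
  rw [pathEdges_append_cons]
  simp

theorem pathEdges_reverse (l : List V) : pathEdges l.reverse = (pathEdges l).reverse := by
  induction l with
  | nil => rfl
  | cons a l ih =>
    cases l with
    | nil => rfl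
    | cons b l =>
      rw [pathEdges_cons_cons, List.reverse_cons (a := s(a, b)), ← ih]
      simp only [List.reverse_cons, List.append_assoc, List.cons_append, List.nil_append]
      rw [pathEdges_append_pair, Sym2.eq_swap]

theorem mem_of_mem_pathEdges {l : List V} {e : Sym2 V} {v : V} (he : e ∈ pathEdges l) (hv : v ∈ e) :
    v ∈ l := by
  induction l with
  | nil => simp at he
  | cons a l ih =>
    cases l with
    | nil => simp at he
    | cons b l =>
      rw [pathEdges_cons_cons, List.mem_cons] at he
      rcases he with rfl | he
      · rcases Sym2.mem_iff.1 hv with rfl | rfl <;> simp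
      · exact List.mem_cons_of_mem _ (ih he)

variable [DecidableEq V]

/-- The edges of a path obtained by joining two paths through a new vertex. -/
theorem count_pathEdges_join {p q : List V} {y t h : V} (hp : p.getLast? = some t)
    (hq : q.head? = some h) (e : Sym2 V) :
    (pathEdges (p ++ y :: q)).count e = (pathEdges p).count e + (if e = s(t, y) then 1 else 0) +
      (if e = s(h, y) then 1 else 0) + (pathEdges q).count e := by
  obtain ⟨p, rfl⟩ := List.getLast?_eq_some_iff.1 hp
  obtain ⟨q, rfl⟩ := List.head?_eq_some_iff.1 hq
  rw [pathEdges_append_cons, List.append_assoc]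
  simp only [List.cons_append, List.nil_append]
  rw [pathEdges_append_pair, pathEdges_cons_cons, Sym2.eq_swap (a := y)]
  simp only [List.count_append, List.count_cons, List.count_nil, beq_iff_eq, eq_comm (a := e)]
  ring

/-- The list `l` is a path from `a` to `b` whose vertices alternate between `X` and `Y`. -/
structure IsAltPath (X Y : Finset V) (a b : V) (l : List V) : Prop where
  nodup : l.Nodup
  chain : l.IsChain fun u v => u ∈ X ∧ v ∈ Y ∨ u ∈ Y ∧ v ∈ X
  head : l.head? = some a
  last : l.getLast? = some b

theorem IsAltPath.reverse {X Y : Finset V} {a b : V} {l : List V} (h : IsAltPath X Y a b l) :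
    IsAltPath X Y b a l.reverse where
  nodup := List.nodup_reverse.2 h.nodup
  chain := by
    rw [List.isChain_reverse]
    exact h.chain.imp fun u v => by tauto
  head := by rw [List.head?_reverse, h.last]
  last := by rw [List.getLast?_reverse, h.head]

/-- Joining two alternating paths that avoid `y` and end at neighbours of `y`. -/
theorem IsAltPath.join {X Y : Finset V} {a t h b y : V} {p q : List V} (hp : IsAltPath X Y a t p)
    (hq : IsAltPath X Y h b q) (ht : t ∈ X) (hh : h ∈ X) (hy : y ∈ Y)
    (hnd : (p ++ y :: q).Nodup) : IsAltPath X Y a b (p ++ y :: q) where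
  nodup := hnd
  chain := by
    rw [List.isChain_append]
    refine ⟨hp.chain, ?_, ?_⟩
    · rw [List.isChain_cons]
      refine ⟨?_, hq.chain⟩
      intro u hu
      rw [hq.head, Option.mem_some_iff] at hu
      subst hu
      exact Or.inr ⟨hy, hh⟩
    · intro u hu v hv
      rw [hp.last, Option.mem_some_iff] at hu
      simp only [List.head?_cons, Option.mem_some_iff] at hv
      subst hu hv
      exact Or.inl ⟨ht, hy⟩
  head := by simp [List.head?_append, hp.head]
  last := by simp [List.getLast?_append, List.getLast?_cons, hq.last]

/-- A path from `X` to `X` through `y` enters `y` from a vertex `n c` on each of its two sides `c`.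
It can be rerouted on any set `f` of sides by joining the end of that side to `y` instead, so that
the end moves to `n c`. -/
theorem IsAltPath.exists_entry {X Y : Finset V} {a b y : V} {l : List V}
    (h : IsAltPath X Y a b l) (hXY : Disjoint X Y) (ha : a ∈ X) (hb : b ∈ X) (hy : y ∈ Y)
    (hyl : y ∈ l) :
    ∃ n : Bool → V, (∀ c, n c ∈ X) ∧ n false ≠ n true ∧
      (∀ x, (pathEdges l).count s(x, y) =
        (if x = n false then 1 else 0) + (if x = n true then 1 else 0)) ∧
      ∀ f : Bool → Bool, ∃ l', IsAltPath X Y (if f false then n false else a)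
          (if f true then n true else b) l' ∧ l'.toFinset = l.toFinset ∧
        ∀ e, (pathEdges l').count e + (if f false = true ∧ e = s(n false, y) then 1 else 0) +
            (if f true = true ∧ e = s(n true, y) then 1 else 0) =
          (pathEdges l).count e + (if f false = true ∧ e = s(a, y) then 1 else 0) +
            (if f true = true ∧ e = s(b, y) then 1 else 0) := by
  obtain ⟨p, q, rfl⟩ := List.append_of_mem hyl
  have hyX : y ∉ X := fun h' => disjoint_left.1 hXY h' hy
  have hp : p ≠ [] := by
    rintro rfl
    have := h.head
    simp only [List.nil_append, List.head?_cons, Option.some_inj] at this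
    exact hyX (this ▸ ha)
  have hq : q ≠ [] := by
    rintro rfl
    have := h.last
    simp only [List.getLast?_concat, Option.some_inj] at this
    exact hyX (this ▸ hb)
  obtain ⟨t, ht⟩ : ∃ t, p.getLast? = some t := ⟨_, List.getLast?_eq_some_getLast hp⟩
  obtain ⟨u, hu⟩ : ∃ u, q.head? = some u := ⟨_, List.head?_eq_some_head hq⟩
  have hch := h.chain
  rw [List.isChain_append, List.isChain_cons] at hch
  obtain ⟨hchp, ⟨hyu, hchq⟩, hty⟩ := hch
  have htX : t ∈ X := by
    rcases hty t (by simp [ht]) y (by simp) with h' | h'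
    · exact h'.1
    · exact absurd h'.2 hyX
  have huX : u ∈ X := by
    rcases hyu u (by simp [hu]) with h' | h'
    · exact absurd h'.1 hyX
    · exact h'.2
  have hnd := h.nodup
  have hnd' := h.nodup
  rw [List.nodup_append, List.nodup_cons] at hnd
  obtain ⟨hndp, ⟨hyq, hndq⟩, hdis⟩ := hnd
  have hyp : y ∉ p := fun h' => hdis y h' y (by simp) rfl
  have hpa : IsAltPath X Y a t p := by
    refine ⟨hndp, hchp, ?_, ht⟩
    have := h.head
    rwa [List.head?_append_of_ne_nil _ hp] at this
  have hqb : IsAltPath X Y u b q := by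
    refine ⟨hndq, hchq, hu, ?_⟩
    have := h.last
    rw [List.getLast?_append, List.getLast?_cons] at this
    obtain ⟨b', hb'⟩ : ∃ b', q.getLast? = some b' := ⟨_, List.getLast?_eq_some_getLast hq⟩
    rw [hb'] at this ⊢
    simpa using this
  refine ⟨fun c => if c then u else t, ?_, ?_, ?_, ?_⟩
  · intro c; cases c <;> simp [htX, huX]
  · simp only [Bool.false_eq_true, if_false, if_true]
    exact hdis t (List.mem_of_getLast? ht) u (List.mem_cons_of_mem _ (List.mem_of_mem_head? hu))
  · intro x
    have h0 : ∀ {l : List V}, y ∉ l → (pathEdges l).count s(x, y) = 0 := fun hl =>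
      List.count_eq_zero.2 fun h' => hl (mem_of_mem_pathEdges h' (Sym2.mem_mk_right x y))
    have h1 : ∀ v, s(x, y) = s(v, y) ↔ x = v := fun v => Sym2.congr_left
    rw [count_pathEdges_join ht hu, h0 hyp, h0 hyq]
    simp [h1]
  · intro f
    -- Reversing the initial or the final segment moves the corresponding end.
    have key1 : ∃ p', IsAltPath X Y (if f false then t else a) (if f false then a else t) p' ∧
        p'.Perm p ∧ ∀ e, (pathEdges p').count e = (pathEdges p).count e := by
      cases f false
      · exact ⟨p, by simpa using hpa, List.Perm.refl _, fun _ => rfl⟩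
      · exact ⟨p.reverse, by simpa using hpa.reverse, List.reverse_perm p, fun e => by
          rw [pathEdges_reverse, List.count_reverse]⟩
    have key2 : ∃ q', IsAltPath X Y (if f true then b else u) (if f true then u else b) q' ∧
        q'.Perm q ∧ ∀ e, (pathEdges q').count e = (pathEdges q).count e := by
      cases f true
      · exact ⟨q, by simpa using hqb, List.Perm.refl _, fun _ => rfl⟩
      · exact ⟨q.reverse, by simpa using hqb.reverse, List.reverse_perm q, fun e => by
          rw [pathEdges_reverse, List.count_reverse]⟩
    obtain ⟨p', hp', hpp, hpe⟩ := key1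
    obtain ⟨q', hq', hqp, hqe⟩ := key2
    have hperm : (p' ++ y :: q').Perm (p ++ y :: q) := hpp.append (hqp.cons y)
    refine ⟨p' ++ y :: q', ?_, List.toFinset_eq_of_perm _ _ hperm, ?_⟩
    · simp only [Bool.false_eq_true, if_false, if_true]
      refine hp'.join hq' ?_ ?_ hy (hperm.nodup_iff.2 hnd')
      · split_ifs <;> assumption
      · split_ifs <;> assumption
    · intro e
      rw [count_pathEdges_join hp'.last hq'.head, count_pathEdges_join ht hu, hpe, hqe]
      cases f false <;> cases f true <;> simp <;> ring

/-- The first edge of a path that starts in `X` and meets `Y`. -/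
theorem IsAltPath.exists_head_edge {X Y : Finset V} {a b : V} {l : List V}
    (h : IsAltPath X Y a b l) (hXY : Disjoint X Y) (ha : a ∈ X) (hY : (l.toFinset ∩ Y).Nonempty) :
    ∃ w ∈ l.toFinset ∩ Y, s(a, w) ∈ pathEdges l := by
  obtain ⟨l, rfl⟩ := List.head?_eq_some_iff.1 h.head
  cases l with
  | nil =>
    obtain ⟨z, hz⟩ := hY
    simp only [List.toFinset_cons, List.toFinset_nil, mem_inter, mem_insert, notMem_empty,
      or_false] at hz
    exact absurd hz.2 (hz.1 ▸ disjoint_left.1 hXY ha)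
  | cons w l =>
    refine ⟨w, ?_, by simp⟩
    have := h.chain
    rw [List.isChain_cons_cons] at this
    rcases this.1 with h' | h'
    · simp [h'.2]
    · exact absurd h'.1 (disjoint_left.1 hXY ha)

theorem IsAltPath.head_ne_last {X Y : Finset V} {a b : V} {l : List V}
    (h : IsAltPath X Y a b l) (hXY : Disjoint X Y) (ha : a ∈ X) (hY : (l.toFinset ∩ Y).Nonempty) :
    a ≠ b := by
  obtain ⟨w, hw, -⟩ := h.exists_head_edge hXY ha hY
  obtain ⟨l, rfl⟩ := List.head?_eq_some_iff.1 h.head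
  rintro rfl
  have hnd := List.nodup_cons.1 h.nodup
  have hl := h.last
  rw [List.getLast?_cons] at hl
  cases hlast : l.getLast? with
  | none =>
    rw [List.getLast?_eq_none_iff] at hlast
    subst hlast
    simp only [List.toFinset_cons, List.toFinset_nil, mem_inter, mem_insert, notMem_empty,
      or_false] at hw
    exact absurd hw.2 (hw.1 ▸ disjoint_left.1 hXY ha)
  | some c =>
    rw [hlast] at hl
    simp only [Option.getD_some, Option.some_inj] at hl
    subst hl
    exact hnd.1 (List.mem_of_getLast? hlast)

end Lists

theorem IsAltPath.exists_mem_of_mem_pathEdges {V : Type*} {X Y : Finset V} {a b : V} {l : List V}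
    (h : IsAltPath X Y a b l) {e : Sym2 V} (he : e ∈ pathEdges l) :
    ∃ x ∈ X, ∃ y ∈ Y, e = s(x, y) := by
  have hch := h.chain
  clear h
  induction l with
  | nil => simp at he
  | cons u l ih =>
    cases l with
    | nil => simp at he
    | cons v l =>
      rw [List.isChain_cons_cons] at hch
      rw [pathEdges_cons_cons, List.mem_cons] at he
      rcases he with rfl | he
      · rcases hch.1 with h | h
        · exact ⟨u, h.1, v, h.2, rfl⟩
        · exact ⟨v, h.2, u, h.1, Sym2.eq_swap⟩
      · exact ih he hch.2

/-! ### Path systems with hanging edges -/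

section Extension

variable {V ι : Type*} [DecidableEq V] [Fintype ι] [DecidableEq ι]

/-- The number of times the edge `e` is used by a family of paths. -/
def edgeCount (P : ι → List V) (e : Sym2 V) : ℕ := ∑ i, (pathEdges (P i)).count e

theorem one_le_edgeCount {P : ι → List V} {e : Sym2 V} {i : ι} (h : e ∈ pathEdges (P i)) :
    1 ≤ edgeCount P e :=
  (List.one_le_count_iff.2 h).trans
    (single_le_sum (f := fun i => (pathEdges (P i)).count e) (fun _ _ => Nat.zero_le _) (mem_univ i))

theorem two_le_edgeCount {P : ι → List V} {e : Sym2 V} {i j : ι} (hij : i ≠ j)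
    (hi : e ∈ pathEdges (P i)) (hj : e ∈ pathEdges (P j)) : 2 ≤ edgeCount P e := by
  have h1 := List.one_le_count_iff.2 hi
  have h2 := List.one_le_count_iff.2 hj
  have h3 : ∑ m ∈ {i, j}, (pathEdges (P m)).count e ≤ edgeCount P e :=
    sum_le_sum_of_subset (subset_univ _)
  rw [sum_pair hij] at h3
  omega

/-- The two ends of a path, indexed by its sides. -/
abbrev IsAltPathOf (X Y : Finset V) (loc : ι × Bool → V) (i : ι) (l : List V) : Prop :=
  IsAltPath X Y (loc (i, false)) (loc (i, true)) l

/-- A family of paths between `X` and `Y` with both ends in `X`, and a set of hanging edges, given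
by the neighbourhoods `E x ⊆ Y` of the vertices `x ∈ X`; all these edges are distinct. -/
structure IsHanging (k : ℕ) (X Y : Finset V) (S : ι → Finset V) (P : ι → List V)
    (loc : ι × Bool → V) (E : V → Finset V) : Prop where
  path : ∀ i, IsAltPathOf X Y loc i (P i)
  loc_mem : ∀ α, loc α ∈ X
  toFinset_eq : ∀ i, (P i).toFinset = S i
  nonempty : ∀ i, (S i ∩ Y).Nonempty
  card_le : ∀ i, #(S i ∩ Y) ≤ k
  hang_subset : ∀ x, E x ⊆ Y
  mem_of_hang : ∀ x y, y ∈ E x → x ∈ X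
  simple : ∀ x ∈ X, ∀ y ∈ Y, edgeCount P s(x, y) + (if y ∈ E x then 1 else 0) ≤ 1

variable {k : ℕ} {X Y D : Finset V} {S : ι → Finset V} {P : ι → List V} {loc : ι × Bool → V}
  {E : V → Finset V} {lab : ι × Bool → Option V} {lost : V → Finset V}

theorem IsHanging.endSystem (h : IsHanging k X Y S P loc E) (hXY : Disjoint X Y) :
    EndSystem k X Y S loc E where
  card_le := h.card_le
  hang_subset := h.hang_subset
  mem_of_hang := h.mem_of_hang
  loc_mem := h.loc_mem
  exists_notMem := by
    have key : ∀ α, ∃ w ∈ S α.1 ∩ Y, s(loc α, w) ∈ pathEdges (P α.1) := by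
      rintro ⟨i, c⟩
      have hne := h.nonempty i
      rw [← h.toFinset_eq] at hne ⊢
      cases c
      · exact (h.path i).exists_head_edge hXY (h.loc_mem _) hne
      · obtain ⟨w, hw, he⟩ := (h.path i).reverse.exists_head_edge hXY (h.loc_mem _)
          (by rwa [List.toFinset_reverse])
        rw [List.toFinset_reverse] at hw
        rw [pathEdges_reverse, List.mem_reverse] at he
        exact ⟨w, hw, he⟩
    intro α
    obtain ⟨w, hw, he⟩ := key α
    refine ⟨w, hw, fun hwE => ?_⟩
    have h1 := h.simple _ (h.loc_mem α) w (mem_inter.1 hw).2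
    have h2 := one_le_edgeCount he
    rw [if_pos hwE] at h1
    omega
  loc_ne := by
    have key : ∀ i, loc (i, false) ≠ loc (i, true) := fun i =>
      (h.path i).head_ne_last hXY (h.loc_mem _) (by rw [h.toFinset_eq]; exact h.nonempty i)
    rintro ⟨i, c⟩
    cases c
    · exact (key i).symm
    · exact key i

/-- Processing one vertex `y`: the hanging edges at `y` are exchanged against edges at `y` inside
the paths, and the resulting hanging edges at `y` are assigned to ends of paths. -/
theorem IsHanging.exists_step [Nonempty ι] (h : IsHanging k X Y S P loc E) (hXY : Disjoint X Y)
    (hL : Labelling k X D S loc E lab lost) {y : V} (hy : y ∉ D) (hDY : insert y D ⊆ Y) :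
    ∃ P' loc' E' lab' lost', IsHanging k X Y S P' loc' E' ∧
      Labelling k X (insert y D) S loc' E' lab' lost' ∧
      (∀ x ∈ X, ∀ z ∈ Y, edgeCount P' s(x, z) + (if z ∈ E' x then 1 else 0) =
        edgeCount P s(x, z) + (if z ∈ E x then 1 else 0)) ∧
      (∀ z ∈ Y, #{x ∈ X | z ∈ E' x} = #{x ∈ X | z ∈ E x}) := by
  classical
  have hE := h.endSystem hXY
  have hyY : y ∈ Y := hDY (mem_insert_self y D)
  have hentry : ∀ i, ∃ n : Bool → V, y ∈ S i → ((∀ c, n c ∈ X) ∧ n false ≠ n true ∧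
      (∀ x, (pathEdges (P i)).count s(x, y) =
        (if x = n false then 1 else 0) + (if x = n true then 1 else 0)) ∧
      ∀ f : Bool → Bool, ∃ l', IsAltPath X Y (if f false then n false else loc (i, false))
          (if f true then n true else loc (i, true)) l' ∧ l'.toFinset = (P i).toFinset ∧
        ∀ e, (pathEdges l').count e + (if f false = true ∧ e = s(n false, y) then 1 else 0) +
            (if f true = true ∧ e = s(n true, y) then 1 else 0) =
          (pathEdges (P i)).count e + (if f false = true ∧ e = s(loc (i, false), y) then 1 else 0) +
            (if f true = true ∧ e = s(loc (i, true), y) then 1 else 0)) := by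
    intro i
    by_cases hyi : y ∈ S i
    · have hyl : y ∈ P i := by rw [← List.mem_toFinset, h.toFinset_eq]; exact hyi
      obtain ⟨n, hn⟩ := (h.path i).exists_entry hXY (h.loc_mem _) (h.loc_mem _) hyY hyl
      exact ⟨n, fun _ => hn⟩
    · exact ⟨fun _ => y, fun h' => absurd h' hyi⟩
  choose n hn using hentry
  let near (α : ι × Bool) : V := n α.1 α.2
  have hedge : ∀ α : ι × Bool, y ∈ S α.1 → s(near α, y) ∈ pathEdges (P α.1) := by
    rintro ⟨i, c⟩ hα
    rw [← List.one_le_count_iff, (hn i hα).2.2.1]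
    cases c <;> simp [near]
  have hnear : IsEntry X S E y near := by
    refine ⟨fun α hα => (hn α.1 hα).1 α.2, fun α hα hyE => ?_, fun α β hα hβ e => ?_⟩
    · have h1 := h.simple _ ((hn α.1 hα).1 α.2) y hyY
      have h2 := one_le_edgeCount (hedge α hα)
      rw [if_pos hyE] at h1
      simp only [near] at h2
      omega
    · have h1 := h.simple _ ((hn α.1 hα).1 α.2) y hyY
      by_cases hi : α.1 = β.1
      · obtain ⟨i, c⟩ := α
        obtain ⟨j, d⟩ := β
        obtain rfl : i = j := hi
        have h2 := (hn i hα).2.1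
        cases c <;> cases d <;> first | rfl | (exact absurd e h2) | (exact absurd e.symm h2)
      · have hβ' := hedge β hβ
        rw [← e] at hβ'
        have h2 := two_le_edgeCount hi (hedge α hα) hβ'
        simp only [near] at h2
        omega
  obtain ⟨A, B, C, hS⟩ := exists_service (near := near) hE hL hy hDY
  let fl := isFlipped X S loc near E y C
  have hflS : ∀ α, fl α = true → y ∈ S α.1 := fun α hα => (isFlipped_iff.1 hα).1
  have hpath : ∀ i, ∃ l', IsAltPathOf X Y (newLoc X S loc near E y C) i l' ∧ l'.toFinset = S i ∧
      ∀ e, (pathEdges l').count e + ((if fl (i, true) = true ∧ e = s(near (i, true), y) then 1 else 0) +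
            (if fl (i, false) = true ∧ e = s(near (i, false), y) then 1 else 0)) =
          (pathEdges (P i)).count e + ((if fl (i, true) = true ∧ e = s(loc (i, true), y) then 1 else 0) +
            (if fl (i, false) = true ∧ e = s(loc (i, false), y) then 1 else 0)) := by
    intro i
    by_cases hyi : y ∈ S i
    · obtain ⟨l', h1, h2, h3⟩ := (hn i hyi).2.2.2 fun c => fl (i, c)
      refine ⟨l', h1, h2.trans (h.toFinset_eq i), fun e => ?_⟩
      have := h3 e
      simp only [near]
      omega
    · have hf : ∀ c, fl (i, c) = false := fun c => by
        rw [← Bool.not_eq_true]; exact fun h' => hyi (hflS _ h')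
      refine ⟨P i, ?_, h.toFinset_eq i, fun e => by simp [hf]⟩
      have hl : ∀ c, newLoc X S loc near E y C (i, c) = loc (i, c) := fun c => by
        unfold newLoc; rw [if_neg]; exact fun h' => hyi (hflS _ h')
      unfold IsAltPathOf
      rw [hl, hl]; exact h.path i
  choose P' hP1 hP2 hP3 using hpath
  have hcount : ∀ e, edgeCount P' e + #{α | fl α = true ∧ e = s(near α, y)} =
      edgeCount P e + #{α | fl α = true ∧ e = s(loc α, y)} := by
    intro e
    simp only [card_filter, Fintype.sum_prod_type, Fintype.sum_bool, edgeCount, ← sum_add_distrib]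
    exact sum_congr rfl fun i _ => hP3 i e
  have hEy : ∀ x, y ∈ newHang X S loc near E y C x → x ∈ X := by
    intro x hx
    by_cases hcl : IsClient X S loc near E y x
    · exact hcl.1
    · rw [newHang_of_not hcl] at hx; exact h.mem_of_hang x y hx
  have hlocX : ∀ α, newLoc X S loc near E y C α ∈ X := by
    intro α
    unfold newLoc
    split_ifs with hf
    · exact hnear.mem α (hflS α hf)
    · exact h.loc_mem α
  have hsum : ∀ x ∈ X, ∀ z ∈ Y, edgeCount P' s(x, z) +
      (if z ∈ newHang X S loc near E y C x then 1 else 0) =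
        edgeCount P s(x, z) + (if z ∈ E x then 1 else 0) := by
    intro x hx z hz
    by_cases hzy : z = y
    · have h1 := hcount s(x, y)
      have h2 := hS.card_flipped hnear x
      have h3 : ∀ v, s(x, y) = s(v, y) ↔ v = x := fun v => Sym2.congr_left.trans eq_comm
      simp only [h3] at h1
      simp only [fl] at h1
      rw [hzy]
      omega
    · have h1 := hcount s(x, z)
      have h3 : ∀ v, s(x, z) ≠ s(v, y) := by
        intro v e
        rcases Sym2.eq_iff.1 e with h' | h'
        · exact hzy h'.2
        · exact disjoint_left.1 hXY hx (h'.1 ▸ hyY)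
      simp only [h3, and_false, filter_false, card_empty, add_zero] at h1
      rw [h1, if_congr (mem_newHang_of_ne hzy) rfl rfl]
  refine ⟨P', newLoc X S loc near E y C, newHang X S loc near E y C,
    newLab X S loc near E lab y A B C, newLost X S loc near E lost y C, ?_,
    hS.labelling hnear hE hL hy, hsum, ?_⟩
  · refine ⟨hP1, hlocX, hP2, h.nonempty, h.card_le, ?_, ?_, ?_⟩
    · intro x z hz
      by_cases hzy : z = y
      · exact hzy ▸ hyY
      · exact h.hang_subset x ((mem_newHang_of_ne hzy).1 hz)
    · intro x z hz
      by_cases hzy : z = y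
      · exact hEy x (hzy ▸ hz)
      · exact h.mem_of_hang x z ((mem_newHang_of_ne hzy).1 hz)
    · intro x hx z hz
      rw [hsum x hx z hz]; exact h.simple x hx z hz
  · intro z hz
    by_cases hzy : z = y
    · have h1 := sum_congr rfl fun x (_ : x ∈ X) => hS.card_flipped hnear x
      rw [sum_add_distrib, sum_add_distrib, ← card_filter, ← card_filter] at h1
      have h2 : ∀ g : ι × Bool → V, (∀ α, fl α = true → g α ∈ X) →
          ∑ x ∈ X, #{α | fl α = true ∧ g α = x} = #{α | fl α = true} := by
        intro g hg
        rw [card_eq_sum_card_fiberwise (f := g) (t := X) fun α hα => hg α (by simpa using hα)]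
        simp only [filter_filter]
      rw [h2 loc fun α _ => h.loc_mem α, h2 near fun α hα => hnear.mem α (hflS α hα)] at h1
      rw [hzy]
      omega
    · simp only [mem_newHang_of_ne hzy]

end Extension

/-! ### Extension of a path system -/

section ExtensionResult

variable {V ι : Type*} [DecidableEq V] [Fintype ι] [DecidableEq ι]
  {k : ℕ} {X Y : Finset V} {S : ι → Finset V} {P : ι → List V} {loc : ι × Bool → V}
  {E : V → Finset V}

/-- Processing the vertices of `D ⊆ Y` one after the other. -/
theorem IsHanging.exists_labelling [Nonempty ι] (h : IsHanging k X Y S P loc E)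
    (hXY : Disjoint X Y) (hcard : ∀ x ∈ X, #(endsAt loc x) = #(E x))
    (hsize : ∀ x ∈ X, 2 * k + 4 ≤ #(E x)) {D : Finset V} (hD : D ⊆ Y) :
    ∃ P' loc' E' lab' lost', IsHanging k X Y S P' loc' E' ∧
      Labelling k X D S loc' E' lab' lost' ∧
      (∀ x ∈ X, ∀ z ∈ Y, edgeCount P' s(x, z) + (if z ∈ E' x then 1 else 0) =
        edgeCount P s(x, z) + (if z ∈ E x then 1 else 0)) ∧
      (∀ z ∈ Y, #{x ∈ X | z ∈ E' x} = #{x ∈ X | z ∈ E x}) := by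
  induction D using Finset.induction_on with
  | empty =>
    refine ⟨P, loc, E, fun _ => none, fun _ => ∅, h, ?_, fun _ _ _ _ => rfl, fun _ _ => rfl⟩
    refine ⟨by simp, by simp, by simp, by simp, by simp, by simp, hcard, by simp, ?_⟩
    intro x hx
    have := hsize x hx
    rw [← hcard x hx] at this
    exact ⟨by simpa using this, by simp; omega, Or.inl (by simp)⟩
  | insert y D hy ih =>
    obtain ⟨P₁, loc₁, E₁, lab₁, lost₁, h1, h2, h3, h4⟩ := ih ((subset_insert y D).trans hD)
    obtain ⟨P₂, loc₂, E₂, lab₂, lost₂, g1, g2, g3, g4⟩ := h1.exists_step hXY h2 hy hD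
    exact ⟨P₂, loc₂, E₂, lab₂, lost₂, g1, g2, fun x hx z hz => (g3 x hx z hz).trans (h3 x hx z hz),
      fun z hz => (g4 z hz).trans (h4 z hz)⟩

/-- **Extension of a path system.** If every vertex of `X` is the end of as many paths as it has
hanging edges, and of at least `2 * k + 4`, then the paths can be rearranged and prolonged by
hanging edges at both ends so that the new paths cover all these edges. -/
theorem IsHanging.exists_extension (h : IsHanging k X Y S P loc E)
    (hXY : Disjoint X Y) (hcard : ∀ x ∈ X, #(endsAt loc x) = #(E x))
    (hsize : ∀ x ∈ X, 2 * k + 4 ≤ #(E x)) :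
    ∃ (P' : ι → List V) (loc' : ι × Bool → V), (∀ i, IsAltPathOf Y X loc' i (P' i)) ∧
      (∀ α, loc' α ∈ Y) ∧ (∀ i, (P' i).toFinset ∩ X = S i ∩ X) ∧
      (∀ i, #((P' i).toFinset ∩ Y) = #(S i ∩ Y) + 2) ∧
      (∀ x ∈ X, ∀ y ∈ Y, edgeCount P' s(x, y) =
        edgeCount P s(x, y) + (if y ∈ E x then 1 else 0)) ∧
      (∀ y ∈ Y, #(endsAt loc' y) = #{x ∈ X | y ∈ E x}) := by
  classical
  rcases isEmpty_or_nonempty ι with hι | hι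
  · have hX : ∀ x ∈ X, False := by
      intro x hx
      have h1 := hcard x hx
      have h2 := hsize x hx
      rw [← h1, card_eq_zero.2 (eq_empty_of_isEmpty _)] at h2
      omega
    refine ⟨P, loc, fun i => isEmptyElim i, fun α => isEmptyElim α.1, fun i => isEmptyElim i,
      fun i => isEmptyElim i, fun x hx => (hX x hx).elim, fun y _ => ?_⟩
    rw [card_eq_zero.2 (eq_empty_of_isEmpty _), eq_comm, card_eq_zero, filter_eq_empty_iff]
    exact fun x hx => (hX x hx).elim
  obtain ⟨Q, pos, E', lab, lost, h1, hL, h3, h4⟩ := h.exists_labelling hXY hcard hsize subset_rfl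
  have hlab : ∀ α, ∃ z, lab α = some z := by
    intro α
    rw [← Option.ne_none_iff_exists']
    intro hα
    have hop := hL.card_open (h1.loc_mem α)
    rw [sdiff_eq_empty_iff_subset.2 (h1.hang_subset _), card_empty, card_eq_zero] at hop
    have : α ∈ openEnds pos lab (pos α) := by simp [hα]
    simp [hop] at this
  choose z hz using hlab
  have hzE : ∀ α, z α ∈ E' (pos α) := fun α => hL.mem_hang α _ (hz α)
  have hzY : ∀ α, z α ∈ Y := fun α => h1.hang_subset _ (hzE α)
  have hzS : ∀ α, z α ∉ S α.1 := fun α => hL.notMem α _ (hz α)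
  have hzne : ∀ i, z (i, false) ≠ z (i, true) := by
    intro i e
    exact hL.ne_partner (i, false) _ (hz _) (by rw [e]; exact hz (i, true))
  have hnotX : ∀ α, z α ∉ X := fun α h' => disjoint_left.1 hXY h' (hzY α)
  have hSQ : ∀ α, z α ∉ Q α.1 := by
    intro α h'
    rw [← List.mem_toFinset, h1.toFinset_eq] at h'
    exact hzS α h'
  have hset : ∀ i, (z (i, false) :: (Q i ++ [z (i, true)])).toFinset =
      insert (z (i, false)) (insert (z (i, true)) (S i)) := by
    intro i
    rw [← h1.toFinset_eq]
    ext v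
    simp
  refine ⟨fun i => z (i, false) :: (Q i ++ [z (i, true)]), z, ?_, hzY, ?_, ?_, ?_, ?_⟩
  · intro i
    have hp := h1.path i
    refine ⟨?_, ?_, by simp, by simp [List.getLast?_cons]⟩
    · rw [List.nodup_cons, List.nodup_append]
      have e1 := hSQ (i, false)
      have e2 := hSQ (i, true)
      refine ⟨by simp [e1, hzne i], hp.nodup, by simp, ?_⟩
      intro a ha b hb
      rw [List.mem_singleton] at hb
      rintro rfl
      exact e2 (hb ▸ ha)
    · rw [List.isChain_cons, List.isChain_append]
      refine ⟨?_, hp.chain.imp fun u v => by tauto, by simp, ?_⟩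
      · intro u hu
        rw [List.head?_append, hp.head] at hu
        simp only [Option.some_or, Option.mem_some_iff] at hu
        subst hu
        exact Or.inl ⟨hzY _, h1.loc_mem _⟩
      · intro u hu v hv
        rw [hp.last, Option.mem_some_iff] at hu
        simp only [List.head?_cons, Option.mem_some_iff] at hv
        subst hu hv
        exact Or.inr ⟨h1.loc_mem _, hzY _⟩
  · intro i
    rw [hset, insert_inter_of_notMem (hnotX _), insert_inter_of_notMem (hnotX _)]
  · intro i
    rw [hset, insert_inter_of_mem (hzY _), insert_inter_of_mem (hzY _), card_insert_of_notMem,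
      card_insert_of_notMem]
    · exact fun h' => hzS (i, true) (mem_inter.1 h').1
    · rw [mem_insert, not_or]
      exact ⟨hzne i, fun h' => hzS (i, false) (mem_inter.1 h').1⟩
  · intro x hx y hy
    rw [← h3 x hx y hy]
    have hpe : ∀ i, (pathEdges (z (i, false) :: (Q i ++ [z (i, true)]))).count s(x, y) =
        (pathEdges (Q i)).count s(x, y) + ∑ c, if pos (i, c) = x ∧ z (i, c) = y then 1 else 0 := by
      intro i
      have key : ∀ α, s(z α, pos α) = s(x, y) ↔ pos α = x ∧ z α = y := by
        intro α
        rw [Sym2.eq_iff]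
        constructor
        · rintro (h' | h')
          · exact absurd (h'.1 ▸ hx) (hnotX α)
          · exact ⟨h'.2, h'.1⟩
        · rintro ⟨h', h''⟩; exact Or.inr ⟨h'', h'⟩
      have hhead := (h1.path i).head
      have hlast := (h1.path i).last
      obtain ⟨q, hq⟩ := List.getLast?_eq_some_iff.1 hlast
      obtain ⟨r, hr⟩ := List.head?_eq_some_iff.1 hhead
      rw [hr, List.cons_append, pathEdges_cons_cons, List.count_cons, ← List.cons_append, ← hr, hq,
        List.append_assoc, List.cons_append, List.nil_append, pathEdges_append_pair,
        List.count_append, Fintype.sum_bool, List.count_singleton, Sym2.eq_swap (a := pos (i, true))]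
      simp only [beq_iff_eq, key]
      ring
    have hsum : (∑ i, ∑ c, if pos (i, c) = x ∧ z (i, c) = y then 1 else 0) =
        if y ∈ E' x then 1 else 0 := by
      rw [← Fintype.sum_prod_type' (f := fun i c => if pos (i, c) = x ∧ z (i, c) = y then 1 else 0),
        ← card_filter]
      split_ifs with hyE
      · obtain ⟨α, h5, h6⟩ := hL.surj x y hyE hy
        rw [card_eq_one]
        refine ⟨α, ?_⟩
        ext β
        simp only [mem_filter, mem_univ, true_and, mem_singleton]
        constructor
        · rintro ⟨h7, h8⟩
          exact hL.inj β α y (h7.trans h5.symm) (h8 ▸ hz β) h6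
        · rintro rfl
          exact ⟨h5, Option.some_injective _ ((hz β).symm.trans h6)⟩
      · rw [card_eq_zero, filter_eq_empty_iff]
        rintro β - ⟨rfl, rfl⟩
        exact hyE (hzE β)
    rw [← hsum]
    simp only [edgeCount, hpe, sum_add_distrib]
  · intro y hy
    rw [← h4 y hy]
    refine card_bij (fun α _ => pos α) ?_ ?_ ?_
    · intro α hα
      rw [mem_endsAt] at hα
      exact mem_filter.2 ⟨h1.loc_mem α, hα ▸ hzE α⟩
    · intro α hα β hβ e
      rw [mem_endsAt] at hα hβ
      exact hL.inj α β y e (hα ▸ hz α) (hβ ▸ hz β)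
    · intro x hx
      obtain ⟨hxX, hyE⟩ := mem_filter.1 hx
      obtain ⟨α, h5, h6⟩ := hL.surj x y hyE hy
      exact ⟨α, mem_endsAt.2 (Option.some_injective _ ((hz α).symm.trans h6)), h5⟩

end ExtensionResult

/-! ### Building paths outwards from their centres -/

section Tower

universe u

variable {V : Type u} [Fintype V] [DecidableEq V]

/-- The neighbours of `v` along the edges of `W`. -/
def nbr (W : Finset (Sym2 V)) (v : V) : Finset V := {w | s(v, w) ∈ W}

@[simp] theorem mem_nbr {W : Finset (Sym2 V)} {v w : V} : w ∈ nbr W v ↔ s(v, w) ∈ W := by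
  simp [nbr]

theorem card_nbr (W : Finset (Sym2 V)) (v : V) : #(nbr W v) = edgeDeg W v := by
  refine card_bij (fun w _ => s(v, w)) ?_ ?_ ?_
  · intro w hw; simpa using hw
  · intro w _ w' _ e; exact Sym2.congr_right.1 e
  · intro e he
    obtain ⟨he, hv⟩ := mem_filter.1 he
    obtain ⟨w, rfl⟩ := Sym2.mem_iff_exists.1 hv
    exact ⟨w, by simpa using he, rfl⟩

/-- Every edge of `W` joins `X` and `Y`. -/
def IsBetween (X Y : Finset V) (W : Finset (Sym2 V)) : Prop :=
  ∀ e ∈ W, ∃ x ∈ X, ∃ y ∈ Y, e = s(x, y)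

theorem IsBetween.symm {X Y : Finset V} {W : Finset (Sym2 V)} (h : IsBetween X Y W) :
    IsBetween Y X W := by
  intro e he
  obtain ⟨x, hx, y, hy, rfl⟩ := h e he
  exact ⟨y, hy, x, hx, Sym2.eq_swap⟩

theorem IsBetween.mem_of_mem {X Y : Finset V} {W : Finset (Sym2 V)} (h : IsBetween X Y W)
    (hXY : Disjoint X Y) {x y : V} (he : s(x, y) ∈ W) (hx : x ∈ X) : y ∈ Y := by
  obtain ⟨x', hx', y', hy', e⟩ := h _ he
  rcases Sym2.eq_iff.1 e with h' | h'
  · rw [h'.2]; exact hy'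
  · exact absurd hx (h'.1 ▸ disjoint_right.1 hXY hy')

/-- An edge set with even degrees on the side `Y` splits into paths of length two centred in `Y`. -/
theorem exists_pairing {X Y : Finset V} {W : Finset (Sym2 V)} (hXY : Disjoint X Y)
    (hW : IsBetween X Y W) (heven : ∀ y ∈ Y, Even (edgeDeg W y)) :
    ∃ (ι : Type u) (_ : Fintype ι) (_ : DecidableEq ι) (P : ι → List V) (loc : ι × Bool → V),
      (∀ i, IsAltPathOf X Y loc i (P i)) ∧ (∀ α, loc α ∈ X) ∧
      (∀ i, #((P i).toFinset ∩ Y) = 1) ∧ (∀ i, #((P i).toFinset ∩ X) = 2) ∧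
      (∀ x ∈ X, ∀ y ∈ Y, edgeCount P s(x, y) = if s(x, y) ∈ W then 1 else 0) ∧
      ∀ x ∈ X, #(endsAt loc x) = edgeDeg W x := by
  classical
  have hcard : ∀ y : Y, Fintype.card (Fin (edgeDeg W y / 2) × Bool) = Fintype.card (nbr W (y : V)) := by
    intro y
    obtain ⟨m, hm⟩ := heven y y.2
    simp only [Fintype.card_prod, Fintype.card_fin, Fintype.card_bool, Fintype.card_coe, card_nbr]
    omega
  let f (y : Y) := Fintype.equivOfCardEq (hcard y)
  let loc (α : (Σ y : Y, Fin (edgeDeg W y / 2)) × Bool) : V := f α.1.1 (α.1.2, α.2)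
  have hmem : ∀ α, s((α.1.1 : V), loc α) ∈ W := fun α => mem_nbr.1 (f α.1.1 (α.1.2, α.2)).2
  have hX : ∀ α, loc α ∈ X := fun α => hW.symm.mem_of_mem hXY.symm (hmem α) α.1.1.2
  have hinj : ∀ α β, α.1.1 = β.1.1 → loc α = loc β → α = β := by
    rintro ⟨⟨y, j⟩, c⟩ ⟨⟨y', j'⟩, c'⟩ e e'
    obtain rfl : y = y' := e
    have := (f y).injective (Subtype.ext e')
    obtain ⟨rfl, rfl⟩ := Prod.mk.inj this
    rfl
  have hsurj : ∀ (y : Y) x, s((y : V), x) ∈ W → ∃ α, α.1.1 = y ∧ loc α = x := by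
    intro y x hx
    refine ⟨(⟨y, ((f y).symm ⟨x, mem_nbr.2 hx⟩).1⟩, ((f y).symm ⟨x, mem_nbr.2 hx⟩).2), rfl, ?_⟩
    simp [loc]
  have hne : ∀ i, loc (i, false) ≠ loc (i, true) := fun i e => by
    have := congrArg Prod.snd (hinj (i, false) (i, true) rfl e)
    simp at this
  have hXnY : ∀ α, loc α ∉ Y := fun α => disjoint_left.1 hXY (hX α)
  have hYnX : ∀ y : Y, (y : V) ∉ X := fun y => disjoint_right.1 hXY y.2
  have hneY : ∀ α (y : Y), loc α ≠ y := fun α y e => hXnY α (e ▸ y.2)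
  refine ⟨_, inferInstance, inferInstance, fun i => [loc (i, false), (i.1 : V), loc (i, true)], loc,
    ?_, hX, ?_, ?_, ?_, ?_⟩
  · intro i
    refine ⟨?_, ?_, rfl, rfl⟩
    · simp [hne i, hneY, (hneY _ _).symm]
    · simp [hX]
  · intro i
    rw [card_eq_one]
    refine ⟨i.1, ?_⟩
    ext v
    simp only [List.toFinset_cons, List.toFinset_nil, mem_inter, mem_insert, notMem_empty, or_false,
      mem_singleton]
    constructor
    · rintro ⟨rfl | h | rfl, hv⟩
      · exact absurd hv (hXnY _)
      · exact h
      · exact absurd hv (hXnY _)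
    · rintro rfl; exact ⟨Or.inr (Or.inl rfl), i.1.2⟩
  · intro i
    rw [card_eq_two]
    refine ⟨_, _, hne i, ?_⟩
    ext v
    simp only [List.toFinset_cons, List.toFinset_nil, mem_inter, mem_insert, notMem_empty, or_false,
      mem_singleton]
    constructor
    · rintro ⟨h | rfl | h, hv⟩
      · exact Or.inl h
      · exact absurd hv (hYnX _)
      · exact Or.inr h
    · rintro (rfl | rfl)
      · exact ⟨Or.inl rfl, hX _⟩
      · exact ⟨Or.inr (Or.inr rfl), hX _⟩
  · intro x hx y hy
    have key : ∀ α : (Σ y : Y, Fin (edgeDeg W y / 2)) × Bool,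
        s(loc α, (α.1.1 : V)) = s(x, y) ↔ loc α = x ∧ (α.1.1 : V) = y := by
      intro α
      rw [Sym2.eq_iff]
      refine or_iff_left ?_
      rintro ⟨h1, -⟩
      exact hXnY α (h1 ▸ hy)
    have hpe : ∀ i : (Σ y : Y, Fin (edgeDeg W y / 2)),
        (pathEdges [loc (i, false), (i.1 : V), loc (i, true)]).count s(x, y) =
        ∑ c, if loc (i, c) = x ∧ (i.1 : V) = y then 1 else 0 := by
      intro i
      rw [pathEdges_cons_cons, pathEdges_cons_cons, pathEdges_singleton, Fintype.sum_bool,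
        Sym2.eq_swap (a := (i.1 : V))]
      simp only [List.count_cons, List.count_nil, beq_iff_eq, key, zero_add]
    simp only [edgeCount, hpe]
    rw [← Fintype.sum_prod_type' (f := fun (i : Σ y : Y, Fin (edgeDeg W y / 2)) c =>
      if loc (i, c) = x ∧ (i.1 : V) = y then 1 else 0), ← card_filter]
    split_ifs with he
    · obtain ⟨α, h1, h2⟩ := hsurj ⟨y, hy⟩ x (by rwa [Sym2.eq_swap])
      rw [card_eq_one]
      refine ⟨α, ?_⟩
      ext β
      simp only [mem_filter, mem_univ, true_and, mem_singleton]
      constructor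
      · rintro ⟨h3, h4⟩
        exact hinj β α (Subtype.ext (by rw [h4, h1])) (h3.trans h2.symm)
      · rintro rfl
        exact ⟨h2, by rw [h1]⟩
    · rw [card_eq_zero, filter_eq_empty_iff]
      rintro β - ⟨rfl, rfl⟩
      exact he (by rw [Sym2.eq_swap]; exact hmem β)
  · intro x hx
    rw [← card_nbr]
    refine card_bij (fun α _ => (α.1.1 : V)) ?_ ?_ ?_
    · intro α hα
      rw [mem_endsAt] at hα
      rw [mem_nbr, ← hα, Sym2.eq_swap]; exact hmem α
    · intro α hα β hβ e
      rw [mem_endsAt] at hα hβ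
      exact hinj α β (Subtype.ext e) (hα.trans hβ.symm)
    · intro y hy
      rw [mem_nbr] at hy
      obtain ⟨α, h1, h2⟩ := hsurj ⟨y, hW.mem_of_mem hXY hy hx⟩ x (by rwa [Sym2.eq_swap])
      exact ⟨α, mem_endsAt.2 h2, by rw [h1]⟩

/-- Paths built outwards from their centres: the edges of `W 0` are paired at their centres, and
each `W (r + 1)` is used to prolong the paths at both ends. The sides of the bipartite graph are
listed alternately as `side r`, so that after `r` steps the ends are in `side r`. -/
theorem exists_path_system {k : ℕ} {side : ℕ → Finset V} {W : ℕ → Finset (Sym2 V)}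
    (hside : ∀ r, side (r + 2) = side r) (hdis : Disjoint (side 0) (side 1))
    (hW : ∀ r, IsBetween (side 0) (side 1) (W r))
    (hWd : ∀ r ≤ k, ∀ r' ≤ k, r ≠ r' → Disjoint (W r) (W r'))
    (heven : ∀ y ∈ side 1, Even (edgeDeg (W 0) y))
    (hdeg : ∀ r < k, ∀ x ∈ side r, edgeDeg (W (r + 1)) x = edgeDeg (W r) x)
    (hlarge : ∀ r < k, ∀ x ∈ side r, 2 * k + 4 ≤ edgeDeg (W (r + 1)) x) {r : ℕ} (hr : r ≤ k) :
    ∃ (ι : Type u) (_ : Fintype ι) (_ : DecidableEq ι) (P : ι → List V) (loc : ι × Bool → V),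
      (∀ i, IsAltPathOf (side r) (side (r + 1)) loc i (P i)) ∧ (∀ α, loc α ∈ side r) ∧
      (∀ i, #((P i).toFinset ∩ side (r + 1)) = r + 1) ∧
      (∀ i, #((P i).toFinset ∩ side r) = r + 2) ∧
      (∀ x ∈ side r, ∀ y ∈ side (r + 1),
        edgeCount P s(x, y) = ∑ t ∈ range (r + 1), if s(x, y) ∈ W t then 1 else 0) ∧
      ∀ x ∈ side r, #(endsAt loc x) = edgeDeg (W r) x := by
  classical
  have hdis' : ∀ r, Disjoint (side r) (side (r + 1)) := by
    intro r
    induction r with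
    | zero => exact hdis
    | succ r ih => rw [hside]; exact ih.symm
  have hW' : ∀ t r, IsBetween (side r) (side (r + 1)) (W t) := by
    intro t r
    induction r with
    | zero => exact hW t
    | succ r ih => rw [hside]; exact ih.symm
  induction r with
  | zero =>
    obtain ⟨ι, i1, i2, P, loc, h1, h2, h3, h4, h5, h6⟩ := exists_pairing hdis (hW 0) heven
    exact ⟨ι, i1, i2, P, loc, h1, h2, h3, h4, fun x hx y hy => by
      rw [h5 x hx y hy, zero_add, range_one, sum_singleton], h6⟩
  | succ r ih =>
    obtain ⟨ι, i1, i2, P, loc, h1, h2, h3, h4, h5, h6⟩ := ih (by omega)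
    let E (x : V) : Finset V := if x ∈ side r then nbr (W (r + 1)) x else ∅
    have hE : ∀ x y, y ∈ E x ↔ x ∈ side r ∧ s(x, y) ∈ W (r + 1) := by
      intro x y
      by_cases hx : x ∈ side r <;> simp [E, hx]
    have hEcard : ∀ x ∈ side r, #(E x) = edgeDeg (W (r + 1)) x := by
      intro x hx
      rw [← card_nbr]; simp [E, hx]
    have hH : IsHanging k (side r) (side (r + 1)) (fun i => (P i).toFinset) P loc E := by
      refine ⟨h1, h2, fun _ => rfl, ?_, ?_, ?_, fun x y hy => ((hE x y).1 hy).1, ?_⟩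
      · intro i; rw [← card_pos, h3]; omega
      · intro i; rw [h3]; omega
      · intro x y hy
        exact (hW' _ r).mem_of_mem (hdis' r) ((hE x y).1 hy).2 ((hE x y).1 hy).1
      · intro x hx y hy
        rw [h5 x hx y hy]
        simp only [hE, hx, true_and]
        rw [← sum_range_succ (fun t => if s(x, y) ∈ W t then 1 else 0), ← card_filter, card_le_one]
        intro a ha b hb
        simp only [mem_filter, mem_range] at ha hb
        by_contra hab
        exact disjoint_left.1 (hWd a (by omega) b (by omega) hab) ha.2 hb.2
    obtain ⟨P', loc', g1, g2, g3, g4, g5, g6⟩ := hH.exists_extension (hdis' r)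
      (fun x hx => by rw [h6 x hx, hEcard x hx, hdeg r (by omega) x hx])
      (fun x hx => by rw [hEcard x hx]; exact hlarge r (by omega) x hx)
    rw [hside]
    refine ⟨ι, i1, i2, P', loc', g1, g2, ?_, ?_, ?_, ?_⟩
    · intro i; rw [g3, h4]
    · intro i; rw [g4, h3]
    · intro y hy x hx
      rw [Sym2.eq_swap, g5 x hx y hy, h5 x hx y hy, sum_range_succ (n := r + 1)]
      simp only [hE, hx, true_and]
    · intro y hy
      rw [g6 y hy, ← card_nbr]
      congr 1
      ext x
      rw [mem_filter, mem_nbr, hE, Sym2.eq_swap]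
      constructor
      · exact fun h' => h'.2.2
      · intro h'
        have hx : x ∈ side r := (hW' _ r).symm.mem_of_mem (hdis' r).symm h' hy
        exact ⟨hx, hx, h'⟩

end Tower

/-! ### Splitting Eulerian edge sets -/

section Splitting

/-- Two fixed-point-free involutions of a finite set have a common proper colouring by two colours:
every orbit of the rotation `σ ∘ τ` is monochromatic, and both involutions exchange it with another
orbit. -/
theorem exists_coloring_of_involutions {ε : Type*} [Finite ε] (σ τ : Equiv.Perm ε)
    (hσ : ∀ e, σ (σ e) = e) (hτ : ∀ e, τ (τ e) = e) (hσ' : ∀ e, σ e ≠ e) (hτ' : ∀ e, τ e ≠ e) :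
    ∃ c : ε → Bool, (∀ e, c (σ e) = !c e) ∧ ∀ e, c (τ e) = !c e := by
  classical
  have key : ∀ n : ℕ, ∀ e, ((σ * τ) ^ n) e ≠ σ e := by
    intro n
    induction n using Nat.twoStepInduction with
    | zero => intro e h; exact hσ' e h.symm
    | one =>
      intro e h
      simp only [pow_one, Equiv.Perm.mul_apply] at h
      exact hτ' e (σ.injective h)
    | more n ih _ =>
      intro e h
      apply ih (σ (τ e))
      rw [hσ]
      have h2 : ((σ * τ) ^ (n + 2)) e = (σ * τ) (((σ * τ) ^ n) ((σ * τ) e)) := by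
        rw [← Equiv.Perm.mul_apply, ← Equiv.Perm.mul_apply, ← pow_succ', ← pow_succ]
      rw [h2, Equiv.Perm.mul_apply, Equiv.Perm.mul_apply] at h
      have h3 := σ.injective h
      rw [← hτ (((σ * τ) ^ n) (σ (τ e))), h3]
  have hcyc : ∀ e, ¬ (σ * τ).SameCycle e (σ e) := by
    intro e h
    obtain ⟨n, -, h⟩ := h.exists_pow_eq'
    exact key n e h
  let q (e : ε) : Quotient (Equiv.Perm.SameCycle.setoid (σ * τ)) := Quotient.mk _ e
  let _ := linearOrderOfSTO (WellOrderingRel (α := Quotient (Equiv.Perm.SameCycle.setoid (σ * τ))))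
  have hq : ∀ e, q e ≠ q (σ e) := fun e h => hcyc e (Quotient.exact h)
  have h1 : ∀ e, q (τ e) = q (σ e) := by
    intro e
    refine Quotient.sound ?_
    have : (σ * τ) (τ e) = σ e := by rw [Equiv.Perm.mul_apply, hτ]
    rw [← this]
    exact Equiv.Perm.sameCycle_apply_right.2 (Equiv.Perm.SameCycle.refl _ _)
  have h2 : ∀ e, q (σ (τ e)) = q e := by
    intro e
    refine Quotient.sound ?_
    exact Equiv.Perm.sameCycle_apply_left.2 (Equiv.Perm.SameCycle.refl (σ * τ) e)
  have h3 : ∀ e, decide (q (σ e) < q e) = !decide (q e < q (σ e)) := by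
    intro e
    rcases lt_or_gt_of_ne (hq e) with h | h
    · simp [h, h.le]
    · simp [h, h.le]
  refine ⟨fun e => decide (q e < q (σ e)), fun e => ?_, fun e => ?_⟩
  · simp only [hσ]; exact h3 e
  · simp only [h1, h2]; exact h3 e

/-- A map all of whose fibres have an even number of elements is invariant under some
fixed-point-free involution. -/
theorem exists_involution_of_even_fibers {ε α : Type*} [Fintype ε] [DecidableEq α] (f : ε → α)
    (hf : ∀ a, Even #{e | f e = a}) :
    ∃ σ : Equiv.Perm ε, (∀ e, σ (σ e) = e) ∧ (∀ e, σ e ≠ e) ∧ ∀ e, f (σ e) = f e := by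
  classical
  have hg : ∀ a, ∃ g : {e // f e = a} → {e // f e = a}, (∀ e, g (g e) = e) ∧ ∀ e, g e ≠ e := by
    intro a
    obtain ⟨m, hm⟩ := hf a
    have hc : Fintype.card {e // f e = a} = Fintype.card (Fin m × Bool) := by
      rw [Fintype.card_subtype, hm]; simp; omega
    let φ := Fintype.equivOfCardEq hc
    refine ⟨fun e => φ.symm ((φ e).1, !(φ e).2), fun e => by simp, fun e h => ?_⟩
    have := congrArg (fun e => (φ e).2) h
    simp at this
  choose g hg1 hg2 using hg
  let s (e : ε) : ε := g (f e) ⟨e, rfl⟩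
  have hs : ∀ e, f (s e) = f e := fun e => (g (f e) ⟨e, rfl⟩).2
  have hcast : ∀ e a (h : f e = a), s e = g a ⟨e, h⟩ := by rintro e _ rfl; rfl
  have hss : Function.Involutive s := by
    intro e
    rw [hcast (s e) (f e) (hs e)]
    exact congrArg Subtype.val (hg1 (f e) ⟨e, rfl⟩)
  exact ⟨hss.toPerm, hss, fun e h => hg2 (f e) ⟨e, rfl⟩ (Subtype.ext h), hs⟩

variable {V : Type*} [DecidableEq V]

theorem edgeDeg_union {F F' : Finset (Sym2 V)} (h : Disjoint F F') (v : V) :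
    edgeDeg (F ∪ F') v = edgeDeg F v + edgeDeg F' v := by
  unfold edgeDeg
  rw [filter_union, card_union_of_disjoint (disjoint_filter_filter h)]

/-- An Eulerian edge set of a bipartite graph splits into two sets with the same degrees. -/
theorem exists_split {X Y : Finset V} (hXY : Disjoint X Y) {F : Finset (Sym2 V)}
    (hF : ∀ e ∈ F, ∃ x ∈ X, ∃ y ∈ Y, e = s(x, y)) (heul : IsEulerianEdgeSet F) :
    ∃ F₁ F₂, Disjoint F₁ F₂ ∧ F₁ ∪ F₂ = F ∧ ∀ v, edgeDeg F₁ v = edgeDeg F₂ v := by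
  classical
  have hF' : ∀ e, ∃ a b : V, e ∈ F → a ∈ X ∧ b ∈ Y ∧ e = s(a, b) := by
    intro e
    by_cases he : e ∈ F
    · obtain ⟨x, hx, y, hy, h⟩ := hF e he
      exact ⟨x, y, fun _ => ⟨hx, hy, h⟩⟩
    · induction e with
      | h a b => exact ⟨a, b, fun h => absurd h he⟩
  choose a b hF' using hF'
  have haX := fun e he => (hF' e he).1
  have hbY := fun e he => (hF' e he).2.1
  have hab := fun e he => (hF' e he).2.2
  have ha : ∀ e ∈ F, ∀ v ∈ X, v ∈ e ↔ a e = v := by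
    intro e he v hv
    constructor
    · intro h
      rw [hab e he] at h
      rcases Sym2.mem_iff.1 h with h | h
      · exact h.symm
      · exact absurd hv (h ▸ disjoint_right.1 hXY (hbY e he))
    · rintro rfl
      have := Sym2.mem_mk_left (a e) (b e)
      rwa [← hab e he] at this
  have hb : ∀ e ∈ F, ∀ v ∈ Y, v ∈ e ↔ b e = v := by
    intro e he v hv
    constructor
    · intro h
      rw [hab e he] at h
      rcases Sym2.mem_iff.1 h with h | h
      · exact absurd hv (h ▸ disjoint_left.1 hXY (haX e he))
      · exact h.symm
    · rintro rfl
      have := Sym2.mem_mk_right (a e) (b e)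
      rwa [← hab e he] at this
  have hfib : ∀ (Z : Finset V) (g : Sym2 V → V), (∀ e ∈ F, g e ∈ Z) →
      (∀ e ∈ F, ∀ v ∈ Z, v ∈ e ↔ g e = v) → ∀ v, Even #{e : F | g e = v} := by
    intro Z g hg hg' v
    by_cases hv : v ∈ Z
    · have : #{e : F | g e = v} = edgeDeg F v := by
        refine card_bij (fun e _ => (e : Sym2 V)) ?_ (fun e _ e' _ h => Subtype.ext h) ?_
        · intro e he
          exact mem_filter.2 ⟨e.2, (hg' e e.2 v hv).2 (mem_filter.1 he).2⟩
        · intro e he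
          obtain ⟨he, hve⟩ := mem_filter.1 he
          exact ⟨⟨e, he⟩, by simpa using (hg' e he v hv).1 hve, rfl⟩
      rw [this]; exact heul v
    · have : #{e : F | g e = v} = 0 := by
        rw [card_eq_zero, filter_eq_empty_iff]
        rintro e - rfl
        exact hv (hg e e.2)
      rw [this]; exact Even.zero
  obtain ⟨σ, hσ1, hσ2, hσ3⟩ := exists_involution_of_even_fibers (fun e : F => a e) (hfib X a haX ha)
  obtain ⟨τ, hτ1, hτ2, hτ3⟩ := exists_involution_of_even_fibers (fun e : F => b e) (hfib Y b hbY hb)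
  obtain ⟨c, hc1, hc2⟩ := exists_coloring_of_involutions σ τ hσ1 hτ1 hσ2 hτ2
  let G (t : Bool) : Finset (Sym2 V) := (univ.filter fun e : F => c e = t).map (Function.Embedding.subtype _)
  have hG : ∀ t e, e ∈ G t ↔ ∃ h : e ∈ F, c ⟨e, h⟩ = t := by
    intro t e; simp [G]
  refine ⟨G true, G false, ?_, ?_, ?_⟩
  · rw [disjoint_left]
    intro e h1 h2
    obtain ⟨h, h1⟩ := (hG _ _).1 h1
    obtain ⟨_, h2⟩ := (hG _ _).1 h2
    simp [h1] at h2
  · ext e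
    rw [mem_union, hG, hG]
    constructor
    · rintro (⟨h, -⟩ | ⟨h, -⟩) <;> exact h
    · intro h
      cases hce : c ⟨e, h⟩
      · exact Or.inr ⟨h, hce⟩
      · exact Or.inl ⟨h, hce⟩
  · have key : ∀ (Z : Finset V) (g : Sym2 V → V) (ρ : Equiv.Perm F), (∀ e, ρ (ρ e) = e) →
        (∀ e, g (ρ e) = g e) → (∀ e, c (ρ e) = !c e) →
        (∀ e ∈ F, ∀ v ∈ Z, v ∈ e ↔ g e = v) → ∀ v ∈ Z, ∀ t,
        edgeDeg (G t) v ≤ edgeDeg (G !t) v := by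
      intro Z g ρ hρ hρg hρc hg v hv t
      refine card_le_card_of_injOn (fun e => if h : e ∈ F then (ρ ⟨e, h⟩ : Sym2 V) else e) ?_ ?_
      · intro e he
        obtain ⟨he, hve⟩ := mem_filter.1 he
        obtain ⟨h, hct⟩ := (hG _ _).1 he
        simp only [dif_pos h]
        refine mem_coe.2 (mem_filter.2 ⟨(hG _ _).2 ⟨(ρ ⟨e, h⟩).2, ?_⟩, ?_⟩)
        · rw [← hct]; exact hρc ⟨e, h⟩
        · rw [hg _ (ρ ⟨e, h⟩).2 v hv, hρg]; exact (hg e h v hv).1 hve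
      · intro e he e' he' hee
        obtain ⟨h, -⟩ := (hG _ _).1 (mem_filter.1 he).1
        obtain ⟨h', -⟩ := (hG _ _).1 (mem_filter.1 he').1
        simp only [dif_pos h, dif_pos h'] at hee
        exact congrArg Subtype.val (ρ.injective (Subtype.ext hee))
    intro v
    by_cases hvX : v ∈ X
    · exact le_antisymm (key X a σ hσ1 hσ3 hc1 ha v hvX true)
        (key X a σ hσ1 hσ3 hc1 ha v hvX false)
    by_cases hvY : v ∈ Y
    · exact le_antisymm (key Y b τ hτ1 hτ3 hc2 hb v hvY true)
        (key Y b τ hτ1 hτ3 hc2 hb v hvY false)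
    have h0 : ∀ t, edgeDeg (G t) v = 0 := by
      intro t
      unfold edgeDeg
      rw [card_eq_zero, filter_eq_empty_iff]
      intro e he hve
      obtain ⟨h, -⟩ := (hG _ _).1 he
      rw [hab e h] at hve
      rcases Sym2.mem_iff.1 hve with rfl | rfl
      · exact hvX (haX e h)
      · exact hvY (hbY e h)
    rw [h0, h0]

/-- Eulerian edge sets `f 0, …, f (L - 1)` can be recombined into edge sets `g 0, …, g (L - 1)`
such that `g l` and `g (l + 1)` have equal degrees for even `l`, while common degrees of
the `f l` are preserved: `g 0` and `g 1` both consist of one half of `f 0` and one half of `f 1`,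
and so on. -/
theorem exists_ladder {X Y : Finset V} (hXY : Disjoint X Y) (L : ℕ) (f : ℕ → Finset (Sym2 V))
    (hf : ∀ l < L, ∀ e ∈ f l, ∃ x ∈ X, ∃ y ∈ Y, e = s(x, y))
    (heul : ∀ l < L, IsEulerianEdgeSet (f l))
    (hd : ∀ l < L, ∀ l' < L, l ≠ l' → Disjoint (f l) (f l')) :
    ∃ g : ℕ → Finset (Sym2 V), (∀ l < L, ∀ e ∈ g l, ∃ j < L, e ∈ f j) ∧
      (∀ j < L, ∀ e ∈ f j, ∃ l < L, e ∈ g l) ∧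
      (∀ l < L, ∀ l' < L, l ≠ l' → Disjoint (g l) (g l')) ∧
      (∀ v d, (∀ l < L, edgeDeg (f l) v = d) → ∀ l < L, edgeDeg (g l) v = d) ∧
      (∀ l, l + 1 < L → Even l → ∀ v, edgeDeg (g (l + 1)) v = edgeDeg (g l) v) ∧
      (∀ l, l + 1 = L → Even l → ∀ v, Even (edgeDeg (g l) v)) := by
  induction L using Nat.twoStepInduction generalizing f with
  | zero => exact ⟨f, by simp, by simp, by simp, by simp, by simp, by simp⟩
  | one =>
    refine ⟨f, fun l hl e he => ⟨l, hl, he⟩, fun l hl e he => ⟨l, hl, he⟩, hd, fun v d h => h, ?_, ?_⟩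
    · intro l hl; omega
    · intro l hl _ v; exact heul l (by omega) v
  | more L ih _ =>
    obtain ⟨g, h1, h2, h3, h4, h5, h6⟩ := ih (fun l => f (l + 2)) (fun l hl => hf (l + 2) (by omega))
      (fun l hl => heul (l + 2) (by omega))
      (fun l hl l' hl' h => hd (l + 2) (by omega) (l' + 2) (by omega) (by omega))
    obtain ⟨p, m, hpm, hpmf, hpmd⟩ := exists_split hXY (hf 0 (by omega)) (heul 0 (by omega))
    obtain ⟨p', m', hpm', hpmf', hpmd'⟩ := exists_split hXY (hf 1 (by omega)) (heul 1 (by omega))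
    have h01 := hd 0 (by omega) 1 (by omega) (by omega)
    rw [← hpmf, ← hpmf', disjoint_union_left, disjoint_union_right, disjoint_union_right] at h01
    have hsub : ∀ e, e ∈ p ∪ p' ∨ e ∈ m ∪ m' ↔ e ∈ f 0 ∨ e ∈ f 1 := by
      intro e; rw [← hpmf, ← hpmf']; simp only [mem_union]; tauto
    let g' : ℕ → Finset (Sym2 V)
      | 0 => p ∪ p'
      | 1 => m ∪ m'
      | l + 2 => g l
    have hlow : ∀ l < L, ∀ e ∈ g l, ¬ (e ∈ f 0 ∨ e ∈ f 1) := by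
      intro l hl e he h
      obtain ⟨j, hj, hej⟩ := h1 l hl e he
      rcases h with h | h
      · exact disjoint_left.1 (hd 0 (by omega) (j + 2) (by omega) (by omega)) h hej
      · exact disjoint_left.1 (hd 1 (by omega) (j + 2) (by omega) (by omega)) h hej
    have hpp : Disjoint (p ∪ p') (m ∪ m') := by
      rw [disjoint_union_left, disjoint_union_right, disjoint_union_right]
      exact ⟨⟨hpm, h01.1.2⟩, h01.2.1.symm, hpm'⟩
    have hdeg0 : ∀ v, edgeDeg (p ∪ p') v = edgeDeg p v + edgeDeg p' v := edgeDeg_union h01.1.1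
    have hdeg1 : ∀ v, edgeDeg (m ∪ m') v = edgeDeg m v + edgeDeg m' v := edgeDeg_union h01.2.2
    refine ⟨g', ?_, ?_, ?_, ?_, ?_, ?_⟩
    · intro l hl e he
      have key : (e ∈ f 0 ∨ e ∈ f 1) → ∃ j < L + 2, e ∈ f j := by
        rintro (h | h)
        · exact ⟨0, by omega, h⟩
        · exact ⟨1, by omega, h⟩
      match l, hl, he with
      | 0, _, he => exact key ((hsub e).1 (Or.inl he))
      | 1, _, he => exact key ((hsub e).1 (Or.inr he))
      | l + 2, hl, he =>
        obtain ⟨j, hj, hej⟩ := h1 l (by omega) e he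
        exact ⟨j + 2, by omega, hej⟩
    · intro j hj e he
      have key : (e ∈ p ∪ p' ∨ e ∈ m ∪ m') → ∃ l < L + 2, e ∈ g' l := by
        rintro (h | h)
        · exact ⟨0, by omega, h⟩
        · exact ⟨1, by omega, h⟩
      match j, hj, he with
      | 0, _, he => exact key ((hsub e).2 (Or.inl he))
      | 1, _, he => exact key ((hsub e).2 (Or.inr he))
      | j + 2, hj, he =>
        obtain ⟨l, hl, hel⟩ := h2 j (by omega) e he
        exact ⟨l + 2, by omega, hel⟩
    · have hlow0 : ∀ l < L, Disjoint (p ∪ p') (g l) := fun l hl => disjoint_left.2 fun e he he' =>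
        hlow l hl e he' ((hsub e).1 (Or.inl he))
      have hlow1 : ∀ l < L, Disjoint (m ∪ m') (g l) := fun l hl => disjoint_left.2 fun e he he' =>
        hlow l hl e he' ((hsub e).1 (Or.inr he))
      intro l hl l' hl' hne
      match l, l', hl, hl', hne with
      | 0, 0, _, _, h => exact absurd rfl h
      | 0, 1, _, _, _ => exact hpp
      | 0, l + 2, _, hl, _ => exact hlow0 l (by omega)
      | 1, 0, _, _, _ => exact hpp.symm
      | 1, 1, _, _, h => exact absurd rfl h
      | 1, l + 2, _, hl, _ => exact hlow1 l (by omega)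
      | l + 2, 0, hl, _, _ => exact (hlow0 l (by omega)).symm
      | l + 2, 1, hl, _, _ => exact (hlow1 l (by omega)).symm
      | l + 2, l' + 2, hl, hl', h => exact h3 l (by omega) l' (by omega) (by omega)
    · intro v d h l hl
      have e0 := h 0 (by omega)
      have e1 := h 1 (by omega)
      rw [← hpmf, edgeDeg_union hpm, hpmd] at e0
      rw [← hpmf', edgeDeg_union hpm', hpmd'] at e1
      match l, hl with
      | 0, _ =>
        change edgeDeg (p ∪ p') v = d
        rw [hdeg0, hpmd, hpmd']; omega
      | 1, _ =>
        change edgeDeg (m ∪ m') v = d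
        rw [hdeg1]; omega
      | l + 2, hl => exact h4 v d (fun l hl => h (l + 2) (by omega)) l (by omega)
    · intro l hl hev v
      match l, hl, hev with
      | 0, _, _ =>
        change edgeDeg (m ∪ m') v = edgeDeg (p ∪ p') v
        rw [hdeg0, hdeg1, hpmd, hpmd']
      | 1, _, h => exact absurd h (by decide)
      | l + 2, hl, h => exact h5 l (by omega) (by simpa [Nat.even_add] using h) v
    · intro l hl hev v
      match l, hl, hev with
      | 0, hl, _ => omega
      | 1, _, h => exact absurd h (by decide)
      | l + 2, hl, h => exact h6 l (by omega) (by simpa [Nat.even_add] using h) v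

end Splitting

/-! ### The levels of the path system -/

section Half

universe u

variable {V : Type u} [Fintype V] [DecidableEq V]

theorem IsBetween.union {X Y : Finset V} {W W' : Finset (Sym2 V)} (h : IsBetween X Y W)
    (h' : IsBetween X Y W') : IsBetween X Y (W ∪ W') := by
  intro e he
  rcases mem_union.1 he with he | he
  exacts [h e he, h' e he]

/-- The levels `a t ∪ b t`, for `t ≤ k`, of the path system that ends in `B`: level `0` consists of
the outermost edges and level `k` of the edges at the centres. On each level the degrees at the side
nearer to the centre agree with the degrees of the next level. -/
theorem exists_levels {k : ℕ} {A B : Finset V} (hk : 0 < k) (hAB : Disjoint A B)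
    {M N : Finset (Sym2 V)} {f₁ f₂ : ℕ → Finset (Sym2 V)} {m : V → ℕ}
    (hM : IsBetween A B M) (hN : IsBetween A B N)
    (hf₁ : ∀ j < k, IsBetween A B (f₁ j)) (hf₂ : ∀ j < k + 1, IsBetween A B (f₂ j))
    (he₁ : ∀ j < k, IsEulerianEdgeSet (f₁ j)) (he₂ : ∀ j < k + 1, IsEulerianEdgeSet (f₂ j))
    (hMN : Disjoint M N) (hd₁ : ∀ i < k, ∀ j < k, i ≠ j → Disjoint (f₁ i) (f₁ j))
    (hd₂ : ∀ i < k + 1, ∀ j < k + 1, i ≠ j → Disjoint (f₂ i) (f₂ j))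
    (hd₁₂ : ∀ i < k, ∀ j < k + 1, Disjoint (f₁ i) (f₂ j))
    (hdM₁ : ∀ j < k, Disjoint (M ∪ N) (f₁ j)) (hdM₂ : ∀ j < k + 1, Disjoint (M ∪ N) (f₂ j))
    (hmM : ∀ v ∈ A, edgeDeg M v = m v) (hmN : ∀ v ∈ A, edgeDeg N v = m v)
    (hm₁ : ∀ v ∈ A, ∀ j < k, edgeDeg (f₁ j) v = 2 * m v)
    (hm₂ : ∀ v ∈ B, ∀ j < k + 1, edgeDeg (f₂ j) v = 2 * m v) :
    ∃ U : ℕ → Finset (Sym2 V), (∀ t, IsBetween A B (U t)) ∧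
      (∀ t ≤ k, ∀ t' ≤ k, t ≠ t' → Disjoint (U t) (U t')) ∧
      (∀ e, (∃ t ≤ k, e ∈ U t) ↔ e ∈ M ∪ N ∨ (∃ j < k, e ∈ f₁ j) ∨ ∃ j < k + 1, e ∈ f₂ j) ∧
      (∀ t < k, ∀ v ∈ (if Even t then A else B), edgeDeg (U (t + 1)) v = edgeDeg (U t) v) ∧
      (∀ t < k, ∀ v ∈ (if Even t then A else B), 2 * m v ≤ edgeDeg (U t) v) ∧
      (∀ v ∈ (if Even k then A else B), Even (edgeDeg (U k) v)) ∧
      ∀ v ∈ B, edgeDeg (U 0) v = edgeDeg M v + edgeDeg N v + 2 * m v := by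
  obtain ⟨g, g1, g2, g3, g4, g5, g6⟩ := exists_ladder hAB k f₁ hf₁ he₁ hd₁
  obtain ⟨b, b1, b2, b3, b4, b5, b6⟩ := exists_ladder hAB (k + 1) f₂ hf₂ he₂ hd₂
  let a : ℕ → Finset (Sym2 V)
    | 0 => M ∪ N
    | t + 1 => g t
  have ha : ∀ t ≤ k, ∀ e ∈ a t, e ∈ M ∪ N ∨ ∃ j < k, e ∈ f₁ j := by
    intro t ht e he
    cases t with
    | zero => exact Or.inl he
    | succ t => exact Or.inr (g1 t (by omega) e he)
  have haB : ∀ t ≤ k, IsBetween A B (a t) := by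
    intro t ht e he
    rcases ha t ht e he with h | ⟨j, hj, h⟩
    · exact hM.union hN e h
    · exact hf₁ j hj e h
  have hbB : ∀ t ≤ k, IsBetween A B (b t) := by
    intro t ht e he
    obtain ⟨j, hj, h⟩ := b1 t (by omega) e he
    exact hf₂ j hj e h
  have hab : ∀ t ≤ k, ∀ t' ≤ k, Disjoint (a t) (b t') := by
    intro t ht t' ht'
    rw [disjoint_left]
    intro e he he'
    obtain ⟨j', hj', h'⟩ := b1 t' (by omega) e he'
    rcases ha t ht e he with h | ⟨j, hj, h⟩
    · exact disjoint_left.1 (hdM₂ j' hj') h h'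
    · exact disjoint_left.1 (hd₁₂ j hj j' hj') h h'
  have h0g : ∀ t < k, Disjoint (M ∪ N) (g t) := by
    intro t ht
    rw [disjoint_left]
    intro e he he'
    obtain ⟨j, hj, h⟩ := g1 t ht e he'
    exact disjoint_left.1 (hdM₁ j hj) he h
  have haa : ∀ t ≤ k, ∀ t' ≤ k, t ≠ t' → Disjoint (a t) (a t') := by
    intro t ht t' ht' hne
    match t, t', ht, ht', hne with
    | 0, 0, _, _, h => exact absurd rfl h
    | 0, t + 1, _, ht, _ => exact h0g t (by omega)
    | t + 1, 0, ht, _, _ => exact (h0g t (by omega)).symm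
    | t + 1, t' + 1, ht, ht', h => exact g3 t (by omega) t' (by omega) (by omega)
  have haA : ∀ t ≤ k, ∀ v ∈ A, edgeDeg (a t) v = 2 * m v := by
    intro t ht v hv
    cases t with
    | zero =>
      change edgeDeg (M ∪ N) v = _
      rw [edgeDeg_union hMN, hmM v hv, hmN v hv]; ring
    | succ t => exact g4 v _ (hm₁ v hv) t (by omega)
  have hbB' : ∀ t ≤ k, ∀ v ∈ B, edgeDeg (b t) v = 2 * m v := fun t ht v hv =>
    b4 v _ (hm₂ v hv) t (by omega)
  have hU : ∀ t ≤ k, ∀ v, edgeDeg (a t ∪ b t) v = edgeDeg (a t) v + edgeDeg (b t) v :=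
    fun t ht v => edgeDeg_union (hab t ht t ht) v
  refine ⟨fun t => if t ≤ k then a t ∪ b t else ∅, ?_, ?_, ?_, ?_, ?_, ?_, ?_⟩
  · intro t
    by_cases ht : t ≤ k
    · simp only [if_pos ht]; exact (haB t ht).union (hbB t ht)
    · simp only [if_neg ht]; intro e he; simp at he
  · intro t ht t' ht' hne
    simp only [if_pos ht, if_pos ht']
    rw [disjoint_union_left, disjoint_union_right, disjoint_union_right]
    exact ⟨⟨haa t ht t' ht' hne, hab t ht t' ht'⟩, (hab t' ht' t ht).symm,
      b3 t (by omega) t' (by omega) hne⟩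
  · intro e
    constructor
    · rintro ⟨t, ht, he⟩
      simp only [if_pos ht, mem_union] at he
      rcases he with he | he
      · rcases ha t ht e he with h | h
        · exact Or.inl h
        · exact Or.inr (Or.inl h)
      · exact Or.inr (Or.inr (b1 t (by omega) e he))
    · have key : ∀ t ≤ k, (e ∈ a t ∨ e ∈ b t) →
          ∃ t ≤ k, e ∈ (if t ≤ k then a t ∪ b t else ∅) := fun t ht h =>
        ⟨t, ht, by rw [if_pos ht]; exact mem_union.2 h⟩
      rintro (h | ⟨j, hj, h⟩ | ⟨j, hj, h⟩)
      · exact key 0 (by omega) (Or.inl h)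
      · obtain ⟨t, ht, h⟩ := g2 j hj e h
        exact key (t + 1) (by omega) (Or.inl h)
      · obtain ⟨t, ht, h⟩ := b2 j hj e h
        exact key t (by omega) (Or.inr h)
  · intro t ht v hv
    simp only [if_pos (show t ≤ k by omega), if_pos (show t + 1 ≤ k by omega)]
    rw [hU t (by omega), hU (t + 1) (by omega)]
    by_cases hev : Even t
    · rw [if_pos hev] at hv
      rw [haA t (by omega) v hv, haA (t + 1) (by omega) v hv, b5 t (by omega) hev]
    · rw [if_neg hev] at hv
      rw [hbB' t (by omega) v hv, hbB' (t + 1) (by omega) v hv]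
      cases t with
      | zero => exact absurd Even.zero hev
      | succ t =>
        change edgeDeg (g (t + 1)) v + _ = edgeDeg (g t) v + _
        rw [g5 t (by omega) (by rwa [Nat.even_add_one, not_not] at hev)]
  · intro t ht v hv
    simp only [if_pos (show t ≤ k by omega)]
    rw [hU t (by omega)]
    by_cases hev : Even t
    · rw [if_pos hev] at hv
      rw [haA t (by omega) v hv]; omega
    · rw [if_neg hev] at hv
      rw [hbB' t (by omega) v hv]; omega
  · intro v hv
    simp only [le_refl, if_true]
    rw [hU k le_rfl]
    by_cases hev : Even k
    · rw [if_pos hev] at hv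
      rw [haA k le_rfl v hv]
      exact (even_two_mul _).add (b6 k rfl hev v)
    · rw [if_neg hev] at hv
      rw [hbB' k le_rfl v hv]
      obtain ⟨l, rfl⟩ := Nat.exists_eq_succ_of_ne_zero hk.ne'
      exact (g6 l rfl (by rwa [Nat.succ_eq_add_one, Nat.even_add_one, not_not] at hev) v).add
        (even_two_mul _)
  · intro v hv
    simp only [Nat.zero_le, if_true]
    rw [hU 0 (by omega), hbB' 0 (by omega) v hv]
    change edgeDeg (M ∪ N) v + _ = _
    rw [edgeDeg_union hMN]

/-- One half of the decomposition: the paths with both ends in `B`. -/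
theorem exists_half {k : ℕ} {A B : Finset V} (hAB : Disjoint A B)
    {m : V → ℕ} {U : ℕ → Finset (Sym2 V)} (hlarge : ∀ v, v ∈ A ∪ B → k + 2 ≤ m v)
    (h1 : ∀ t, IsBetween A B (U t))
    (h2 : ∀ t ≤ k, ∀ t' ≤ k, t ≠ t' → Disjoint (U t) (U t'))
    (h3 : ∀ t < k, ∀ v ∈ (if Even t then A else B), edgeDeg (U (t + 1)) v = edgeDeg (U t) v)
    (h4 : ∀ t < k, ∀ v ∈ (if Even t then A else B), 2 * m v ≤ edgeDeg (U t) v)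
    (h5 : ∀ v ∈ (if Even k then A else B), Even (edgeDeg (U k) v)) :
    ∃ (ι : Type u) (_ : Fintype ι) (_ : DecidableEq ι) (P : ι → List V) (loc : ι × Bool → V),
      (∀ i, IsAltPathOf B A loc i (P i)) ∧ (∀ α, loc α ∈ B) ∧ (∀ i, (P i).length = 2 * k + 3) ∧
      (∀ x ∈ B, ∀ y ∈ A, edgeCount P s(x, y) = if ∃ t ≤ k, s(x, y) ∈ U t then 1 else 0) ∧
      ∀ x ∈ B, #(endsAt loc x) = edgeDeg (U 0) x := by
  classical
  let side (r : ℕ) : Finset V := if Even (k + r) then B else A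
  have hside : ∀ r, side (r + 1) = if Even (k + r) then A else B := by
    intro r
    simp only [side, ← add_assoc, Nat.even_add_one]
    by_cases h : Even (k + r) <;> simp [h]
  have hs0 : side 0 = if Even k then B else A := rfl
  have hs1 : side 1 = if Even k then A else B := hside 0
  have hsk : side k = B := if_pos ⟨k, rfl⟩
  have hsk1 : side (k + 1) = A := by rw [hside, if_pos ⟨k, rfl⟩]
  have htail : ∀ r < k, side r = if Even (k - (r + 1)) then A else B := by
    intro r hr
    have h : Even (k + r) ↔ ¬ Even (k - (r + 1)) := by
      have e : k + r = (k - (r + 1)) + 1 + (r + r) := by omega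
      rw [e, Nat.even_add, Nat.even_add_one]
      simp
    simp only [side]
    by_cases h' : Even (k - (r + 1)) <;> simp [h, h']
  have hsub : ∀ r, side r ⊆ A ∪ B := by
    intro r
    simp only [side]
    split_ifs
    exacts [subset_union_right, subset_union_left]
  obtain ⟨ι, i1, i2, P, loc, p1, p2, p3, p4, p5, p6⟩ :=
    exists_path_system (k := k) (side := side) (W := fun r => U (k - r)) (r := k)
    (fun r => by simp only [side, ← add_assoc, Nat.even_add_one, not_not])
    (by rw [hs0, hs1]; split_ifs; exacts [hAB.symm, hAB])
    (fun r => by rw [hs0, hs1]; split_ifs; exacts [(h1 _).symm, h1 _])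
    (fun r hr r' hr' hne => h2 _ (by omega) _ (by omega) (by omega))
    (by rw [hs1]; simpa using h5)
    (fun r hr x hx => by
      rw [htail r hr] at hx
      have := h3 (k - (r + 1)) (by omega) x hx
      rw [show k - (r + 1) + 1 = k - r by omega] at this
      exact this.symm)
    (fun r hr x hx => by
      have h7 := hlarge x (hsub r hx)
      rw [htail r hr] at hx
      have := h4 (k - (r + 1)) (by omega) x hx
      omega) le_rfl
  rw [hsk, hsk1] at p1 p5
  rw [hsk] at p2 p4 p6
  rw [hsk1] at p3
  refine ⟨ι, i1, i2, P, loc, p1, p2, ?_, ?_, ?_⟩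
  · intro i
    have hmem : ∀ v ∈ P i, v ∈ B ∨ v ∈ A := by
      intro v hv
      have hlen : 2 ≤ (P i).length := by
        have h6 : #((P i).toFinset ∩ B) ≤ (P i).length :=
          (card_le_card inter_subset_left).trans (List.toFinset_card_le _)
        rw [p4] at h6
        omega
      obtain ⟨j, hj, rfl⟩ := List.mem_iff_getElem.1 hv
      have hch := List.isChain_iff_getElem.1 (p1 i).chain
      by_cases hj' : j + 1 < (P i).length
      · rcases hch j hj' with h | h
        · exact Or.inl h.1
        · exact Or.inr h.1
      · obtain ⟨j, rfl⟩ := Nat.exists_eq_succ_of_ne_zero (show j ≠ 0 by omega)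
        rcases hch j hj with h | h
        · exact Or.inr h.2
        · exact Or.inl h.2
    have hun : (P i).toFinset = ((P i).toFinset ∩ B) ∪ ((P i).toFinset ∩ A) := by
      rw [← inter_union_distrib_left, eq_comm, inter_eq_left]
      intro v hv
      rw [mem_union]
      exact hmem v (List.mem_toFinset.1 hv)
    rw [← List.toFinset_card_of_nodup (p1 i).nodup, hun, card_union_of_disjoint, p3, p4]
    · ring
    · exact hAB.symm.mono inter_subset_right inter_subset_right
  · intro x hx y hy
    rw [p5 x hx y hy, ← card_filter]
    split_ifs with h
    · obtain ⟨t, ht, h⟩ := h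
      rw [card_eq_one]
      refine ⟨k - t, ?_⟩
      ext r
      simp only [mem_filter, mem_range, mem_singleton]
      constructor
      · rintro ⟨hr, h'⟩
        by_contra hne
        exact disjoint_left.1 (h2 t ht (k - r) (by omega) (by omega)) h h'
      · rintro rfl
        exact ⟨by omega, by rwa [show k - (k - t) = t by omega]⟩
    · rw [card_eq_zero, filter_eq_empty_iff]
      intro r hr h'
      exact h ⟨k - r, by omega, h'⟩
  · intro x hx
    rw [p6 x hx, Nat.sub_self]

end Half

/-! ### From path systems to path tracking decompositions -/

section Trackings

variable {V ι : Type*} [DecidableEq V] [Fintype ι] [DecidableEq ι] {G : SimpleGraph V}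

theorem isChain_mem_pathEdges (l : List V) : l.IsChain fun u v => s(u, v) ∈ pathEdges l := by
  induction l with
  | nil => exact List.IsChain.nil
  | cons a l ih =>
    cases l with
    | nil => exact List.IsChain.singleton a
    | cons b l =>
      rw [List.isChain_cons_cons]
      exact ⟨by simp, ih.imp fun u v h => by simp [h]⟩

theorem edges_eq_pathEdges {u v : V} (w : G.Walk u v) : w.edges = pathEdges w.support := by
  induction w with
  | nil => rfl
  | cons h w ih =>
    rw [SimpleGraph.Walk.edges_cons, SimpleGraph.Walk.support_cons, ih]
    cases w <;> simp

/-- Paths of positive length that use every edge of `G` exactly once form a path tracking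
decomposition, and the number of its ends at `v` is the number of path ends located at `v`. -/
theorem exists_decomposition {l : ℕ} (hl : 0 < l) {P : ι → List V} {loc : ι × Bool → V}
    (hhead : ∀ i, (P i).head? = some (loc (i, false)))
    (hlast : ∀ i, (P i).getLast? = some (loc (i, true)))
    (hnd : ∀ i, (P i).Nodup) (hlen : ∀ i, (P i).length = l + 1)
    (hmem : ∀ i, ∀ e ∈ pathEdges (P i), e ∈ G.edgeSet)
    (hcount : ∀ e ∈ G.edgeSet, edgeCount P e = 1) :
    ∃ 𝓑 : Finset (Tracking G), IsPathTrackingDecomposition l 𝓑 ∧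
      ∀ v, endCount 𝓑 v = #(endsAt loc v) := by
  classical
  have hw : ∀ i, ∃ w : G.Walk (loc (i, false)) (loc (i, true)), w.support = P i := by
    intro i
    have hne : P i ≠ [] := by rintro h; have := hlen i; simp [h] at this
    have hch : (P i).IsChain G.Adj :=
      (isChain_mem_pathEdges (P i)).imp fun u v h => (SimpleGraph.mem_edgeSet G).1 (hmem i _ h)
    have h1 : (P i).head hne = loc (i, false) := by
      have := hhead i
      rw [List.head?_eq_some_head hne] at this
      exact Option.some_injective _ this
    have h2 : (P i).getLast hne = loc (i, true) := by
      have := hlast i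
      rw [List.getLast?_eq_some_getLast hne] at this
      exact Option.some_injective _ this
    exact ⟨(SimpleGraph.Walk.ofSupport (P i) hne hch).copy h1 h2, by
      rw [SimpleGraph.Walk.support_copy, SimpleGraph.Walk.support_ofSupport]⟩
  choose w hw using hw
  have hpath : ∀ i, (w i).IsPath := fun i => by
    rw [SimpleGraph.Walk.isPath_def, hw]; exact hnd i
  have hlength : ∀ i, (w i).length = l := fun i => by
    have := (w i).length_support
    rw [hw, hlen] at this
    omega
  have hedges : ∀ i, (w i).edges = pathEdges (P i) := fun i => by rw [edges_eq_pathEdges, hw]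
  let T (i : ι) : Tracking G := ⟨loc (i, false), loc (i, true), w i, (hpath i).isTrail⟩
  have hT : ∀ i e, e ∈ (T i).edgeFinset ↔ e ∈ pathEdges (P i) := by
    intro i e
    rw [← hedges]
    simp [T, Tracking.edgeFinset]
  have hdisj : ∀ i j, i ≠ j → Disjoint (T i).edgeFinset (T j).edgeFinset := by
    intro i j hij
    rw [disjoint_left]
    intro e hi hj
    rw [hT] at hi hj
    have h1 := two_le_edgeCount hij hi hj
    rw [hcount e (hmem i e hi)] at h1
    omega
  have hne : ∀ i, loc (i, false) ≠ loc (i, true) := by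
    intro i h
    have := hlength i
    have h2 : ∀ {u v : V} (p : G.Walk u v), p.IsPath → u = v → p.length = 0 := by
      rintro u _ p hp rfl
      exact SimpleGraph.Walk.length_eq_zero_iff.2 (SimpleGraph.Walk.isPath_iff_nil.1 hp)
    rw [h2 (w i) (hpath i) h] at this
    omega
  have hTinj : Function.Injective T := by
    intro i j hij
    by_contra h
    have h1 := hdisj i j h
    rw [hij, disjoint_self] at h1
    have h2 : (w j).edges = [] := List.toFinset_eq_empty_iff _ |>.1 h1
    have h3 := (w j).length_edges
    rw [h2, hlength] at h3
    simp at h3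
    omega
  refine ⟨univ.image T, ⟨?_, ?_, ?_, ?_⟩, ?_⟩
  · simp only [mem_image, mem_univ, true_and, forall_exists_index, forall_apply_eq_imp_iff]
    exact hpath
  · simp only [mem_image, mem_univ, true_and, forall_exists_index, forall_apply_eq_imp_iff]
    exact hlength
  · simp only [mem_image, mem_univ, true_and, forall_exists_index, forall_apply_eq_imp_iff]
    exact fun i j h => hdisj i j fun e => h (by rw [e])
  · intro e
    simp only [mem_image, mem_univ, true_and, exists_exists_eq_and, hT]
    constructor
    · intro he
      by_contra! h
      have h1 := hcount e he
      rw [edgeCount, sum_eq_zero fun i _ => List.count_eq_zero.2 (h i)] at h1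
      omega
    · rintro ⟨i, hi⟩; exact hmem i e hi
  · intro v
    have hodd : ∀ i, Odd (edgeDeg (T i).edgeFinset v) ↔ loc (i, false) = v ∨ loc (i, true) = v := by
      intro i
      have h1 := (hpath i).isTrail.even_countP_edges_iff v
      have h2 : edgeDeg (T i).edgeFinset v = (w i).edges.countP fun e => v ∈ e := by
        rw [List.countP_eq_length_filter,
          ← List.toFinset_card_of_nodup ((hpath i).isTrail.edges_nodup.filter _)]
        unfold edgeDeg
        congr 1
        ext e
        simp [T, Tracking.edgeFinset]
      rw [h2, ← Nat.not_even_iff_odd, h1]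
      have := hne i
      simp only [ne_eq, this, not_false_iff, true_imp_iff, eq_comm (a := v)]
      tauto
    have e1 : #{B ∈ univ.image T | B.start = v ∧ B.finish = v} = 0 := by
      rw [card_eq_zero, filter_eq_empty_iff]
      simp only [mem_image, mem_univ, true_and, forall_exists_index, forall_apply_eq_imp_iff]
      intro i h
      exact hne i (h.1.trans h.2.symm)
    have e2 : #{B ∈ univ.image T | Odd (edgeDeg B.edgeFinset v)} =
        #{i | loc (i, false) = v ∨ loc (i, true) = v} := by
      rw [filter_image, card_image_of_injective _ hTinj]
      simp only [hodd]
    unfold endCount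
    rw [e1, e2, mul_zero, add_zero]
    unfold endsAt
    simp only [card_filter, Fintype.sum_prod_type, Fintype.sum_bool]
    refine sum_congr rfl fun i _ => ?_
    have := hne i
    by_cases h1 : loc (i, false) = v <;> by_cases h2 : loc (i, true) = v
    · exact absurd (h1.trans h2.symm) this
    all_goals simp [h1, h2]

end Trackings

/-! ### Paths from a bifactorization -/

section Bifactorization

universe u

variable {V : Type u} [Fintype V] [DecidableEq V] {k : ℕ} {𝓕₁ 𝓕₂ 𝓕 : FactorFamily V 2 (2 * (2 * k + 2))}

/-- The edges in the two members `M 0` and `M 1` and in the Eulerian members of index less than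
`k`. They are used by the paths with both ends on the other side. -/
def FactorFamily.lower (𝓕 : FactorFamily V 2 (2 * (2 * k + 2))) (e : Sym2 V) : Prop :=
  e ∈ 𝓕.M 0 ∪ 𝓕.M 1 ∨ ∃ j, j.1 < k ∧ e ∈ 𝓕.F j

/-- The edges in the Eulerian members of index at least `k`. They are used by the paths with both
ends on the same side. -/
def FactorFamily.upper (𝓕 : FactorFamily V 2 (2 * (2 * k + 2))) (e : Sym2 V) : Prop :=
  ∃ j, k ≤ j.1 ∧ e ∈ 𝓕.F j

theorem mem_edges_iff {e : Sym2 V} : e ∈ 𝓕.edges ↔ 𝓕.lower e ∨ 𝓕.upper e := by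
  unfold FactorFamily.edges FactorFamily.part FactorFamily.lower FactorFamily.upper
  simp only [mem_biUnion, mem_univ, true_and, Sum.exists, Sum.elim_inl, Sum.elim_inr,
    Fin.exists_fin_two, mem_union]
  constructor
  · rintro (h | ⟨j, hj⟩)
    · exact Or.inl (Or.inl h)
    · rcases lt_or_ge j.1 k with h | h
      · exact Or.inl (Or.inr ⟨j, h, hj⟩)
      · exact Or.inr ⟨j, h, hj⟩
  · rintro ((h | ⟨j, -, hj⟩) | ⟨j, -, hj⟩)
    · exact Or.inl h
    · exact Or.inr ⟨j, hj⟩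
    · exact Or.inr ⟨j, hj⟩

variable {X : Set V} {E : Finset (Sym2 V)}

theorem IsFractionalFactorization.not_lower_and_upper (h : IsFractionalFactorization X E 𝓕)
    {e : Sym2 V} (h1 : 𝓕.lower e) (h2 : 𝓕.upper e) : False := by
  obtain ⟨j, hj, he⟩ := h2
  rcases h1 with h1 | ⟨i, hi, h1⟩
  · rcases mem_union.1 h1 with h1 | h1
    · exact disjoint_left.1 (h.disjoint (Sum.inl 0) (Sum.inr j) (by simp)) h1 he
    · exact disjoint_left.1 (h.disjoint (Sum.inl 1) (Sum.inr j) (by simp)) h1 he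
  · refine disjoint_left.1 (h.disjoint (Sum.inr i) (Sum.inr j) ?_) h1 he
    intro e
    rw [Sum.inr.injEq] at e
    subst e
    omega

theorem IsFractionalFactorization.edgeDeg_M (h : IsFractionalFactorization X E 𝓕) {v : V}
    (hv : v ∈ X) (i : Fin 2) : 2 * (2 * k + 2) * edgeDeg (𝓕.M i) v = edgeDeg E v := by
  have h1 := (h.factor_M i).2 v hv
  have : (2 * (2 * (k : ℚ) + 2)) ≠ 0 := by positivity
  push_cast at h1
  field_simp at h1
  have h2 : ((2 * (2 * k + 2) * edgeDeg (𝓕.M i) v : ℕ) : ℚ) = (edgeDeg E v : ℚ) := by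
    push_cast; linarith
  exact_mod_cast h2

theorem IsFractionalFactorization.edgeDeg_F (h : IsFractionalFactorization X E 𝓕) {v : V}
    (hv : v ∈ X) (j) : (2 * k + 2) * edgeDeg (𝓕.F j) v = edgeDeg E v := by
  have h1 := (h.factor_F j).2 v hv
  have : (2 * (2 * (k : ℚ) + 2)) ≠ 0 := by positivity
  push_cast at h1
  field_simp at h1
  have h2 : (((2 * k + 2) * edgeDeg (𝓕.F j) v : ℕ) : ℚ) = (edgeDeg E v : ℚ) := by
    push_cast; linarith
  exact_mod_cast h2

/-- The paths with both ends in `B` for bifactorizations with sides `A` and `B`. -/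
theorem exists_paths_of_factorizations (hk : 0 < k) {A B : Finset V} (hAB : Disjoint A B)
    {E₁ E₂ : Finset (Sym2 V)} (h₁ : IsFractionalFactorization (A : Set V) E₁ 𝓕₁)
    (h₂ : IsFractionalFactorization (B : Set V) E₂ 𝓕₂) (hd : Disjoint E₁ E₂)
    (hb₁ : IsBetween A B E₁) (hb₂ : IsBetween A B E₂)
    (hs₁ : ∀ v ∈ A, 2 * (2 * k + 2) * (k + 2) ≤ edgeDeg E₁ v)
    (hs₂ : ∀ v ∈ B, 2 * (2 * k + 2) * (k + 2) ≤ edgeDeg E₂ v) :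
    ∃ (ι : Type u) (_ : Fintype ι) (_ : DecidableEq ι) (P : ι → List V) (loc : ι × Bool → V),
      (∀ i, IsAltPathOf B A loc i (P i)) ∧ (∀ α, loc α ∈ B) ∧ (∀ i, (P i).length = 2 * k + 3) ∧
      (∀ x ∈ B, ∀ y ∈ A, (𝓕₁.lower s(x, y) ∨ 𝓕₂.upper s(x, y) → edgeCount P s(x, y) = 1) ∧
        (¬ (𝓕₁.lower s(x, y) ∨ 𝓕₂.upper s(x, y)) → edgeCount P s(x, y) = 0)) ∧
      ∀ x ∈ B, (2 * k + 2) * #(endsAt loc x) =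
        edgeDeg E₂ x + (2 * k + 2) * (edgeDeg (𝓕₁.M 0) x + edgeDeg (𝓕₁.M 1) x) := by
  classical
  let g (𝓕 : FactorFamily V 2 (2 * (2 * k + 2))) (j : ℕ) : Finset (Sym2 V) :=
    if h : j < (2 * (2 * k + 2) - 2) / 2 then 𝓕.F ⟨j, h⟩ else ∅
  have hg : ∀ 𝓕 j, j < 2 * k + 1 → ∃ i : Fin ((2 * (2 * k + 2) - 2) / 2), i.1 = j ∧ g 𝓕 j = 𝓕.F i := by
    intro 𝓕 j hj
    have : j < (2 * (2 * k + 2) - 2) / 2 := by omega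
    exact ⟨⟨j, this⟩, rfl, dif_pos this⟩
  have hgF : ∀ 𝓕 (i : Fin ((2 * (2 * k + 2) - 2) / 2)), 𝓕.F i = g 𝓕 i.1 := fun 𝓕 i => by
    simp only [g, dif_pos i.2]
  have hsub : ∀ {𝓕 : FactorFamily V 2 (2 * (2 * k + 2))} {Z : Set V} {E},
      IsFractionalFactorization Z E 𝓕 → ∀ a, 𝓕.part a ⊆ E := by
    intro 𝓕 Z E h a e he
    rw [← h.union]
    exact mem_biUnion.2 ⟨a, mem_univ a, he⟩
  have hgd : ∀ {𝓕 : FactorFamily V 2 (2 * (2 * k + 2))} {Z : Set V} {E},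
      IsFractionalFactorization Z E 𝓕 → ∀ i < 2 * k + 1, ∀ j < 2 * k + 1, i ≠ j →
        Disjoint (g 𝓕 i) (g 𝓕 j) := by
    intro 𝓕 Z E h i hi j hj hij
    obtain ⟨i', rfl, e⟩ := hg 𝓕 i hi
    obtain ⟨j', rfl, e'⟩ := hg 𝓕 j hj
    rw [e, e']
    exact h.disjoint (Sum.inr i') (Sum.inr j') fun h' => hij (by rw [Sum.inr.inj h'])
  have hgs : ∀ {𝓕 : FactorFamily V 2 (2 * (2 * k + 2))} {Z : Set V} {E},
      IsFractionalFactorization Z E 𝓕 → ∀ j < 2 * k + 1, g 𝓕 j ⊆ E := by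
    intro 𝓕 Z E h j hj
    obtain ⟨i, -, e⟩ := hg 𝓕 j hj
    rw [e]; exact hsub h (Sum.inr i)
  have hge : ∀ {𝓕 : FactorFamily V 2 (2 * (2 * k + 2))} {Z : Set V} {E},
      IsFractionalFactorization Z E 𝓕 → ∀ j < 2 * k + 1, IsEulerianEdgeSet (g 𝓕 j) := by
    intro 𝓕 Z E h j hj
    obtain ⟨i, -, e⟩ := hg 𝓕 j hj
    rw [e]; exact h.eulerian_F i
  have hgm : ∀ {𝓕 : FactorFamily V 2 (2 * (2 * k + 2))} {Z : Set V} {E},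
      IsFractionalFactorization Z E 𝓕 → ∀ v ∈ Z, ∀ j < 2 * k + 1,
        edgeDeg (g 𝓕 j) v = 2 * edgeDeg (𝓕.M 0) v := by
    intro 𝓕 Z E h v hv j hj
    obtain ⟨i, -, e⟩ := hg 𝓕 j hj
    rw [e]
    have h1 := h.edgeDeg_F hv i
    have h2 := h.edgeDeg_M hv 0
    have : (2 * k + 2) * edgeDeg (𝓕.F i) v = (2 * k + 2) * (2 * edgeDeg (𝓕.M 0) v) := by
      rw [h1, ← h2]; ring
    exact Nat.eq_of_mul_eq_mul_left (by omega) this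
  have hM01 : ∀ v ∈ A, edgeDeg (𝓕₁.M 1) v = edgeDeg (𝓕₁.M 0) v := by
    intro v hv
    have h1 := h₁.edgeDeg_M hv 0
    have h2 := h₁.edgeDeg_M hv 1
    exact Nat.eq_of_mul_eq_mul_left (by omega) (h2.trans h1.symm)
  let m (v : V) : ℕ := if v ∈ A then edgeDeg (𝓕₁.M 0) v else edgeDeg (𝓕₂.M 0) v
  have hmA : ∀ v ∈ A, m v = edgeDeg (𝓕₁.M 0) v := fun v hv => if_pos hv
  have hmB : ∀ v ∈ B, m v = edgeDeg (𝓕₂.M 0) v := fun v hv =>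
    if_neg (disjoint_right.1 hAB hv)
  have hlarge : ∀ v, v ∈ A ∪ B → k + 2 ≤ m v := by
    intro v hv
    rcases mem_union.1 hv with hv | hv
    · have h1 := hs₁ v hv
      rw [← h₁.edgeDeg_M hv 0] at h1
      rw [hmA v hv]
      exact Nat.le_of_mul_le_mul_left h1 (by omega)
    · have h1 := hs₂ v hv
      rw [← h₂.edgeDeg_M hv 0] at h1
      rw [hmB v hv]
      exact Nat.le_of_mul_le_mul_left h1 (by omega)
  have hMsub : 𝓕₁.M 0 ∪ 𝓕₁.M 1 ⊆ E₁ := union_subset (hsub h₁ (Sum.inl 0)) (hsub h₁ (Sum.inl 1))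
  obtain ⟨U, u1, u2, u3, u4, u5, u6, u7⟩ := exists_levels (k := k) (A := A) (B := B)
    (M := 𝓕₁.M 0) (N := 𝓕₁.M 1) (f₁ := g 𝓕₁) (f₂ := fun j => g 𝓕₂ (k + j)) (m := m) hk hAB
    (fun e he => hb₁ e (hsub h₁ (Sum.inl 0) he)) (fun e he => hb₁ e (hsub h₁ (Sum.inl 1) he))
    (fun j hj e he => hb₁ e (hgs h₁ j (by omega) he))
    (fun j hj e he => hb₂ e (hgs h₂ (k + j) (by omega) he))
    (fun j hj => hge h₁ j (by omega)) (fun j hj => hge h₂ (k + j) (by omega))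
    (h₁.disjoint (Sum.inl 0) (Sum.inl 1) (by simp))
    (fun i hi j hj hij => hgd h₁ i (by omega) j (by omega) hij)
    (fun i hi j hj hij => hgd h₂ (k + i) (by omega) (k + j) (by omega) (by omega))
    (fun i hi j hj => hd.mono (hgs h₁ i (by omega)) (hgs h₂ (k + j) (by omega)))
    (fun j hj => by
      obtain ⟨i, -, e⟩ := hg 𝓕₁ j (by omega)
      rw [e, disjoint_union_left]
      exact ⟨h₁.disjoint (Sum.inl 0) (Sum.inr i) (by simp),
        h₁.disjoint (Sum.inl 1) (Sum.inr i) (by simp)⟩)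
    (fun j hj => hd.mono hMsub (hgs h₂ (k + j) (by omega)))
    (fun v hv => (hmA v hv).symm) (fun v hv => by rw [hM01 v hv, hmA v hv])
    (fun v hv j hj => by rw [hgm h₁ v hv j (by omega), hmA v hv])
    (fun v hv j hj => by rw [hgm h₂ v hv (k + j) (by omega), hmB v hv])
  obtain ⟨ι, i1, i2, P, loc, p1, p2, p3, p4, p5⟩ := exists_half hAB hlarge u1 u2 u4 u5 u6
  have hiff : ∀ e, (∃ t ≤ k, e ∈ U t) ↔ 𝓕₁.lower e ∨ 𝓕₂.upper e := by
    intro e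
    rw [u3, ← or_assoc]
    refine or_congr (or_congr_right ?_) ?_
    · constructor
      · rintro ⟨j, hj, he⟩
        obtain ⟨i, rfl, e'⟩ := hg 𝓕₁ j (by omega)
        exact ⟨i, hj, e' ▸ he⟩
      · rintro ⟨i, hi, he⟩
        exact ⟨i.1, hi, by rwa [← hgF]⟩
    · constructor
      · rintro ⟨j, hj, he⟩
        obtain ⟨i, e1, e'⟩ := hg 𝓕₂ (k + j) (by omega)
        exact ⟨i, by omega, e' ▸ he⟩
      · rintro ⟨i, hi, he⟩
        have := i.2
        refine ⟨i.1 - k, by omega, ?_⟩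
        rwa [Nat.add_sub_cancel' hi, ← hgF]
  refine ⟨ι, i1, i2, P, loc, p1, p2, p3, ?_, ?_⟩
  · intro x hx y hy
    rw [p4 x hx y hy]
    refine ⟨fun h => if_pos ((hiff _).2 h), fun h => if_neg fun h' => h ((hiff _).1 h')⟩
  · intro x hx
    rw [p5 x hx, u7 x hx, hmB x hx, ← h₂.edgeDeg_M hx 0]
    ring

theorem edgeCount_sum {ι κ : Type*} [Fintype ι] [Fintype κ] (P : ι → List V) (Q : κ → List V)
    (e : Sym2 V) : edgeCount (Sum.elim P Q) e = edgeCount P e + edgeCount Q e := by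
  simp [edgeCount]

end Bifactorization

theorem mainTheorem6 {V : Type*} [Fintype V] [DecidableEq V] (k : ℕ) (hk : 0 < k)
    (G : SimpleGraph V) (A₁ A₂ : Set V)
    (hA : IsCompl A₁ A₂) (hG : G.IsBipartiteWith A₁ A₂)
    (𝓕₁ 𝓕₂ : FactorFamily V 2 (2 * (2 * k + 2)))
    (hF : IsStrongBifactorization G A₁ A₂ 𝓕₁ 𝓕₂) :
    ∃ 𝓑 : Finset (Tracking G),
      IsPathTrackingDecomposition (2 * k + 2) 𝓑 ∧ IsBalanced A₁ A₂ 𝓕₁ 𝓕₂ 𝓑 := by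
  classical
  obtain ⟨A, rfl⟩ : ∃ A : Finset V, A₁ = A := ⟨A₁.toFinset, by simp⟩
  obtain ⟨B, rfl⟩ : ∃ B : Finset V, A₂ = B := ⟨A₂.toFinset, by simp⟩
  have hAB : Disjoint A B := disjoint_coe.1 hA.disjoint
  have hG' : ∀ e, e ∈ G.edgeSet ↔ e ∈ 𝓕₁.edges ∨ e ∈ 𝓕₂.edges := by
    intro e; rw [← hF.union]; simp
  have hbet : ∀ e ∈ G.edgeSet, ∃ x ∈ A, ∃ y ∈ B, e = s(x, y) := by
    intro e he
    induction e with
    | h u v =>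
      rcases hG.mem_of_adj ((SimpleGraph.mem_edgeSet G).1 he) with h | h
      · exact ⟨u, h.1, v, h.2, rfl⟩
      · exact ⟨v, h.2, u, h.1, Sym2.eq_swap⟩
  have hb₁ : IsBetween A B 𝓕₁.edges := fun e he => hbet e ((hG' e).2 (Or.inl he))
  have hb₂ : IsBetween A B 𝓕₂.edges := fun e he => hbet e ((hG' e).2 (Or.inr he))
  have hstrong : ∀ d : ℕ, strongBound 2 (2 * (2 * k + 2)) ≤ (d : ℚ) →
      2 * (2 * k + 2) * (k + 2) ≤ d := by
    intro d hd
    have h2 : ¬ Odd 2 := by decide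
    simp only [strongBound, if_neg h2] at hd
    push_cast at hd
    have : ((2 * (2 * k + 2) * (k + 2) : ℕ) : ℚ) ≤ d := by
      push_cast; linarith
    exact_mod_cast this
  have hs₁ := fun v hv => hstrong _ (hF.strong₁ v hv)
  have hs₂ := fun v hv => hstrong _ (hF.strong₂ v hv)
  obtain ⟨ι, _, _, P, pos, p1, p2, p3, p4, p5⟩ := exists_paths_of_factorizations hk hAB
    hF.factorization₁ hF.factorization₂ hF.disjoint hb₁ hb₂ hs₁ hs₂
  obtain ⟨κ, _, _, Q, qos, q1, q2, q3, q4, q5⟩ := exists_paths_of_factorizations hk hAB.symm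
    hF.factorization₂ hF.factorization₁ hF.disjoint.symm hb₂.symm hb₁.symm hs₂ hs₁
  have hmem : ∀ (X Y : Finset V) (a b : V) (l : List V), IsAltPath X Y a b l →
      (∀ x ∈ X, ∀ y ∈ Y, s(x, y) ∈ pathEdges l → s(x, y) ∈ G.edgeSet) →
      ∀ e ∈ pathEdges l, e ∈ G.edgeSet := by
    intro X Y a b l hl h e he
    obtain ⟨x, hx, y, hy, rfl⟩ := hl.exists_mem_of_mem_pathEdges he
    exact h x hx y hy he
  have hposP : ∀ i, ∀ x ∈ B, ∀ y ∈ A, s(x, y) ∈ pathEdges (P i) → s(x, y) ∈ G.edgeSet := by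
    intro i x hx y hy h
    have h1 := one_le_edgeCount h
    rw [hG', mem_edges_iff, mem_edges_iff]
    by_contra hcon
    rw [(p4 x hx y hy).2 (by tauto)] at h1
    omega
  have hposQ : ∀ i, ∀ x ∈ A, ∀ y ∈ B, s(x, y) ∈ pathEdges (Q i) → s(x, y) ∈ G.edgeSet := by
    intro i x hx y hy h
    have h1 := one_le_edgeCount h
    rw [hG', mem_edges_iff, mem_edges_iff]
    by_contra hcon
    rw [(q4 x hx y hy).2 (by tauto)] at h1
    omega
  have hcount : ∀ e ∈ G.edgeSet, edgeCount (Sum.elim P Q) e = 1 := by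
    intro e he
    obtain ⟨x, hx, y, hy, rfl⟩ := hbet e he
    rw [edgeCount_sum]
    have hp := p4 y hy x hx
    rw [Sym2.eq_swap] at hp
    have hq := q4 x hx y hy
    have hd : s(x, y) ∈ 𝓕₁.edges → s(x, y) ∉ 𝓕₂.edges :=
      fun h => disjoint_left.1 hF.disjoint h
    rw [hG'] at he
    simp only [mem_edges_iff] at hd he
    have h1 := hF.factorization₁.not_lower_and_upper (e := s(x, y))
    have h2 := hF.factorization₂.not_lower_and_upper (e := s(x, y))
    by_cases hc : 𝓕₁.lower s(x, y) ∨ 𝓕₂.upper s(x, y)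
    · rw [hp.1 hc, hq.2 (by tauto)]
    · rw [hp.2 hc, hq.1 (by tauto)]
  let loc (α : (ι ⊕ κ) × Bool) : V := Sum.elim (fun i => pos (i, α.2)) (fun i => qos (i, α.2)) α.1
  obtain ⟨𝓑, h1, h2⟩ := exists_decomposition (G := G) (l := 2 * k + 2) (by omega)
    (P := Sum.elim P Q) (loc := loc)
    (by rintro (i | i); exacts [(p1 i).head, (q1 i).head])
    (by rintro (i | i); exacts [(p1 i).last, (q1 i).last])
    (by rintro (i | i); exacts [(p1 i).nodup, (q1 i).nodup])
    (by rintro (i | i); exacts [p3 i, q3 i])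
    (by rintro (i | i); exacts [hmem _ _ _ _ _ (p1 i) (hposP i), hmem _ _ _ _ _ (q1 i) (hposQ i)])
    hcount
  have hends : ∀ v, #(endsAt loc v) = #(endsAt pos v) + #(endsAt qos v) := by
    intro v
    simp only [endsAt, card_filter, Fintype.sum_prod_type, Fintype.sum_sum_type, loc, Sum.elim_inl,
      Sum.elim_inr]
    rfl
  have hcast : ∀ a b c d : ℕ, (2 * k + 2) * a = b + (2 * k + 2) * (c + d) →
      (a : ℚ) = (b : ℚ) / (2 * (k : ℚ) + 2) + (c : ℚ) + (d : ℚ) := by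
    intro a b c d h
    have h' : (2 * (k : ℚ) + 2) * a = b + (2 * k + 2) * (c + d) := by exact_mod_cast h
    have : (2 * (k : ℚ) + 2) ≠ 0 := by positivity
    field_simp
    linarith
  refine ⟨𝓑, h1, fun v hv => ?_, fun v hv => ?_⟩
  · have h0 : #(endsAt pos v) = 0 := by
      rw [card_eq_zero, endsAt, filter_eq_empty_iff]
      rintro α - rfl
      exact disjoint_left.1 hAB hv (p2 α)
    rw [h2, hends, h0, zero_add]
    exact hcast _ _ _ _ (q5 v hv)
  · have h0 : #(endsAt qos v) = 0 := by
      rw [card_eq_zero, endsAt, filter_eq_empty_iff]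
      rintro α - rfl
      exact disjoint_left.1 hAB (q2 α) hv
    rw [h2, hends, h0, add_zero]
    exact hcast _ _ _ _ (p5 v hv)
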